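/- **Conventions.** All 2-categories are small and strict, and 2-functors and 2-natural transformations are strict. A category is regarded as a 2-category with only identity 2-cells. Let $\underline{\mathbf{2Cat}}$ be the 2-category of 2-categories, 2-functors and 2-natural transformations. The nerve of a 2-category $A$ is the simplicial category $\mathrm{N}A$ with $$\mathrm{N}_pA=\coprod_{a_0,\dots,a_p}A(a_0,a_1)\times\cdots\times A(a_{p-1},a_p),$$ and the classifying space of $A$ is the geometric realization $\|A\|=|\mathrm{Diag}\,\mathrm{N}\mathrm{N}A|$ of the simplicial set $[p]\mapsto \mathrm{N}_p\mathrm{N}_pA$. A 2-functor $F:A\to B$ is a *weak equivalence* if the induced map $\|A\|\to\|B\|$ is a homotopy equivalence. The classifying space of a simplicial 2-category $S$ is the geometric realization $\|S\|$ of the simplicial set $[p]\mapsto \mathrm{N}_p\mathrm{N}_pS_p$. For a 2-category $C$ and a 2-functor $D:C\to\underline{\mathbf{2Cat}}$, with action on cells written $D_c$, $f_*$, $\alpha_*$, the homotopy colimit $\mathrm{hocolim}_C D$ is the simplicial 2-category with 2-category of $p$-simplices $$\coprod_{c_0,\dots,c_p}D_{c_0}\times C(c_0,c_1)\times\cdots\times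 C(c_{p-1},c_p).$$ Its face $d_0$ is induced by the 2-functor $D_{c_0}\times C(c_0,c_1)\to D_{c_1}$ that sends $(x,f)$ to $f_*x$, a 1-cell $(u,\alpha):(x,f)\to(y,g)$ to $g_*u\circ\alpha_*x$, and a 2-cell $(\phi,1_\alpha)$ to $g_*\phi\circ 1_{\alpha_*x}$; the other faces and the degeneracies are $1_{D_{c_0}}\times d_i$ and $1_{D_{c_0}}\times s_i$, with $d_i,s_i$ those of $\mathrm{N}C$. For a 2-functor $D:C^{\mathrm{op}}\to\underline{\mathbf{2Cat}}$ (where $C^{\mathrm{op}}$ reverses the 1-cells only), with action on cells written $D_c$, $f^*$, $\alpha^*$, the homotopy colimit $\mathrm{hocolim}_C D$ has 2-category of $p$-simplices $$\coprod_{c_0,\dots,c_p}C(c_0,c_1)\times\cdots\times C(c_{p-1},c_p)\times D_{c_p};$$ its face $d_p$ is induced by the 2-functor $C(c_{p-1},c_p)\times D_{c_p}\to D_{c_{p-1}}$ given by the same formulas with $f^*,g^*,\alpha^*$ in place of $f_*,g_*,\alpha_*$, and its other faces and degeneracies come from those of $\mathrm{N}C$. A 2-natural transformation $\Gamma:D\Rightarrow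 E$ induces a morphism $\Gamma_*:\mathrm{hocolim}_CD\to\mathrm{hocolim}_CE$ of simplicial 2-categories, given on the summands by $\Gamma_{c_0}\times 1$ (respectively $1\times\Gamma_{c_p}$). **Theorem (Homotopy Invariance).** Let $C$ be a 2-category, let $D,E:C\to\underline{\mathbf{2Cat}}$ (or $D,E:C^{\mathrm{op}}\to\underline{\mathbf{2Cat}}$) be 2-functors, and let $\Gamma:D\Rightarrow E$ be a 2-natural transformation such that for every object $c$ of $C$ the 2-functor $\Gamma_c:D_c\to E_c$ is a weak equivalence. Then the induced map $$\Gamma_*:\|\mathrm{hocolim}_C D\|\longrightarrow\|\mathrm{hocolim}_C E\|$$ is a homotopy equivalence. -/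

import Mathlib

open CategoryTheory Bicategory Opposite

universe w₁ w₂ w₃ v₁ v₂ v₃ u₁ u₂ u₃ u

namespace TwoCategory

section
variable {B : Type u₁} [Bicategory.{w₁, v₁} B] {C : Type u₂} [Bicategory.{w₂, v₂} C]

/-- 2-functors that agree on objects, 1-cells and 2-cells are equal. -/
theorem twoFunctor_ext {F G : StrictPseudofunctor B C}
    (h₀ : ∀ x, F.obj x = G.obj x)
    (h₁ : ∀ {x y : B} (f : x ⟶ y), F.map f ≍ G.map f)
    (h₂ : ∀ {x y : B} {f g : x ⟶ y} (η : f ⟶ g), F.map₂ η ≍ G.map₂ η) : F = G := by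
  obtain ⟨⟨⟨⟨⟨⟨Fo, Fm⟩, Fm₂⟩, _, _⟩, Fid, Fcomp, _, _, _, _, _⟩, Fi, Fie⟩, Fc, Fce⟩ := F
  obtain ⟨⟨⟨⟨⟨⟨Go, Gm⟩, Gm₂⟩, _, _⟩, Gid, Gcomp, _, _, _, _, _⟩, Gi, Gie⟩, Gc, Gce⟩ := G
  dsimp at h₀ h₁ h₂ Fi Gi Fc Gc Fie Gie Fce Gce
  obtain rfl : Fo = Go := funext h₀
  obtain rfl : @Fm = @Gm := by
    funext x y f; exact eq_of_heq (h₁ f)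
  obtain rfl : @Fm₂ = @Gm₂ := by
    funext x y f g η; exact eq_of_heq (h₂ η)
  obtain rfl : @Fid = @Gid := by
    funext x; rw [Fie, Gie]
  obtain rfl : @Fcomp = @Gcomp := by
    funext x y z f g; rw [Fce, Gce]
  rfl

theorem map₂_whiskerRight_heq (K : StrictPseudofunctor B C) {a b c : B}
    {f g : a ⟶ b} (η : f ⟶ g) (h : b ⟶ c) : K.map₂ (η ▷ h) ≍ K.map₂ η ▷ K.map h := by
  simp [K.map₂_whisker_right, K.mapComp_eq_eqToIso]

theorem map₂_whiskerLeft_heq (K : StrictPseudofunctor B C) {a b c : B}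
    (f : a ⟶ b) {g h : b ⟶ c} (η : g ⟶ h) : K.map₂ (f ◁ η) ≍ K.map f ◁ K.map₂ η := by
  simp [K.map₂_whisker_left, K.mapComp_eq_eqToIso]

theorem map₂_heq {K : StrictPseudofunctor B C} {a b : B}
    {f g f' g' : a ⟶ b} {η : f ⟶ g} {η' : f' ⟶ g'} (hf : f = f') (hg : g = g') (h : η ≍ η') :
    K.map₂ η ≍ K.map₂ η' := by
  subst hf hg; cases h; rfl

/-- A 2-natural transformation between 2-functors: it is strictly natural with respect to
1-cells and 2-cells. -/
@[ext]
structure TwoNatTrans (F G : StrictPseudofunctor B C) where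
  app (a : B) : F.obj a ⟶ G.obj a
  naturality {a b : B} (f : a ⟶ b) : F.map f ≫ app b = app a ≫ G.map f
  naturality₂ {a b : B} {f g : a ⟶ b} (η : f ⟶ g) :
    F.map₂ η ▷ app b ≫ eqToHom (naturality g) = eqToHom (naturality f) ≫ app a ◁ G.map₂ η

namespace TwoNatTrans

/-- Naturality with respect to 2-cells, as a heterogeneous equality. -/
theorem naturality₂_heq {F G : StrictPseudofunctor B C} (σ : TwoNatTrans F G)
    {a b : B} {f g : a ⟶ b} (η : f ⟶ g) :
    F.map₂ η ▷ σ.app b ≍ σ.app a ◁ G.map₂ η := by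
  have h := σ.naturality₂ η
  rw [← comp_eqToHom_heq_iff (F.map₂ η ▷ σ.app b) _ (σ.naturality g), h]
  simp

end TwoNatTrans
end

section
variable {B : Type u₁} [Bicategory.{w₁, v₁} B] {C : Type u₂} [Bicategory.{w₂, v₂} C] [Strict C]

/-- Associativity of whiskerings. -/
theorem whiskerRight_comp_heq {a b c d : C} {f f' : a ⟶ b} (η : f ⟶ f') (g : b ⟶ c) (h : c ⟶ d) :
    η ▷ (g ≫ h) ≍ (η ▷ g) ▷ h := by
  simp [whiskerRight_comp, Strict.associator_eqToIso]

theorem comp_whiskerLeft_heq {a b c d : C} (f : a ⟶ b) (g : b ⟶ c) {h h' : c ⟶ d} (η : h ⟶ h') :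
    (f ≫ g) ◁ η ≍ f ◁ g ◁ η := by
  simp [comp_whiskerLeft, Strict.associator_eqToIso]

theorem whisker_assoc_heq {a b c d : C} (f : a ⟶ b) {g g' : b ⟶ c} (η : g ⟶ g') (h : c ⟶ d) :
    (f ◁ η) ▷ h ≍ f ◁ (η ▷ h) := by
  simp [whisker_assoc, Strict.associator_eqToIso]

theorem id_whiskerLeft_heq {a b : C} {f f' : a ⟶ b} (η : f ⟶ f') : 𝟙 a ◁ η ≍ η := by
  simp [id_whiskerLeft, Strict.leftUnitor_eqToIso]

theorem whiskerRight_id_heq {a b : C} {f f' : a ⟶ b} (η : f ⟶ f') : η ▷ 𝟙 b ≍ η := by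
  simp [whiskerRight_id, Strict.rightUnitor_eqToIso]

theorem whiskerLeft_heq {a b c : C} {f f' : a ⟶ b} {g₁ g₂ h₁ h₂ : b ⟶ c} {η : g₁ ⟶ h₁}
    {θ : g₂ ⟶ h₂} (hf : f = f') (hg : g₁ = g₂) (hh : h₁ = h₂) (h : η ≍ θ) :
    f ◁ η ≍ f' ◁ θ := by
  subst hf hg hh; cases h; rfl

theorem whiskerRight_heq {a b c : C} {g g' : b ⟶ c} {f₁ f₂ h₁ h₂ : a ⟶ b} {η : f₁ ⟶ h₁}
    {θ : f₂ ⟶ h₂} (hg : g = g') (hf : f₁ = f₂) (hh : h₁ = h₂) (h : η ≍ θ) :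
    η ▷ g ≍ θ ▷ g' := by
  subst hg hf hh; cases h; rfl

namespace TwoNatTrans

/-- A 2-natural transformation, from 2-cell naturality given as a heterogeneous equality. -/
@[simps]
def ofHEq {F G : StrictPseudofunctor B C} (app : ∀ a, F.obj a ⟶ G.obj a)
    (nat : ∀ {a b : B} (f : a ⟶ b), F.map f ≫ app b = app a ≫ G.map f)
    (nat₂ : ∀ {a b : B} {f g : a ⟶ b} (η : f ⟶ g), F.map₂ η ▷ app b ≍ app a ◁ G.map₂ η) :
    TwoNatTrans F G where
  app := app
  naturality := nat
  naturality₂ η := by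
    apply eq_of_heq
    rw [comp_eqToHom_heq_iff, heq_eqToHom_comp_iff]
    exact nat₂ η

/-- The identity 2-natural transformation. -/
def id (F : StrictPseudofunctor B C) : TwoNatTrans F F :=
  ofHEq (fun a => 𝟙 (F.obj a)) (fun f => by simp)
    (fun η => (whiskerRight_id_heq _).trans (id_whiskerLeft_heq _).symm)

/-- Vertical composition of 2-natural transformations. -/
def vcomp {F G H : StrictPseudofunctor B C} (σ : TwoNatTrans F G) (τ : TwoNatTrans G H) :
    TwoNatTrans F H :=
  ofHEq (fun a => σ.app a ≫ τ.app a)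
    (fun f => by
      rw [← Strict.assoc, σ.naturality, Strict.assoc, τ.naturality, Strict.assoc])
    (fun {a b f g} η => by
      refine (whiskerRight_comp_heq _ _ _).trans ?_
      refine (whiskerRight_heq rfl (σ.naturality f) (σ.naturality g) (σ.naturality₂_heq η)).trans ?_
      refine (whisker_assoc_heq _ _ _).trans ?_
      refine (whiskerLeft_heq rfl (τ.naturality f) (τ.naturality g) (τ.naturality₂_heq η)).trans ?_
      exact (comp_whiskerLeft_heq _ _ _).symm)

instance : Category (StrictPseudofunctor B C) where
  Hom F G := TwoNatTrans F G
  id F := id F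
  comp σ τ := vcomp σ τ
  id_comp σ := by
    apply TwoNatTrans.ext; funext a; exact Strict.id_comp _
  comp_id σ := by
    apply TwoNatTrans.ext; funext a; exact Strict.comp_id _
  assoc σ τ υ := by
    apply TwoNatTrans.ext; funext a; exact Strict.assoc _ _ _

@[ext]
theorem hom_ext {F G : StrictPseudofunctor B C} {σ τ : F ⟶ G}
    (h : ∀ a, TwoNatTrans.app σ a = TwoNatTrans.app τ a) : σ = τ :=
  TwoNatTrans.ext (funext h)

end TwoNatTrans
end
/-- A small (strict) 2-category. -/
structure TwoCat where
  carrier : Type u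
  [bicategory : Bicategory.{u, u} carrier]
  [strict : Strict carrier]

namespace TwoCat

instance : CoeSort TwoCat.{u} (Type u) := ⟨TwoCat.carrier⟩

attribute [instance] TwoCat.bicategory TwoCat.strict

/-- Whiskering of a 2-natural transformation with a 2-functor on the source side. -/
def whiskerL {A B C : TwoCat.{u}} (F : StrictPseudofunctor A B) {G H : StrictPseudofunctor B C}
    (σ : TwoNatTrans G H) : TwoNatTrans (F.comp G) (F.comp H) where
  app a := σ.app (F.obj a)
  naturality f := σ.naturality (F.map f)
  naturality₂ η := σ.naturality₂ (F.map₂ η)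

/-- Whiskering of a 2-natural transformation with a 2-functor on the target side. -/
def whiskerR {A B C : TwoCat.{u}} {F G : StrictPseudofunctor A B} (σ : TwoNatTrans F G)
    (K : StrictPseudofunctor B C) : TwoNatTrans (F.comp K) (G.comp K) :=
  TwoNatTrans.ofHEq (fun a => K.map (σ.app a))
    (fun f => by
      change K.map (F.map f) ≫ K.map _ = K.map _ ≫ K.map (G.map f)
      rw [← K.map_comp, ← K.map_comp, σ.naturality])
    (fun {a b f g} η => by
      change K.map₂ (F.map₂ η) ▷ K.map (σ.app b) ≍ K.map (σ.app a) ◁ K.map₂ (G.map₂ η)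
      refine (map₂_whiskerRight_heq K _ _).symm.trans ?_
      refine HEq.trans ?_ (map₂_whiskerLeft_heq K _ _)
      exact map₂_heq (σ.naturality f) (σ.naturality g) (σ.naturality₂_heq η))

theorem id_comp' {A B : TwoCat.{u}} (F : StrictPseudofunctor A B) :
    (StrictPseudofunctor.id A).comp F = F :=
  twoFunctor_ext (fun _ => rfl) (fun _ => HEq.rfl) (fun _ => HEq.rfl)

theorem comp_id' {A B : TwoCat.{u}} (F : StrictPseudofunctor A B) :
    F.comp (StrictPseudofunctor.id B) = F :=
  twoFunctor_ext (fun _ => rfl) (fun _ => HEq.rfl) (fun _ => HEq.rfl)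

theorem assoc' {A B C D : TwoCat.{u}} (F : StrictPseudofunctor A B)
    (G : StrictPseudofunctor B C) (H : StrictPseudofunctor C D) :
    (F.comp G).comp H = F.comp (G.comp H) :=
  twoFunctor_ext (fun _ => rfl) (fun _ => HEq.rfl) (fun _ => HEq.rfl)

theorem conj_app {A B : TwoCat.{u}} {F F' G G' : StrictPseudofunctor A B} (h : F = F')
    (h' : G' = G) (σ : F' ⟶ G') (a : A) :
    TwoNatTrans.app (eqToHom h ≫ σ ≫ eqToHom h') a ≍ TwoNatTrans.app σ a := by
  subst h h'; simp

theorem whiskerL_eqToHom {A B C : TwoCat.{u}} (F : StrictPseudofunctor A B)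
    {G H : StrictPseudofunctor B C} (h : G = H) :
    whiskerL F (eqToHom h : G ⟶ H) =
      (eqToHom (congrArg F.comp h) : F.comp G ⟶ F.comp H) := by
  subst h; rfl

theorem whiskerR_eqToHom {A B C : TwoCat.{u}} {F G : StrictPseudofunctor A B} (h : F = G)
    (K : StrictPseudofunctor B C) :
    whiskerR (eqToHom h : F ⟶ G) K =
      (eqToHom (congrArg (fun X => X.comp K) h) : F.comp K ⟶ G.comp K) := by
  subst h; apply TwoNatTrans.hom_ext; intro a; exact K.map_id _

theorem pentagon' {A B C D E : TwoCat.{u}} (F : StrictPseudofunctor A B)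
    (G : StrictPseudofunctor B C) (H : StrictPseudofunctor C D) (K : StrictPseudofunctor D E) :
    (show ((F.comp G).comp H).comp K ⟶ (F.comp (G.comp H)).comp K from
        whiskerR (eqToHom (assoc' F G H)) K) ≫
      (show _ ⟶ F.comp ((G.comp H).comp K) from eqToHom (assoc' F (G.comp H) K)) ≫
      (show _ ⟶ F.comp (G.comp (H.comp K)) from whiskerL F (eqToHom (assoc' G H K))) =
    (show _ ⟶ (F.comp G).comp (H.comp K) from eqToHom (assoc' (F.comp G) H K)) ≫
      eqToHom (assoc' F G (H.comp K)) := by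
  have h₁ := whiskerR_eqToHom (assoc' F G H) K
  have h₂ := whiskerL_eqToHom F (assoc' G H K)
  dsimp only
  rw [h₁, h₂]
  exact (eqToHom_trans_assoc _ _ _).trans ((eqToHom_trans _ _).trans (eqToHom_trans _ _).symm)

theorem triangle' {A B C : TwoCat.{u}} (F : StrictPseudofunctor A B)
    (G : StrictPseudofunctor B C) :
    (show (F.comp (StrictPseudofunctor.id B)).comp G ⟶
        F.comp ((StrictPseudofunctor.id B).comp G) from eqToHom (assoc' F (StrictPseudofunctor.id B) G)) ≫
      (show _ ⟶ F.comp G from whiskerL F (eqToHom (id_comp' G))) =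
    whiskerR (eqToHom (comp_id' F)) G := by
  have h₁ := whiskerR_eqToHom (comp_id' F) G
  have h₂ := whiskerL_eqToHom F (id_comp' G)
  dsimp only
  rw [h₁, h₂]
  exact eqToHom_trans _ _

/-- The underlying structure of 2-categories and 2-functors. -/
instance : CategoryStruct TwoCat.{u} where
  Hom A B := StrictPseudofunctor A B
  id A := StrictPseudofunctor.id A
  comp F G := StrictPseudofunctor.comp F G

/-- The 2-category of small 2-categories, 2-functors and 2-natural transformations. -/
instance : Bicategory TwoCat.{u} where
  homCategory A B := inferInstanceAs (Category (StrictPseudofunctor A B))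
  whiskerLeft F _ _ σ := whiskerL F σ
  whiskerRight σ K := whiskerR σ K
  associator {A _ _ D} F G H := eqToIso (C := StrictPseudofunctor A D) (assoc' F G H)
  leftUnitor {A B} F := eqToIso (C := StrictPseudofunctor A B) (id_comp' F)
  rightUnitor {A B} F := eqToIso (C := StrictPseudofunctor A B) (comp_id' F)
  whiskerLeft_id F G := rfl
  whiskerLeft_comp F _ _ _ σ τ := rfl
  id_whiskerLeft σ := by
    apply TwoNatTrans.hom_ext; intro a; exact (eq_of_heq (conj_app (id_comp' _) (id_comp' _).symm σ a)).symm
  comp_whiskerLeft F G _ _ σ := by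
    apply TwoNatTrans.hom_ext; intro a; exact (eq_of_heq (conj_app (assoc' _ _ _) (assoc' _ _ _).symm (whiskerL F (whiskerL G σ)) a)).symm
  id_whiskerRight F G := by
    apply TwoNatTrans.hom_ext; intro a; exact G.map_id _
  comp_whiskerRight σ τ K := by
    apply TwoNatTrans.hom_ext; intro a; exact K.map_comp _ _
  whiskerRight_id σ := by
    apply TwoNatTrans.hom_ext; intro a; exact (eq_of_heq (conj_app (comp_id' _) (comp_id' _).symm σ a)).symm
  whiskerRight_comp σ G H := by
    apply TwoNatTrans.hom_ext; intro a; exact (eq_of_heq (conj_app (assoc' _ _ _).symm (assoc' _ _ _) (whiskerR (whiskerR σ G) H) a)).symm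
  whisker_assoc F _ _ σ H := by
    apply TwoNatTrans.hom_ext; intro a; exact (eq_of_heq (conj_app (assoc' _ _ _) (assoc' _ _ _).symm (whiskerL F (whiskerR σ H)) a)).symm
  whisker_exchange σ τ := by
    apply TwoNatTrans.hom_ext; intro a
    exact (TwoNatTrans.naturality τ (TwoNatTrans.app σ a)).symm
  pentagon F G H K := pentagon' F G H K
  triangle F G := triangle' F G

instance : Strict TwoCat.{u} where
  id_comp := id_comp'
  comp_id := comp_id'
  assoc := assoc'

end TwoCat
section Chains

variable {ι κ : Type} [Preorder ι] [Preorder κ]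
variable {B : Type u₁} [Bicategory.{w₁, v₁} B] {B' : Type u₂} [Bicategory.{w₂, v₂} B']

/-- Horizontal composition of 2-cells. -/
def hcomp {a b c : B} {f f' : a ⟶ b} {g g' : b ⟶ c} (α : f ⟶ f') (β : g ⟶ g') :
    f ≫ g ⟶ f' ≫ g' :=
  α ▷ g ≫ f' ◁ β

/-- A composable chain of 1-cells through given objects `c i`, recorded together with all its
composites `c i ⟶ c j`. For `ι = Fin (n + 1)` this is the same as a family of `n` consecutive
1-cells, that is, an element of `C(c₀, c₁) × ⋯ × C(cₙ₋₁, cₙ)`. -/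
@[ext]
structure Chain (c : ι → B) where
  hom {i j : ι} (h : i ≤ j) : c i ⟶ c j
  hom_refl (i : ι) : hom (le_refl i) = 𝟙 (c i)
  hom_trans {i j k : ι} (h : i ≤ j) (h' : j ≤ k) : hom (h.trans h') = hom h ≫ hom h'

/-- A family of 2-cells between the 1-cells of two chains through the same objects, recorded
together with all its horizontal composites. For `ι = Fin (n + 1)` this is the same as a family of
`n` 2-cells between the consecutive 1-cells, that is, a morphism of the product category
`C(c₀, c₁) × ⋯ × C(cₙ₋₁, cₙ)`. -/
@[ext]
structure ChainHom {c : ι → B} (f g : Chain c) where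
  cell {i j : ι} (h : i ≤ j) : f.hom h ⟶ g.hom h
  cell_refl (i : ι) : cell (le_refl i) ≍ 𝟙 (𝟙 (c i))
  cell_trans {i j k : ι} (h : i ≤ j) (h' : j ≤ k) :
    cell (h.trans h') ≍ hcomp (cell h) (cell h')

theorem comp_heq {A : Type u₁} [Category.{v₁} A] {x y z x' y' z' : A} {f : x ⟶ y} {g : y ⟶ z}
    {f' : x' ⟶ y'} {g' : y' ⟶ z'} (hx : x = x') (hy : y = y') (hz : z = z') (hf : f ≍ f')
    (hg : g ≍ g') : f ≫ g ≍ f' ≫ g' := by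
  subst hx hy hz; cases hf; cases hg; rfl

theorem id_heq {A : Type u₁} [Category.{v₁} A] {x y : A} (h : x = y) : 𝟙 x ≍ 𝟙 y := by
  subst h; rfl

theorem hcomp_comp {a b c : B} {f f' f'' : a ⟶ b} {g g' g'' : b ⟶ c} (α : f ⟶ f') (α' : f' ⟶ f'')
    (β : g ⟶ g') (β' : g' ⟶ g'') :
    hcomp (α ≫ α') (β ≫ β') = hcomp α β ≫ hcomp α' β' := by
  simp [hcomp, whisker_exchange_assoc]

/-- Chains through given objects form a category (with composition of 2-cells). -/
instance (c : ι → B) : Category (Chain c) where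
  Hom f g := ChainHom f g
  id f :=
    { cell h := 𝟙 (f.hom h)
      cell_refl i := id_heq (f.hom_refl i)
      cell_trans h h' := (id_heq (f.hom_trans h h')).trans (by simp [hcomp]) }
  comp {f g k} α β :=
    { cell h := α.cell h ≫ β.cell h
      cell_refl i := (comp_heq (f.hom_refl i) (g.hom_refl i) (k.hom_refl i) (α.cell_refl i)
        (β.cell_refl i)).trans (by simp)
      cell_trans h h' := (comp_heq (f.hom_trans h h') (g.hom_trans h h') (k.hom_trans h h')
        (α.cell_trans h h') (β.cell_trans h h')).trans (by rw [hcomp_comp]) }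
  id_comp α := ChainHom.ext (by funext i j h; exact Category.id_comp _)
  comp_id α := ChainHom.ext (by funext i j h; exact Category.comp_id _)
  assoc α β γ := ChainHom.ext (by funext i j h; exact Category.assoc _ _ _)

/-- Reindexing of chains along a monotone map. -/
def Chain.restrict (φ : κ →o ι) (c : ι → B) : Chain c ⥤ Chain (c ∘ φ) where
  obj f :=
    { hom h := f.hom (φ.monotone h)
      hom_refl i := f.hom_refl (φ i)
      hom_trans h h' := f.hom_trans (φ.monotone h) (φ.monotone h') }
  map α :=
    { cell h := α.cell (φ.monotone h)
      cell_refl i := α.cell_refl (φ i)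
      cell_trans h h' := α.cell_trans (φ.monotone h) (φ.monotone h') }

theorem map₂_hcomp_heq (K : StrictPseudofunctor B B') {a b c : B} {f f' : a ⟶ b} {g g' : b ⟶ c}
    (α : f ⟶ f') (β : g ⟶ g') : K.map₂ (hcomp α β) ≍ hcomp (K.map₂ α) (K.map₂ β) := by
  have h : K.map₂ (hcomp α β) = eqToHom (K.map_comp f g) ≫ hcomp (K.map₂ α) (K.map₂ β) ≫
      eqToHom (K.map_comp f' g').symm := by
    simp [hcomp, K.map₂_whisker_right, K.map₂_whisker_left, K.mapComp_eq_eqToIso]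
  rw [h, eqToHom_comp_heq_iff, comp_eqToHom_heq_iff]

/-- The image of a chain under a 2-functor. -/
def Chain.image (K : StrictPseudofunctor B B') (c : ι → B) :
    Chain c ⥤ Chain (fun i => K.obj (c i)) where
  obj f :=
    { hom h := K.map (f.hom h)
      hom_refl i := by rw [f.hom_refl, K.map_id]
      hom_trans h h' := by rw [f.hom_trans h h', K.map_comp] }
  map {f g} α :=
    { cell h := K.map₂ (α.cell h)
      cell_refl i := (map₂_heq (f.hom_refl i) (g.hom_refl i) (α.cell_refl i)).trans (by
        rw [K.map₂_id]; exact id_heq (K.map_id _))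
      cell_trans h h' := (map₂_heq (f.hom_trans h h') (g.hom_trans h h')
        (α.cell_trans h h')).trans (map₂_hcomp_heq K _ _) }
  map_id f := ChainHom.ext (by funext i j h; exact K.map₂_id _)
  map_comp α β := ChainHom.ext (by funext i j h; exact K.map₂_comp _ _)

end Chains

section Nerve

/-- The functor between disjoint unions of categories induced by a map of the index sets and
functors between the summands. -/
def sigmaFunctor {I J : Type u} {A : I → Type u} {A' : J → Type u} [∀ i, Category.{u} (A i)]
    [∀ j, Category.{u} (A' j)] (e : I → J) (F : ∀ i, A i ⥤ A' (e i)) :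
    (Σ i, A i) ⥤ (Σ j, A' j) :=
  Sigma.desc fun i => F i ⋙ Sigma.incl (e i)

theorem sigma_functor_ext {I : Type u} {A : I → Type u} [∀ i, Category.{u} (A i)] {E : Type u}
    [Category.{u} E] {F G : (Σ i, A i) ⥤ E} (h : ∀ i, Sigma.incl i ⋙ F = Sigma.incl i ⋙ G) :
    F = G := by
  refine Functor.hext (fun ⟨i, x⟩ => Functor.congr_obj (h i) x) ?_
  rintro ⟨i, x⟩ ⟨_, y⟩ ⟨f⟩
  have := Functor.congr_hom (h i) f
  dsimp at this
  exact (conj_eqToHom_iff_heq _ _ (Functor.congr_obj (h i) x) (Functor.congr_obj (h i) _)).1 this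

/-- The nerve of a 2-category `C`: the simplicial category whose category of `p`-simplices is the
disjoint union over `c₀, …, cₚ` of the categories `C(c₀, c₁) × ⋯ × C(cₚ₋₁, cₚ)`. -/
def ner (C : TwoCat.{u}) : SimplicialObject Cat.{u, u} where
  obj p := Cat.of (Σ c : Fin (p.unop.len + 1) → C, Chain c)
  map φ := (sigmaFunctor.{u} (fun (c : _ → C) => c ∘ φ.unop.toOrderHom)
    (fun c => Chain.restrict φ.unop.toOrderHom c)).toCatHom
  map_id p := by
    apply Cat.ext
    apply sigma_functor_ext
    intro c; rfl
  map_comp φ ψ := by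
    apply Cat.ext
    apply sigma_functor_ext
    intro c; rfl

/-- The nerve as a functor from 2-categories and 2-functors to simplicial categories. -/
def nerFunctor : TwoCat.{u} ⥤ SimplicialObject Cat.{u, u} where
  obj C := ner C
  map {C C'} K :=
    { app p := (sigmaFunctor.{u} (A' := fun c : Fin (p.unop.len + 1) → C' => Chain c)
        (fun (c : Fin (p.unop.len + 1) → C) i => (show StrictPseudofunctor C C' from K).obj (c i))
        (fun c => Chain.image K c)).toCatHom
      naturality p q φ := by
        apply Cat.ext
        apply sigma_functor_ext
        intro c; rfl }
  map_id C := by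
    ext p
    apply sigma_functor_ext
    intro c; rfl
  map_comp K K' := by
    ext p
    apply sigma_functor_ext
    intro c; rfl

/-- The diagonal of a bisimplicial set. -/
def diag : SimplicialObject SSet.{u} ⥤ SSet.{u} where
  obj X :=
    { obj p := (X.obj p).obj p
      map {p q} φ := (X.map φ).app p ≫ (X.obj q).map φ
      map_id p := by simp
      map_comp {p q r} φ ψ := by
        simp }
  map f :=
    { app p := (f.app p).app p
      naturality p q φ := by
        have h := congrArg (fun k => NatTrans.app k p) (f.naturality φ)
        have h' := (f.app q).naturality φ
        dsimp at h h' ⊢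
        rw [Category.assoc, h', reassoc_of% h] }
  map_id X := rfl
  map_comp f g := rfl

/-- The diagonal of the double nerve of a 2-category, with `p`-simplices `ner_p ner_p C`. -/
def diagDoubleNerve : TwoCat.{u} ⥤ SSet.{u} :=
  nerFunctor ⋙ (SimplicialObject.whiskering _ _).obj nerveFunctor ⋙ diag

/-- The classifying space functor of 2-categories. -/
noncomputable def classifyingSpace : TwoCat.{u} ⥤ TopCat.{u} :=
  diagDoubleNerve ⋙ SSet.toTop

/-- The classifying space functor of simplicial 2-categories: the geometric realization of the
simplicial set with `p`-simplices `ner_p ner_p S_p`. -/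
noncomputable def classifyingSpaceSimplicial : SimplicialObject TwoCat.{u} ⥤ TopCat.{u} :=
  (SimplicialObject.whiskering _ _).obj diagDoubleNerve ⋙ diag ⋙ SSet.toTop

/-- A continuous map is a homotopy equivalence. -/
def IsHomotopyEquivalence {X Y : TopCat.{u}} (f : X ⟶ Y) : Prop :=
  ∃ e : ContinuousMap.HomotopyEquiv X Y, e.toFun = f.hom

/-- A 2-functor is a weak equivalence if it induces a homotopy equivalence on classifying
spaces. -/
def IsWeakEquivalence {A B : TwoCat.{u}} (F : A ⟶ B) : Prop :=
  IsHomotopyEquivalence (classifyingSpace.map F)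

end Nerve

section Coproducts

variable {I : Type u} (A : I → TwoCat.{u})

/-- The disjoint union of a family of 2-categories. -/
structure Coprod where
  idx : I
  pt : A idx

namespace Coprod

variable {A}

/-- The 1-cells of a disjoint union: those of the summands. -/
inductive Hom : Coprod A → Coprod A → Type u
  | mk {i : I} {x y : A i} (f : x ⟶ y) : Hom ⟨i, x⟩ ⟨i, y⟩

/-- The 2-cells of a disjoint union: those of the summands. -/
inductive Hom₂ : ∀ {X Y : Coprod A}, Hom X Y → Hom X Y → Type u
  | mk {i : I} {x y : A i} {f g : x ⟶ y} (η : f ⟶ g) : Hom₂ (Hom.mk f) (Hom.mk g)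

instance : CategoryStruct (Coprod A) where
  Hom X Y := Hom X Y
  id X := Hom.mk (𝟙 X.pt)
  comp
    | .mk f, .mk g => .mk (f ≫ g)

instance (X Y : Coprod A) : Category (X ⟶ Y) where
  Hom f g := Hom₂ f g
  id
    | .mk f => .mk (𝟙 f)
  comp
    | .mk η, .mk θ => .mk (η ≫ θ)
  id_comp := by
    rintro _ _ ⟨η⟩
    exact congrArg Hom₂.mk (Category.id_comp η)
  comp_id := by
    rintro _ _ ⟨η⟩
    exact congrArg Hom₂.mk (Category.comp_id η)
  assoc := by
    rintro _ _ _ _ ⟨η⟩ ⟨θ⟩ ⟨κ⟩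
    exact congrArg Hom₂.mk (Category.assoc η θ κ)

/-- The inclusion of a hom-category of a summand. -/
def inclHom {i : I} (x y : A i) : (x ⟶ y) ⥤ ((⟨i, x⟩ : Coprod A) ⟶ ⟨i, y⟩) where
  obj f := Hom.mk f
  map η := Hom₂.mk η

/-- Left whiskering in a disjoint union. -/
def whiskerL : ∀ {X Y Z : Coprod A} (f : X ⟶ Y) {g h : Y ⟶ Z} (_ : g ⟶ h), (f ≫ g ⟶ f ≫ h)
  | _, _, _, Hom.mk f, _, _, Hom₂.mk η => Hom₂.mk (f ◁ η)

/-- Right whiskering in a disjoint union. -/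
def whiskerR : ∀ {X Y Z : Coprod A} {f g : X ⟶ Y} (_ : f ⟶ g) (h : Y ⟶ Z), (f ≫ h ⟶ g ≫ h)
  | _, _, _, _, _, Hom₂.mk η, Hom.mk h => Hom₂.mk (η ▷ h)

/-- The associators of a disjoint union. -/
def assoc : ∀ {W X Y Z : Coprod A} (f : W ⟶ X) (g : X ⟶ Y) (h : Y ⟶ Z),
    (f ≫ g) ≫ h ≅ f ≫ g ≫ h
  | _, _, _, _, Hom.mk f, Hom.mk g, Hom.mk h => (inclHom _ _).mapIso (α_ f g h)

/-- The left unitors of a disjoint union. -/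
def unitL : ∀ {X Y : Coprod A} (f : X ⟶ Y), 𝟙 X ≫ f ≅ f
  | _, _, Hom.mk f => (inclHom _ _).mapIso (λ_ f)

/-- The right unitors of a disjoint union. -/
def unitR : ∀ {X Y : Coprod A} (f : X ⟶ Y), f ≫ 𝟙 Y ≅ f
  | _, _, Hom.mk f => (inclHom _ _).mapIso (ρ_ f)

instance : Bicategory (Coprod A) where
  whiskerLeft f _ _ η := whiskerL f η
  whiskerRight η h := whiskerR η h
  associator f g h := assoc f g h
  leftUnitor f := unitL f
  rightUnitor f := unitR f
  whiskerLeft_id := by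
    rintro _ _ _ ⟨f⟩ ⟨g⟩
    exact congrArg Hom₂.mk (whiskerLeft_id f g)
  whiskerLeft_comp := by
    rintro _ _ _ ⟨f⟩ _ _ _ ⟨η⟩ ⟨θ⟩
    exact congrArg Hom₂.mk (whiskerLeft_comp f η θ)
  id_whiskerLeft := by
    rintro _ _ _ _ ⟨η⟩
    exact congrArg Hom₂.mk (id_whiskerLeft η)
  comp_whiskerLeft := by
    rintro _ _ _ _ ⟨f⟩ ⟨g⟩ _ _ ⟨η⟩
    exact congrArg Hom₂.mk (comp_whiskerLeft f g η)
  id_whiskerRight := by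
    rintro _ _ _ ⟨f⟩ ⟨g⟩
    exact congrArg Hom₂.mk (id_whiskerRight f g)
  comp_whiskerRight := by
    rintro _ _ _ _ _ _ ⟨η⟩ ⟨θ⟩ ⟨g⟩
    exact congrArg Hom₂.mk (comp_whiskerRight η θ g)
  whiskerRight_id := by
    rintro _ _ _ _ ⟨η⟩
    exact congrArg Hom₂.mk (whiskerRight_id η)
  whiskerRight_comp := by
    rintro _ _ _ _ _ _ ⟨η⟩ ⟨g⟩ ⟨h⟩
    exact congrArg Hom₂.mk (whiskerRight_comp η g h)
  whisker_assoc := by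
    rintro _ _ _ _ ⟨f⟩ _ _ ⟨η⟩ ⟨h⟩
    exact congrArg Hom₂.mk (whisker_assoc f η h)
  whisker_exchange := by
    rintro _ _ _ _ _ _ _ ⟨η⟩ ⟨θ⟩
    exact congrArg Hom₂.mk (whisker_exchange η θ)
  pentagon := by
    rintro _ _ _ _ _ ⟨f⟩ ⟨g⟩ ⟨h⟩ ⟨k⟩
    exact congrArg Hom₂.mk (pentagon f g h k)
  triangle := by
    rintro _ _ _ ⟨f⟩ ⟨g⟩
    exact congrArg Hom₂.mk (triangle f g)

theorem mapIso_eqToIso {i : I} {x y : A i} {f g : x ⟶ y} (h : f = g) :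
    (inclHom x y).mapIso (eqToIso h) = eqToIso (congrArg (inclHom x y).obj h) := by
  subst h; rfl

instance : Strict (Coprod A) where
  id_comp := by
    rintro _ _ ⟨f⟩
    exact congrArg Hom.mk (Strict.id_comp f)
  comp_id := by
    rintro _ _ ⟨f⟩
    exact congrArg Hom.mk (Strict.comp_id f)
  assoc := by
    rintro _ _ _ _ ⟨f⟩ ⟨g⟩ ⟨h⟩
    exact congrArg Hom.mk (Strict.assoc f g h)
  leftUnitor_eqToIso := by
    rintro _ _ ⟨f⟩
    exact (congrArg (inclHom _ _).mapIso (Strict.leftUnitor_eqToIso f)).trans (mapIso_eqToIso _)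
  rightUnitor_eqToIso := by
    rintro _ _ ⟨f⟩
    exact (congrArg (inclHom _ _).mapIso (Strict.rightUnitor_eqToIso f)).trans (mapIso_eqToIso _)
  associator_eqToIso := by
    rintro _ _ _ _ ⟨f⟩ ⟨g⟩ ⟨h⟩
    exact (congrArg (inclHom _ _).mapIso (Strict.associator_eqToIso f g h)).trans
      (mapIso_eqToIso _)

theorem heq_mk {i : I} {x y : A i} {f g f' g' : x ⟶ y} {η : f ⟶ g} {η' : f' ⟶ g'}
    (hf : f = f') (hg : g = g') (h : η ≍ η') :
    (inclHom x y).map η ≍ (inclHom x y).map η' := by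
  subst hf hg; cases h; rfl

/-- The action on 1-cells of `Coprod.map`. -/
def mapHom {J : Type u} {A' : J → TwoCat.{u}} (e : I → J)
    (F : ∀ i, StrictPseudofunctor (A i) (A' (e i))) : ∀ {X Y : Coprod A} (_ : X ⟶ Y),
      ((⟨e X.idx, (F X.idx).obj X.pt⟩ : Coprod A') ⟶ ⟨e Y.idx, (F Y.idx).obj Y.pt⟩)
  | _, _, Hom.mk f => Hom.mk ((F _).map f)

/-- The action on 2-cells of `Coprod.map`. -/
def mapHom₂ {J : Type u} {A' : J → TwoCat.{u}} (e : I → J)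
    (F : ∀ i, StrictPseudofunctor (A i) (A' (e i))) : ∀ {X Y : Coprod A} {f g : X ⟶ Y}
      (_ : f ⟶ g), (mapHom e F f ⟶ mapHom e F g)
  | _, _, _, _, Hom₂.mk η => Hom₂.mk ((F _).map₂ η)

/-- The 2-functor between disjoint unions induced by a map of the index sets and 2-functors
between the summands. -/
def map {J : Type u} {A' : J → TwoCat.{u}} (e : I → J)
    (F : ∀ i, StrictPseudofunctor (A i) (A' (e i))) :
    StrictPseudofunctor (Coprod A) (Coprod A') :=
  StrictPseudofunctor.mk''
    { obj X := ⟨e X.idx, (F X.idx).obj X.pt⟩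
      map f := mapHom e F f
      map₂ η := mapHom₂ e F η
      map₂_id := by
        rintro _ _ ⟨f⟩
        exact congrArg Hom₂.mk ((F _).map₂_id f)
      map₂_comp := by
        rintro _ _ _ _ _ ⟨η⟩ ⟨θ⟩
        exact congrArg Hom₂.mk ((F _).map₂_comp η θ)
      map_id X := congrArg Hom.mk ((F _).map_id X.pt)
      map_comp := by
        rintro _ _ _ ⟨f⟩ ⟨g⟩
        exact congrArg Hom.mk ((F _).map_comp f g)
      map₂_whisker_left := by
        rintro _ _ _ ⟨f⟩ _ _ ⟨η⟩
        apply eq_of_heq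
        rw [heq_eqToHom_comp_iff, heq_comp_eqToHom_iff]
        exact heq_mk ((F _).map_comp _ _) ((F _).map_comp _ _) (map₂_whiskerLeft_heq (F _) f η)
      map₂_whisker_right := by
        rintro _ _ _ _ _ ⟨η⟩ ⟨g⟩
        apply eq_of_heq
        rw [heq_eqToHom_comp_iff, heq_comp_eqToHom_iff]
        exact heq_mk ((F _).map_comp _ _) ((F _).map_comp _ _) (map₂_whiskerRight_heq (F _) η g) }

theorem map_comp_map {J K : Type u} {A' : J → TwoCat.{u}} {A'' : K → TwoCat.{u}} (e : I → J)
    (F : ∀ i, StrictPseudofunctor (A i) (A' (e i))) (e' : J → K)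
    (F' : ∀ j, StrictPseudofunctor (A' j) (A'' (e' j))) :
    (map e F).comp (map e' F') = map (e' ∘ e) (fun i => (F i).comp (F' (e i))) :=
  twoFunctor_ext (fun _ => rfl) (by rintro _ _ ⟨f⟩; rfl) (by rintro _ _ _ _ ⟨η⟩; rfl)

theorem map_id : map (fun i : I => i) (fun i => StrictPseudofunctor.id (A i)) =
    StrictPseudofunctor.id (Coprod A) :=
  twoFunctor_ext (fun _ => rfl) (by rintro _ _ ⟨f⟩; rfl) (by rintro _ _ _ _ ⟨η⟩; rfl)

end Coprod
end Coproducts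

section Action

/-- The 2-functor underlying a 1-cell of the 2-category of 2-categories. -/
abbrev TwoCat.fn {A B : TwoCat.{u}} (F : A ⟶ B) : StrictPseudofunctor A B := F

/-- The components of a 2-cell of the 2-category of 2-categories. -/
abbrev TwoCat.comp₂ {A B : TwoCat.{u}} {F G : A ⟶ B} (σ : F ⟶ G) (x : A) :
    (TwoCat.fn F).obj x ⟶ (TwoCat.fn G).obj x :=
  TwoNatTrans.app σ x

open TwoCat

variable {A B C : TwoCat.{u}} {K K' K'' : Type u} [Category.{u} K] [Category.{u} K']
  [Category.{u} K'']

/-- The 2-category `A × K`, where the category `K` is viewed as a 2-category with only identity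
2-cells. -/
def prodCat (A : TwoCat.{u}) (K : Type u) [Category.{u} K] : TwoCat.{u} :=
  letI : Bicategory (A × LocallyDiscrete K) := Bicategory.prod A (LocallyDiscrete K)
  { carrier := A × LocallyDiscrete K
    bicategory := Bicategory.prod A (LocallyDiscrete K)
    strict := inferInstance }

theorem exch_left (F G : A ⟶ B) (σ : F ⟶ G) {x y : A} (u : x ⟶ y) :
    (fn F).map u ≫ comp₂ σ y = comp₂ σ x ≫ (fn G).map u :=
  TwoNatTrans.naturality σ u

theorem comp₂_comp {F G H : A ⟶ B} (σ : F ⟶ G) (τ : G ⟶ H) (x : A) :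
    comp₂ (σ ≫ τ) x = comp₂ σ x ≫ comp₂ τ x := rfl

theorem comp₂_id (F : A ⟶ B) (x : A) : comp₂ (𝟙 F) x = 𝟙 ((fn F).obj x) := rfl

theorem act_map_comp (P : K ⥤ (A ⟶ B)) {x y z : A} {k l m : K} (u : x ⟶ y) (v : y ⟶ z)
    (α : k ⟶ l) (β : l ⟶ m) :
    comp₂ (P.map (α ≫ β)) x ≫ (fn (P.obj m)).map (u ≫ v) =
      (comp₂ (P.map α) x ≫ (fn (P.obj l)).map u) ≫
        (comp₂ (P.map β) y ≫ (fn (P.obj m)).map v) := by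
  rw [P.map_comp, comp₂_comp, (fn (P.obj m)).map_comp]
  simp only [Strict.assoc]
  rw [← Strict.assoc _ _ ((fn (P.obj m)).map v), ← exch_left, Strict.assoc]

/-- The 2-functor `A × K → B`, `(x, k) ↦ P k x` defined by a functor `P` from the category `K` to
the category of 2-functors from `A` to `B`. A 1-cell `(u, α) : (x, k) → (y, l)` goes to the
composite of `P α x : P k x → P l x` and `P l u : P l x → P l y`, and a 2-cell `(φ, 1)` goes to the
whiskering of `P l φ` with `P α x`. -/
def act (P : K ⥤ (A ⟶ B)) : StrictPseudofunctor (prodCat A K) B :=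
  StrictPseudofunctor.mk''
    { obj X := (fn (P.obj X.2.as)).obj X.1
      map {X Y} f := comp₂ (P.map f.2.as) X.1 ≫ (fn (P.obj Y.2.as)).map f.1
      map₂ {X Y f g} η := comp₂ (P.map f.2.as) X.1 ◁ (fn (P.obj Y.2.as)).map₂ η.1 ≫
        eqToHom (by rw [LocallyDiscrete.eq_of_hom η.2])
      map₂_id := by
        rintro ⟨x, ⟨k⟩⟩ ⟨y, ⟨l⟩⟩ ⟨u, ⟨α⟩⟩
        change comp₂ (P.map α) x ◁ (fn (P.obj l)).map₂ (𝟙 u) ≫ 𝟙 _ = _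
        rw [PrelaxFunctor.map₂_id, whiskerLeft_id, Category.comp_id]
      map₂_comp := by
        rintro ⟨x, ⟨k⟩⟩ ⟨y, ⟨l⟩⟩ ⟨u, ⟨α⟩⟩ ⟨v, ⟨β⟩⟩ ⟨w, ⟨γ⟩⟩ ⟨η, ⟨⟨h⟩⟩⟩ ⟨θ, ⟨⟨h'⟩⟩⟩
        obtain rfl : α = β := h
        obtain rfl : α = γ := h'
        change comp₂ (P.map α) x ◁ (fn (P.obj l)).map₂ (η ≫ θ) ≫ 𝟙 _ =
          (comp₂ (P.map α) x ◁ (fn (P.obj l)).map₂ η ≫ 𝟙 _) ≫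
            (comp₂ (P.map α) x ◁ (fn (P.obj l)).map₂ θ ≫ 𝟙 _)
        simp only [Category.comp_id, PrelaxFunctor.map₂_comp, whiskerLeft_comp]
      map_id := by
        rintro ⟨x, ⟨k⟩⟩
        change comp₂ (P.map (𝟙 k)) x ≫ (fn (P.obj k)).map (𝟙 x) = 𝟙 _
        rw [P.map_id, comp₂_id, (fn (P.obj k)).map_id, Strict.comp_id]
      map_comp := by
        rintro ⟨x, ⟨k⟩⟩ ⟨y, ⟨l⟩⟩ ⟨z, ⟨m⟩⟩ ⟨u, ⟨α⟩⟩ ⟨v, ⟨β⟩⟩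
        exact act_map_comp P u v α β
      map₂_whisker_left := by
        rintro ⟨x, ⟨k⟩⟩ ⟨y, ⟨l⟩⟩ ⟨z, ⟨m⟩⟩ ⟨u, ⟨α⟩⟩ ⟨v, ⟨β⟩⟩ ⟨w, ⟨γ⟩⟩ ⟨η, ⟨⟨h⟩⟩⟩
        obtain rfl : β = γ := h
        apply eq_of_heq
        rw [heq_eqToHom_comp_iff, heq_comp_eqToHom_iff]
        change comp₂ (P.map (α ≫ β)) x ◁ (fn (P.obj m)).map₂ (u ◁ η) ≫ 𝟙 _ ≍
          (comp₂ (P.map α) x ≫ (fn (P.obj l)).map u) ◁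
            (comp₂ (P.map β) y ◁ (fn (P.obj m)).map₂ η ≫ 𝟙 _)
        rw [Category.comp_id, Category.comp_id, P.map_comp, comp₂_comp]
        refine (whiskerLeft_heq rfl ((fn (P.obj m)).map_comp _ _) ((fn (P.obj m)).map_comp _ _)
          (map₂_whiskerLeft_heq _ u η)).trans ?_
        refine (comp_whiskerLeft_heq _ _ _).trans ?_
        refine HEq.trans ?_ (comp_whiskerLeft_heq _ _ _).symm
        refine whiskerLeft_heq rfl (by rw [← Strict.assoc, ← Strict.assoc, exch_left])
          (by rw [← Strict.assoc, ← Strict.assoc, exch_left]) ?_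
        refine (comp_whiskerLeft_heq _ _ _).symm.trans ?_
        refine HEq.trans ?_ (comp_whiskerLeft_heq _ _ _)
        exact whiskerLeft_heq (exch_left _ _ _ _).symm rfl rfl HEq.rfl
      map₂_whisker_right := by
        rintro ⟨x, ⟨k⟩⟩ ⟨y, ⟨l⟩⟩ ⟨z, ⟨m⟩⟩ ⟨u, ⟨α⟩⟩ ⟨v, ⟨β⟩⟩ ⟨η, ⟨⟨h⟩⟩⟩ ⟨w, ⟨γ⟩⟩
        obtain rfl : α = β := h
        apply eq_of_heq
        rw [heq_eqToHom_comp_iff, heq_comp_eqToHom_iff]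
        change comp₂ (P.map (α ≫ γ)) x ◁ (fn (P.obj m)).map₂ (η ▷ w) ≫ 𝟙 _ ≍
          (comp₂ (P.map α) x ◁ (fn (P.obj l)).map₂ η ≫ 𝟙 _) ▷
            (comp₂ (P.map γ) y ≫ (fn (P.obj m)).map w)
        rw [Category.comp_id, Category.comp_id, P.map_comp, comp₂_comp]
        refine (whiskerLeft_heq rfl ((fn (P.obj m)).map_comp _ _) ((fn (P.obj m)).map_comp _ _)
          (map₂_whiskerRight_heq _ η w)).trans ?_
        refine (comp_whiskerLeft_heq _ _ _).trans ?_
        refine HEq.trans ?_ (whisker_assoc_heq _ _ _).symm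
        refine whiskerLeft_heq rfl (by rw [← Strict.assoc, ← Strict.assoc, exch_left])
          (by rw [← Strict.assoc, ← Strict.assoc, exch_left]) ?_
        refine HEq.trans ?_ (whiskerRight_comp_heq _ _ _).symm
        refine (whisker_assoc_heq _ _ _).symm.trans ?_
        exact whiskerRight_heq rfl (exch_left _ _ _ _).symm (exch_left _ _ _ _).symm
          (TwoNatTrans.naturality₂_heq (P.map γ) η).symm }

theorem pair_heq {α α' β : Type u} {a : α} {a' : α'} (h : a ≍ a') (b : β) :
    ((a, b) : α × β) ≍ ((a', b) : α' × β) := by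
  cases h; rfl

theorem prodCat_heq {x x' y y' : A} {k l : K} {u v : x ⟶ y} {u' v' : x' ⟶ y'} {α β : k ⟶ l}
    (η : u ⟶ v) (η' : u' ⟶ v') (hx : x = x') (hy : y = y') (hu : u ≍ u') (hv : v ≍ v')
    (h : η ≍ η') (e e' : (⟨α⟩ : Discrete (k ⟶ l)) ⟶ ⟨β⟩) :
    ((η, e) : ((u, ⟨α⟩) : ((x, ⟨k⟩) : prodCat A K) ⟶ (y, ⟨l⟩)) ⟶ (v, ⟨β⟩)) ≍
      ((η', e') : ((u', ⟨α⟩) : ((x', ⟨k⟩) : prodCat A K) ⟶ (y', ⟨l⟩)) ⟶ (v', ⟨β⟩)) := by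
  subst hx hy; cases hu; cases hv; cases h
  obtain rfl : e = e' := Subsingleton.elim _ _
  rfl

theorem eq_conj_of_heq {A : Type u₁} [Category.{v₁} A] {x y x' y' : A} {f : x ⟶ y} {g : x' ⟶ y'}
    (hx : x = x') (hy : y' = y) (h : f ≍ g) : f = eqToHom hx ≫ g ≫ eqToHom hy := by
  subst hx hy; simpa using h

theorem prod_cell_heq {A : Type u₁} [Bicategory.{w₁, v₁} A] {L : Type u₂} [Bicategory.{w₂, v₂} L]
    {X Y : A × L} {f g f' g' : X ⟶ Y} (η : f ⟶ g) (η' : f' ⟶ g') (hf : f = f') (hg : g = g')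
    (h₁ : η.1 ≍ η'.1) (h₂ : η.2 ≍ η'.2) : η ≍ η' := by
  subst hf hg
  exact heq_of_eq (Prod.ext (eq_of_heq h₁) (eq_of_heq h₂))

/-- The 2-functor into a product of 2-categories with given components. -/
def pairing {Z : Type u₁} [Bicategory.{w₁, v₁} Z] [Strict Z] {A : Type u₂} [Bicategory.{w₂, v₂} A]
    [Strict A] {L : Type u₃} [Bicategory.{w₃, v₃} L] [Strict L] (F : StrictPseudofunctor Z A)
    (G : StrictPseudofunctor Z L) : StrictPseudofunctor Z (A × L) :=
  StrictPseudofunctor.mk''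
    { obj X := (F.obj X, G.obj X)
      map f := (F.map f, G.map f)
      map₂ η := (F.map₂ η, G.map₂ η)
      map₂_id f := Prod.ext (F.map₂_id f) (G.map₂_id f)
      map₂_comp η θ := Prod.ext (F.map₂_comp η θ) (G.map₂_comp η θ)
      map_id X := Prod.ext (F.map_id X) (G.map_id X)
      map_comp f g := Prod.ext (F.map_comp f g) (G.map_comp f g)
      map₂_whisker_left {a _ c} f _ _ η :=
        eq_conj_of_heq (A := ((F.obj a, G.obj a) : A × L) ⟶ (F.obj c, G.obj c)) _ _ <|
          prod_cell_heq _ _ (Prod.ext (F.map_comp _ _) (G.map_comp _ _))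
          (Prod.ext (F.map_comp _ _) (G.map_comp _ _)) (map₂_whiskerLeft_heq F f η)
          (map₂_whiskerLeft_heq G f η)
      map₂_whisker_right {a _ c} _ _ η h :=
        eq_conj_of_heq (A := ((F.obj a, G.obj a) : A × L) ⟶ (F.obj c, G.obj c)) _ _ <|
          prod_cell_heq _ _ (Prod.ext (F.map_comp _ _) (G.map_comp _ _))
          (Prod.ext (F.map_comp _ _) (G.map_comp _ _)) (map₂_whiskerRight_heq F η h)
          (map₂_whiskerRight_heq G η h) }

/-- A functor, viewed as a 2-functor. -/
def locDiscr (R : K ⥤ K') : StrictPseudofunctor (LocallyDiscrete K) (LocallyDiscrete K') :=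
  StrictPseudofunctor.mk''
    { obj X := ⟨R.obj X.as⟩
      map f := ⟨R.map f.as⟩
      map₂ η := eqToHom (congrArg (fun a => Discrete.mk (R.map a))
          (congrArg Discrete.as (LocallyDiscrete.eq_of_hom η)))
      map₂_id _ := Subsingleton.elim _ _
      map₂_comp _ _ := Subsingleton.elim _ _
      map_id _ := congrArg Discrete.mk (R.map_id _)
      map_comp _ _ := congrArg Discrete.mk (R.map_comp _ _)
      map₂_whisker_left _ _ _ _ := Subsingleton.elim _ _
      map₂_whisker_right _ _ := Subsingleton.elim _ _ }

/-- The 2-functor `A × K → B × K'` with components `act P` and `R`. -/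
def step (P : K ⥤ (A ⟶ B)) (R : K ⥤ K') : StrictPseudofunctor (prodCat A K) (prodCat B K') :=
  pairing (act P) ((Bicategory.Prod.snd A (LocallyDiscrete K)).comp (locDiscr R))

/-- The 2-functor `F × 1 : A × K → B × K`. -/
def prodMap (F : StrictPseudofunctor A B) (K : Type u) [Category.{u} K] :
    StrictPseudofunctor (prodCat A K) (prodCat B K) :=
  pairing ((Bicategory.Prod.fst A (LocallyDiscrete K)).comp F)
    (Bicategory.Prod.snd A (LocallyDiscrete K))

theorem act_heq {F F' G G' : A ⟶ B} {σ : F ⟶ G} {σ' : F' ⟶ G'} (hF : F = F') (hG : G = G')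
    (h : σ ≍ σ') {x y : A} (u : x ⟶ y) :
    comp₂ σ x ≫ (fn G).map u ≍ comp₂ σ' x ≫ (fn G').map u := by
  subst hF hG; cases h; rfl

theorem act_heq₂ {F F' G G' : A ⟶ B} {σ : F ⟶ G} {σ' : F' ⟶ G'} (hF : F = F') (hG : G = G')
    (h : σ ≍ σ') {x y : A} {u v : x ⟶ y} (η : u ⟶ v) :
    comp₂ σ x ◁ (fn G).map₂ η ≍ comp₂ σ' x ◁ (fn G').map₂ η := by
  subst hF hG; cases h; rfl

theorem step_id (P : K ⥤ (A ⟶ A)) (h₀ : ∀ k, P.obj k = 𝟙 A)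
    (h₁ : ∀ {k l : K} (α : k ⟶ l), P.map α ≍ 𝟙 (𝟙 A)) :
    step P (𝟭 K) = StrictPseudofunctor.id (prodCat A K) := by
  refine twoFunctor_ext ?_ ?_ ?_
  · rintro ⟨x, ⟨k⟩⟩
    exact Prod.ext (congrArg (fun F => (fn F).obj x) (h₀ k)) rfl
  · rintro ⟨x, ⟨k⟩⟩ ⟨y, ⟨l⟩⟩ ⟨u, ⟨α⟩⟩
    refine pair_heq ?_ _
    exact (act_heq (h₀ k) (h₀ l) (h₁ α) u).trans (heq_of_eq (Strict.id_comp _))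
  · rintro ⟨x, ⟨k⟩⟩ ⟨y, ⟨l⟩⟩ ⟨u, ⟨α⟩⟩ ⟨v, ⟨β⟩⟩ ⟨η, ⟨⟨h⟩⟩⟩
    obtain rfl : α = β := h
    refine prodCat_heq _ _ (congrArg (fun F => (fn F).obj x) (h₀ k))
      (congrArg (fun F => (fn F).obj y) (h₀ l))
      ((act_heq (h₀ k) (h₀ l) (h₁ α) u).trans (heq_of_eq (Strict.id_comp _)))
      ((act_heq (h₀ k) (h₀ l) (h₁ α) v).trans (heq_of_eq (Strict.id_comp _))) ?_ _ _
    change comp₂ (P.map α) x ◁ (fn (P.obj l)).map₂ η ≫ 𝟙 _ ≍ _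
    rw [Category.comp_id]
    exact (act_heq₂ (h₀ k) (h₀ l) (h₁ α) η).trans (id_whiskerLeft_heq _)

theorem step_comp (P : K ⥤ (A ⟶ B)) (R : K ⥤ K') (P' : K' ⥤ (B ⟶ C)) (R' : K' ⥤ K'')
    (Q : K ⥤ (A ⟶ C)) (h₀ : ∀ k, Q.obj k = P.obj k ≫ P'.obj (R.obj k))
    (h₁ : ∀ {k l : K} (α : k ⟶ l), Q.map α ≍ hcomp (P.map α) (P'.map (R.map α))) :
    (step P R).comp (step P' R') = step Q (R ⋙ R') := by
  have key : ∀ {x y : A} {k l : K} (u : x ⟶ y) (α : k ⟶ l),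
      comp₂ (P'.map (R.map α)) ((fn (P.obj k)).obj x) ≫
        (fn (P'.obj (R.obj l))).map (comp₂ (P.map α) x ≫ (fn (P.obj l)).map u) =
      comp₂ (hcomp (P.map α) (P'.map (R.map α))) x ≫
        (fn (P.obj l ≫ P'.obj (R.obj l))).map u := by
    intro x y k l u α
    rw [(fn (P'.obj (R.obj l))).map_comp, ← Strict.assoc, ← exch_left]
    rfl
  refine twoFunctor_ext ?_ ?_ ?_
  · rintro ⟨x, ⟨k⟩⟩
    exact Prod.ext (congrArg (fun F => (fn F).obj x) (h₀ k)).symm rfl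
  · rintro ⟨x, ⟨k⟩⟩ ⟨y, ⟨l⟩⟩ ⟨u, ⟨α⟩⟩
    refine pair_heq ?_ _
    exact (heq_of_eq (key u α)).trans (act_heq (h₀ k) (h₀ l) (h₁ α) u).symm
  · rintro ⟨x, ⟨k⟩⟩ ⟨y, ⟨l⟩⟩ ⟨u, ⟨α⟩⟩ ⟨v, ⟨β⟩⟩ ⟨η, ⟨⟨h⟩⟩⟩
    obtain rfl : α = β := h
    refine prodCat_heq _ _ (congrArg (fun F => (fn F).obj x) (h₀ k)).symm
      (congrArg (fun F => (fn F).obj y) (h₀ l)).symm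
      ((heq_of_eq (key u α)).trans (act_heq (h₀ k) (h₀ l) (h₁ α) u).symm)
      ((heq_of_eq (key v α)).trans (act_heq (h₀ k) (h₀ l) (h₁ α) v).symm) ?_ _ _
    change comp₂ (P'.map (R.map α)) ((fn (P.obj k)).obj x) ◁
      (fn (P'.obj (R.obj l))).map₂ (comp₂ (P.map α) x ◁ (fn (P.obj l)).map₂ η ≫ 𝟙 _) ≫ 𝟙 _ ≍
        comp₂ (Q.map α) x ◁ (fn (Q.obj l)).map₂ η ≫ 𝟙 _
    rw [Category.comp_id, Category.comp_id, Category.comp_id]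
    refine HEq.trans ?_ (act_heq₂ (h₀ k) (h₀ l) (h₁ α) η).symm
    refine (whiskerLeft_heq rfl ((fn (P'.obj (R.obj l))).map_comp _ _)
      ((fn (P'.obj (R.obj l))).map_comp _ _) (map₂_whiskerLeft_heq _ _ _)).trans ?_
    refine (comp_whiskerLeft_heq _ _ _).symm.trans ?_
    exact whiskerLeft_heq (exch_left _ _ _ _).symm rfl rfl HEq.rfl

theorem step_prodMap {A' B' : TwoCat.{u}} (F : A ⟶ A') (G : B ⟶ B') (P : K ⥤ (A ⟶ B))
    (P' : K ⥤ (A' ⟶ B')) (R : K ⥤ K') (h₀ : ∀ k, P.obj k ≫ G = F ≫ P'.obj k)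
    (h₁ : ∀ {k l : K} (α : k ⟶ l), P.map α ▷ G ≍ F ◁ P'.map α) :
    (step P R).comp (prodMap G K') = (prodMap F K).comp (step P' R) := by
  have key : ∀ {x y : A} {k l : K} (u : x ⟶ y) (α : k ⟶ l),
      (fn G).map (comp₂ (P.map α) x ≫ (fn (P.obj l)).map u) =
      comp₂ (P.map α ▷ G) x ≫ (fn (P.obj l ≫ G)).map u := by
    intro x y k l u α
    exact (fn G).map_comp _ _
  refine twoFunctor_ext ?_ ?_ ?_
  · rintro ⟨x, ⟨k⟩⟩
    exact Prod.ext (congrArg (fun F => (fn F).obj x) (h₀ k)) rfl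
  · rintro ⟨x, ⟨k⟩⟩ ⟨y, ⟨l⟩⟩ ⟨u, ⟨α⟩⟩
    refine pair_heq ?_ _
    exact (heq_of_eq (key u α)).trans (act_heq (h₀ k) (h₀ l) (h₁ α) u)
  · rintro ⟨x, ⟨k⟩⟩ ⟨y, ⟨l⟩⟩ ⟨u, ⟨α⟩⟩ ⟨v, ⟨β⟩⟩ ⟨η, ⟨⟨h⟩⟩⟩
    obtain rfl : α = β := h
    refine prodCat_heq _ _ (congrArg (fun F => (fn F).obj x) (h₀ k))
      (congrArg (fun F => (fn F).obj y) (h₀ l))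
      ((heq_of_eq (key u α)).trans (act_heq (h₀ k) (h₀ l) (h₁ α) u))
      ((heq_of_eq (key v α)).trans (act_heq (h₀ k) (h₀ l) (h₁ α) v)) ?_ _ _
    change (fn G).map₂ (comp₂ (P.map α) x ◁ (fn (P.obj l)).map₂ η ≫ 𝟙 _) ≍
      comp₂ (P'.map α) ((fn F).obj x) ◁ (fn (P'.obj l)).map₂ ((fn F).map₂ η) ≫ 𝟙 _
    rw [Category.comp_id, Category.comp_id]
    refine HEq.trans ?_ (act_heq₂ (h₀ k) (h₀ l) (h₁ α) η)
    exact map₂_whiskerLeft_heq (fn G) _ _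

end Action

section Hocolim

open TwoCat Bicategory.Opposite

variable {C : Type u} [Bicategory.{u, u} C] {ι : Type} [Preorder ι]

/-- The functor `f ↦ (f_{ij})_* : D (c i) → D (c j)`. -/
def push (D : StrictPseudofunctor C TwoCat.{u}) (c : ι → C) {i j : ι} (h : i ≤ j) :
    Chain c ⥤ (D.obj (c i) ⟶ D.obj (c j)) where
  obj f := D.map (f.hom h)
  map α := D.map₂ (α.cell h)
  map_id _ := D.map₂_id _
  map_comp _ _ := D.map₂_comp _ _

/-- The functor `f ↦ (f_{ij})^* : D (c j) → D (c i)`. -/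
def pull (D : StrictPseudofunctor Cᵒᵖ TwoCat.{u}) (c : ι → C) {i j : ι} (h : i ≤ j) :
    Chain c ⥤ (D.obj (op (c j)) ⟶ D.obj (op (c i))) where
  obj f := D.map (f.hom h).op
  map α := D.map₂ (op2 (α.cell h))
  map_id _ := D.map₂_id _
  map_comp α β := D.map₂_comp (op2 (α.cell h)) (op2 (β.cell h))

theorem op2_heq {a b : C} {f g f' g' : a ⟶ b} {η : f ⟶ g} {η' : f' ⟶ g'} (hf : f = f')
    (hg : g = g') (h : η ≍ η') : op2 η ≍ op2 η' := by
  subst hf hg; cases h; rfl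

theorem op2_hcomp {a b c : C} {f f' : a ⟶ b} {g g' : b ⟶ c} (α : f ⟶ f') (β : g ⟶ g') :
    op2 (hcomp α β) = hcomp (op2 β) (op2 α) := by
  have h : hcomp α β = f ◁ β ≫ α ▷ g' := (whisker_exchange α β).symm
  rw [h]; rfl

/-- The homotopy colimit of a 2-functor `D : C → 2Cat`: the simplicial 2-category whose
2-category of `p`-simplices is the disjoint union over `c₀, …, cₚ` of the 2-categories
`D_{c₀} × C(c₀, c₁) × ⋯ × C(cₚ₋₁, cₚ)`. An order-preserving map `φ : [q] → [p]` acts by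
reindexing the chains `f` and by `(f_{0,φ(0)})_*` from `D_{c₀}` to `D_{c_φ(0)}`. -/
def hocolim (D : StrictPseudofunctor C TwoCat.{u}) : SimplicialObject TwoCat.{u} where
  obj p := TwoCat.mk
    (Coprod (fun c : Fin (p.unop.len + 1) → C => prodCat (D.obj (c 0)) (Chain c)))
  map φ := Coprod.map (fun c => c ∘ φ.unop.toOrderHom)
    (fun c => step (push D c (Fin.zero_le (φ.unop.toOrderHom 0)))
      (Chain.restrict φ.unop.toOrderHom c))
  map_id p := by
    refine Eq.trans (congrArg (Coprod.map _) ?_) Coprod.map_id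
    funext c
    refine step_id _ (fun f => ?_) (fun {f g} α => ?_)
    · exact (congrArg D.map (f.hom_refl 0)).trans (D.map_id _)
    · refine (map₂_heq (f.hom_refl 0) (g.hom_refl 0) (α.cell_refl 0)).trans ?_
      rw [D.map₂_id]
      exact id_heq (D.map_id _)
  map_comp {p q r} φ ψ := by
    refine Eq.trans ?_ (Coprod.map_comp_map _ _ _ _).symm
    refine congrArg (Coprod.map _) ?_
    funext c
    refine (step_comp (push D c (Fin.zero_le _))
      (Chain.restrict φ.unop.toOrderHom c)
      (push D (c ∘ φ.unop.toOrderHom) (Fin.zero_le (ψ.unop.toOrderHom 0)))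
      (Chain.restrict ψ.unop.toOrderHom (c ∘ φ.unop.toOrderHom)) (push D c (Fin.zero_le _))
      (fun f => ?_) (fun {f g} α => ?_)).symm
    · exact (congrArg D.map (f.hom_trans _ _)).trans (D.map_comp _ _)
    · exact (map₂_heq (f.hom_trans _ _) (g.hom_trans _ _) (α.cell_trans _ _)).trans
        (map₂_hcomp_heq D _ _)

/-- The morphism of simplicial 2-categories induced by a 2-transformation, given on
`D_{c₀} × C(c₀, c₁) × ⋯ × C(cₚ₋₁, cₚ)` by `Γ_{c₀} × 1`. -/
def hocolimMap {D E : StrictPseudofunctor C TwoCat.{u}} (Γ : TwoNatTrans D E) :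
    hocolim D ⟶ hocolim E where
  app p := Coprod.map (fun c => c) (fun c => prodMap (Γ.app (c 0)) (Chain c))
  naturality p q φ := by
    refine (Coprod.map_comp_map _ _ _ _).trans (Eq.trans ?_ (Coprod.map_comp_map _ _ _ _).symm)
    refine congrArg (Coprod.map _) ?_
    funext c
    exact step_prodMap _ _ _ _ _ (fun f => Γ.naturality _) (fun α => Γ.naturality₂_heq _)

theorem pull_trans (D : StrictPseudofunctor Cᵒᵖ TwoCat.{u}) {c : ι → C} {f g : Chain c}
    (α : f ⟶ g) {i j k : ι} (h : i ≤ j) (h' : j ≤ k) :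
    (pull D c (h.trans h')).map α ≍ hcomp ((pull D c h').map α) ((pull D c h).map α) := by
  refine (map₂_heq (congrArg Quiver.Hom.op (f.hom_trans h h'))
    (congrArg Quiver.Hom.op (g.hom_trans h h'))
    (op2_heq (f.hom_trans h h') (g.hom_trans h h') (α.cell_trans h h'))).trans ?_
  refine HEq.trans ?_ (map₂_hcomp_heq D _ _)
  exact heq_of_eq (congrArg (fun k => D.map₂ k) (op2_hcomp _ _))

/-- The homotopy colimit of a 2-functor `D : Cᵒᵖ → 2Cat`: the simplicial 2-category whose
2-category of `p`-simplices is the disjoint union over `c₀, …, cₚ` of the 2-categories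
`C(c₀, c₁) × ⋯ × C(cₚ₋₁, cₚ) × D_{cₚ}` (written here with the factor `D_{cₚ}` in front). An
order-preserving map `φ : [q] → [p]` acts by reindexing the chains `f` and by `(f_{φ(q),p})^*` from
`D_{cₚ}` to `D_{c_φ(q)}`. -/
def hocolimOp (D : StrictPseudofunctor Cᵒᵖ TwoCat.{u}) : SimplicialObject TwoCat.{u} where
  obj p := TwoCat.mk
    (Coprod (fun c : Fin (p.unop.len + 1) → C =>
      prodCat (D.obj (op (c (Fin.last p.unop.len)))) (Chain c)))
  map {p q} φ := Coprod.map (fun c => c ∘ φ.unop.toOrderHom)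
    (fun c => step (pull D c (Fin.le_last (φ.unop.toOrderHom (Fin.last q.unop.len))))
      (Chain.restrict φ.unop.toOrderHom c))
  map_id p := by
    refine Eq.trans (congrArg (Coprod.map _) ?_) Coprod.map_id
    funext c
    refine step_id _ (fun f => ?_) (fun {f g} α => ?_)
    · exact (congrArg (fun k => D.map (Quiver.Hom.op k)) (f.hom_refl _)).trans (D.map_id _)
    · refine (map₂_heq (congrArg Quiver.Hom.op (f.hom_refl _))
        (congrArg Quiver.Hom.op (g.hom_refl _))
        (op2_heq (f.hom_refl _) (g.hom_refl _) (α.cell_refl _))).trans ?_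
      exact (heq_of_eq (D.map₂_id _)).trans (id_heq (D.map_id _))
  map_comp {p q r} φ ψ := by
    refine Eq.trans ?_ (Coprod.map_comp_map _ _ _ _).symm
    refine congrArg (Coprod.map _) ?_
    funext c
    refine (step_comp (pull D c (Fin.le_last _))
      (Chain.restrict φ.unop.toOrderHom c)
      (pull D (c ∘ φ.unop.toOrderHom) (Fin.le_last (ψ.unop.toOrderHom (Fin.last _))))
      (Chain.restrict ψ.unop.toOrderHom (c ∘ φ.unop.toOrderHom)) (pull D c (Fin.le_last _))
      (fun f => ?_) (fun {f g} α => ?_)).symm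
    · exact (congrArg (fun k => D.map (Quiver.Hom.op k)) (f.hom_trans _ _)).trans (D.map_comp _ _)
    · exact pull_trans D α (φ.unop.toOrderHom.monotone (Fin.le_last _)) (Fin.le_last _)

/-- The morphism of simplicial 2-categories induced by a 2-transformation, given on
`C(c₀, c₁) × ⋯ × C(cₚ₋₁, cₚ) × D_{cₚ}` by `1 × Γ_{cₚ}`. -/
def hocolimOpMap {D E : StrictPseudofunctor Cᵒᵖ TwoCat.{u}} (Γ : TwoNatTrans D E) :
    hocolimOp D ⟶ hocolimOp E where
  app p := Coprod.map (fun c => c)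
    (fun c => prodMap (Γ.app (op (c (Fin.last p.unop.len)))) (Chain c))
  naturality p q φ := by
    refine (Coprod.map_comp_map _ _ _ _).trans (Eq.trans ?_ (Coprod.map_comp_map _ _ _ _).symm)
    refine congrArg (Coprod.map _) ?_
    funext c
    exact step_prodMap _ _ _ _ _ (fun f => Γ.naturality _) (fun α => Γ.naturality₂_heq _)

end Hocolim

end TwoCategory

open TwoCategory

/-! In each simplicial degree `p` both homotopy colimits are disjoint unions, over the tuples `c₀,
…, cₚ`, of products of one value of the diagram (at `c₀`, respectively at `cₚ`) with a category of
chains, and `Γ_*` is the disjoint union of the 2-functors `Γ × 1`. The diagonal double nerve turns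
such products into products (`nerveProd_bijective`) and disjoint unions into coproducts
(`Coprod.isColimitNerve`). Let `W` be the class of maps of simplicial sets whose realization is a
homotopy equivalence. The theorem then follows from three properties of `W`: it is stable under
coproducts (`W_of_cofan`) and under products with a fixed simplicial set (`W_whiskerRight`), and a
map of bisimplicial sets that lies in `W` in each row lies in `W` on diagonals (`W_diag`).

These properties are obtained without comparing `|X × Y|` with `|X| × |Y|`. The realization of a
monomorphism has the homotopy extension property, so it is a homotopy equivalence exactly when it is
the inclusion of a strong deformation retract. This in turn says that all maps extend along it, and
all homotopies with prescribed ends. By the adjunction between realization and singular complex,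
these are left lifting properties against `Sing T → pt` and `Sing T^I → Sing (T × T)` for all spaces
`T`. Thus the monomorphisms in `W` are described by a lifting property (`triv_eq`), and they are
stable under pushouts and sequential composition; an induction over cells gives pushout-products
(`triv_unionProd`). The test maps have the right lifting property against horns, so anodyne
extensions lie in `W` and simplicial homotopies realize to homotopies.

For a levelwise monomorphism `X → Y`, the diagonal of `Y` is filtered by adding to that of `X` the
rows of index less than `n`. Passing to `n + 1` attaches `Yₙ × Δ[n]` along `Lₙ × Δ[n] ∪ Yₙ × ∂Δ[n]`,
with `Lₙ` the union of `Xₙ` and the degenerate part of `Yₙ`; the inclusion of `Lₙ` in `Yₙ` is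
trivial because `Lₙ` arises from `Xₙ` by adding the images of the degeneracies one at a time. A
general map is a levelwise monomorphism into the product of `Y` with a functorial contractible hull
of `X`, followed by the projection. -/

open scoped unitInterval

namespace HomotopyExtension

/-! ### Concatenation of families of paths -/

section Concatenation

variable {Y : Type u₁} {T : Type u₂} [TopologicalSpace Y] [TopologicalSpace T]

/-- Given families of paths `U`, `G`, `V` such that `U y` and `V y` start at the two ends of `G y`,
the family of paths obtained by following `U y` backwards from time `s`, then `G y`, and then
`V y` until time `s`. -/
noncomputable def concatFun (U G V : C(Y, C(I, T))) (p : (Y × I) × I) : T :=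
  -- The affine map `t ↦ (1 + 2s)t - s` carries `[0, 1]` onto `[-s, 1 + s]`: the negative part runs
  -- through `U` backwards, `[0, 1]` through `G`, and the part beyond `1` through `V`. For `s = 0`
  -- it is the identity, so the family starts at `G` with no reparametrization.
  if (1 + 2 * (p.1.2 : ℝ)) * p.2 - p.1.2 ≤ 0 then
    U p.1.1 (Set.projIcc 0 1 zero_le_one (-((1 + 2 * (p.1.2 : ℝ)) * p.2 - p.1.2)))
  else if (1 + 2 * (p.1.2 : ℝ)) * p.2 - p.1.2 ≤ 1 then
    G p.1.1 (Set.projIcc 0 1 zero_le_one ((1 + 2 * (p.1.2 : ℝ)) * p.2 - p.1.2))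
  else V p.1.1 (Set.projIcc 0 1 zero_le_one ((1 + 2 * (p.1.2 : ℝ)) * p.2 - p.1.2 - 1))

theorem continuous_concatFun (U G V : C(Y, C(I, T))) (h₀ : ∀ y, U y 0 = G y 0)
    (h₁ : ∀ y, V y 0 = G y 1) : Continuous (concatFun U G V) := by
  have ev : ∀ (W : C(Y, C(I, T))) (φ : (Y × I) × I → ℝ), Continuous φ →
      Continuous fun p : (Y × I) × I => W p.1.1 (Set.projIcc 0 1 zero_le_one (φ p)) := by
    intro W φ hφ
    have h1 : Continuous fun p : (Y × I) × I => W p.1.1 := by fun_prop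
    have h2 : Continuous fun p : (Y × I) × I => Set.projIcc (0 : ℝ) 1 zero_le_one (φ p) :=
      continuous_projIcc.comp hφ
    exact h1.eval h2
  have hw : Continuous fun p : (Y × I) × I => (1 + 2 * (p.1.2 : ℝ)) * p.2 - p.1.2 := by fun_prop
  refine Continuous.if_le (ev U _ hw.neg) ?_ hw continuous_const ?_
  · refine Continuous.if_le (ev G _ hw) (ev V _ (hw.sub continuous_const)) hw continuous_const ?_
    intro p hp
    rw [hp]
    simpa using (h₁ p.1.1).symm
  · intro p hp
    rw [hp]
    simpa using h₀ p.1.1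

/-- The continuous version of `concatFun`. -/
noncomputable def concat (U G V : C(Y, C(I, T))) (h₀ : ∀ y, U y 0 = G y 0)
    (h₁ : ∀ y, V y 0 = G y 1) : C(Y × I, C(I, T)) :=
  ContinuousMap.curry ⟨concatFun U G V, continuous_concatFun U G V h₀ h₁⟩

variable {U G V : C(Y, C(I, T))} (h₀ : ∀ y, U y 0 = G y 0) (h₁ : ∀ y, V y 0 = G y 1)

theorem concat_zero (y : Y) : concat U G V h₀ h₁ (y, 0) = G y := by
  ext t
  change concatFun U G V ((y, 0), t) = _
  have e : (1 + 2 * ((0 : I) : ℝ)) * t - (0 : I) = t := by simp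
  have ht : Set.projIcc (0 : ℝ) 1 zero_le_one t = t := Set.projIcc_val _ t
  simp only [concatFun, e, ht]
  split_ifs with h h'
  · have : t = 0 := Subtype.ext (le_antisymm h t.2.1)
    subst this
    simpa using h₀ y
  · rfl
  · exact absurd t.2.2 h'

theorem concat_start (y : Y) (s : I) : concat U G V h₀ h₁ (y, s) 0 = U y s := by
  change concatFun U G V ((y, s), 0) = _
  have e : (1 + 2 * (s : ℝ)) * (0 : I) - s = -s := by simp
  simp only [concatFun, e, neg_neg, Set.projIcc_val]
  rw [if_pos (by simpa using s.2.1)]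

theorem concat_end (y : Y) (s : I) : concat U G V h₀ h₁ (y, s) 1 = V y s := by
  change concatFun U G V ((y, s), 1) = _
  have e : (1 + 2 * (s : ℝ)) * (1 : I) - s = 1 + s := by simp; ring
  simp only [concatFun, e]
  have hs := s.2.1
  rw [if_neg (by linarith)]
  split_ifs with h
  · have : s = 0 := Subtype.ext (le_antisymm (show (s : ℝ) ≤ 0 by linarith) hs)
    subst this
    simpa using (h₁ y).symm
  · simp

/-- Where the outer paths are constant, the concatenation is a reparametrization of the middle
path. -/
theorem concat_of_const (y : Y) (hU : ∀ s, U y s = U y 0) (hV : ∀ s, V y s = V y 0) (s t : I) :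
    concat U G V h₀ h₁ (y, s) t =
      G y (Set.projIcc 0 1 zero_le_one ((1 + 2 * (s : ℝ)) * t - s)) := by
  change concatFun U G V ((y, s), t) = _
  simp only [concatFun]
  split_ifs with h h'
  · rw [hU, h₀, Set.projIcc_of_le_left _ h]; rfl
  · rfl
  · rw [hV, h₁, Set.projIcc_of_right_le _ (not_le.1 h').le]; rfl

end Concatenation

/-! ### Homotopy extension and strong deformation retracts -/

section Cofibrations

variable {A X : Type u} [TopologicalSpace A] [TopologicalSpace X]

/-- The homotopy extension property. -/
def HasHEP (i : C(A, X)) : Prop :=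
  ∀ (T : Type u) [TopologicalSpace T] (g : C(X, T)) (h : C(A, C(I, T))),
    (∀ a, h a 0 = g (i a)) → ∃ K : C(X, C(I, T)), (∀ x, K x 0 = g x) ∧ ∀ a, K (i a) = h a

/-- The map `i` is the inclusion of a strong deformation retract. -/
def IsSDR (i : C(A, X)) : Prop :=
  ∃ (r : C(X, A)) (h : C(X, C(I, X))), (∀ a, r (i a) = a) ∧ (∀ x, h x 0 = x) ∧
    (∀ x, h x 1 = i (r x)) ∧ ∀ a t, h (i a) t = i a

/-- Every map defined on the source extends. -/
def ExtendsMaps (i : C(A, X)) : Prop :=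
  ∀ (T : Type u) [TopologicalSpace T] (g : C(A, T)), ∃ k : C(X, T), ∀ a, k (i a) = g a

/-- Every homotopy defined on the source between restrictions of maps defined on the target
extends. -/
def ExtendsHomotopies (i : C(A, X)) : Prop :=
  ∀ (T : Type u) [TopologicalSpace T] (f g : C(X, T)) (h : C(A, C(I, T))),
    (∀ a, h a 0 = f (i a)) → (∀ a, h a 1 = g (i a)) →
    ∃ K : C(X, C(I, T)), (∀ x, K x 0 = f x) ∧ (∀ x, K x 1 = g x) ∧ ∀ a, K (i a) = h a

/-- A homotopy as a family of paths. -/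
def pathFamily {Y : Type u₁} {T : Type u₂} [TopologicalSpace Y] [TopologicalSpace T] {f g : C(Y, T)}
    (H : ContinuousMap.Homotopy f g) : C(Y, C(I, T)) :=
  (H.toContinuousMap.comp ContinuousMap.prodSwap).curry

theorem pathFamily_apply {Y : Type u₁} {T : Type u₂} [TopologicalSpace Y] [TopologicalSpace T]
    {f g : C(Y, T)} (H : ContinuousMap.Homotopy f g) (y : Y) (t : I) :
    pathFamily H y t = H (t, y) := rfl

/-- A family of paths as a homotopy. -/
def homotopyOfPathFamily {Y : Type u₁} {T : Type u₂} [TopologicalSpace Y] [TopologicalSpace T]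
    {f g : C(Y, T)} (h : C(Y, C(I, T))) (h₀ : ∀ y, h y 0 = f y) (h₁ : ∀ y, h y 1 = g y) :
    ContinuousMap.Homotopy f g where
  toContinuousMap := h.uncurry.comp ContinuousMap.prodSwap
  map_zero_left := h₀
  map_one_left := h₁

/-- Precomposition of paths with a fixed reparametrization. -/
def reparam {T : Type u₂} [TopologicalSpace T] (e : C(I, I)) : C(C(I, T), C(I, T)) :=
  ⟨fun γ => γ.comp e, ContinuousMap.continuous_precomp e⟩

/-- The constant path at the values of a map. -/
def constPaths {Y : Type u₁} {T : Type u₂} [TopologicalSpace Y] [TopologicalSpace T] (f : C(Y, T)) :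
    C(Y, C(I, T)) :=
  ContinuousMap.curry (f.comp ContinuousMap.fst)

/-- The composition of the paths in a family with a map. -/
def mapPaths {Y : Type u₁} {T : Type u₂} {T' : Type u₃} [TopologicalSpace Y] [TopologicalSpace T]
    [TopologicalSpace T'] (f : C(T, T')) (h : C(Y, C(I, T))) : C(Y, C(I, T')) :=
  (ContinuousMap.mk (fun γ : C(I, T) => f.comp γ) (ContinuousMap.continuous_postcomp f)).comp h

theorem ExtendsMaps.of_isSDR {i : C(A, X)} (hi : IsSDR i) : ExtendsMaps i := by
  obtain ⟨r, h, hr, -⟩ := hi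
  exact fun T _ g => ⟨g.comp r, fun a => congrArg g (hr a)⟩

/-- The retraction `r` extends the identity of `A`. On `A` the maps `id` and `i ∘ r` agree, and the
deformation extends the constant homotopy between them. -/
theorem IsSDR.of_extends {i : C(A, X)} (h₁ : ExtendsMaps i) (h₂ : ExtendsHomotopies i) :
    IsSDR i := by
  obtain ⟨r, hr⟩ := h₁ A (ContinuousMap.id A)
  obtain ⟨K, h0, h1, hK⟩ := h₂ X (ContinuousMap.id X) (i.comp r) (constPaths i) (fun _ => rfl)
    (fun a => by simp [constPaths, hr])
  exact ⟨r, K, hr, h0, h1, fun a t => by rw [hK]; rfl⟩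

/-- The inclusion of a strong deformation retract is a homotopy equivalence. -/
theorem IsSDR.exists_homotopyEquiv {i : C(A, X)} (hi : IsSDR i) :
    ∃ e : ContinuousMap.HomotopyEquiv A X, e.toFun = i := by
  obtain ⟨r, h, hr, h0, h1, -⟩ := hi
  refine ⟨⟨i, r, ?_, ?_⟩, rfl⟩
  · have : r.comp i = ContinuousMap.id A := ContinuousMap.ext hr
    rw [this]
  · exact ⟨(homotopyOfPathFamily h h0 h1).symm⟩

/-- The path which goes forth and back. -/
noncomputable def tent : C(I, I) :=
  ⟨fun t => Set.projIcc 0 1 zero_le_one (1 - |1 - 2 * (t : ℝ)|),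
    continuous_projIcc.comp (by fun_prop)⟩

theorem tent_zero : tent 0 = 0 := by
  simp [tent]

theorem tent_one : tent 1 = 0 := by
  apply Subtype.ext; simp only [tent, ContinuousMap.coe_mk]; norm_num

/-- A homotopy equivalence with the homotopy extension property is the inclusion of a strong
deformation retract. -/
theorem IsSDR.of_hasHEP {i : C(A, X)} (hi : HasHEP i) (e : ContinuousMap.HomotopyEquiv A X)
    (he : e.toFun = i) : IsSDR i := by
  obtain ⟨f, r', ⟨H₁⟩, ⟨H₂⟩⟩ := e
  obtain rfl : f = i := he
  rename' f => i
  -- Extending the homotopy from `r' ∘ i` to the identity deforms the homotopy inverse `r'` into a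
  -- strict retraction `r`, the end of `K`.
  obtain ⟨K, hK0, hKi⟩ := hi A r' (pathFamily H₁) (fun a => H₁.map_zero_left a)
  let r : C(X, A) := ⟨fun x => K x 1, by fun_prop⟩
  have hr : ∀ a, r (i a) = a := fun a => by
    change K (i a) 1 = a
    rw [hKi]; exact H₁.map_one_left a
  have hir : ContinuousMap.Homotopy (ContinuousMap.id X) (i.comp r) :=
    H₂.symm.trans (ContinuousMap.Homotopy.comp (ContinuousMap.Homotopy.refl i)
      (homotopyOfPathFamily K hK0 (fun _ => rfl)))
  let M : C(X, C(I, X)) := pathFamily hir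
  have hM0 : ∀ x, M x 0 = x := fun x => hir.map_zero_left x
  have hM1 : ∀ x, M x 1 = i (r x) := fun x => hir.map_one_left x
  -- The homotopy `M` from `id` to `i ∘ r` need not be constant on `A`. Following `M x` by the
  -- reverse of `M (i (r x))` keeps the ends `x` and `i (r x)`, and over `A` gives a path run forth
  -- and back, which contracts with fixed ends.
  let G : C(X, C(I, X)) := pathFamily
    (ContinuousMap.Homotopy.trans hir
      (homotopyOfPathFamily (f := i.comp r) (g := i.comp r)
        ((reparam ⟨σ, unitInterval.continuous_symm⟩).comp (M.comp (i.comp r)))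
        (fun x => by
          change M (i (r x)) (σ 0) = i (r x)
          rw [unitInterval.symm_zero, hM1, hr])
        (fun x => by
          change M (i (r x)) (σ 1) = i (r x)
          rw [unitInterval.symm_one, hM0])))
  have hG0 : ∀ x, G x 0 = x := fun x => (pathFamily_apply _ _ _).trans (by simp)
  have hG1 : ∀ x, G x 1 = i (r x) := fun x => (pathFamily_apply _ _ _).trans (by simp)
  have hGi : ∀ a t, G (i a) t = M (i a) (tent t) := by
    intro a t
    refine (ContinuousMap.Homotopy.trans_apply _ _ _).trans ?_
    split_ifs with h
    · change M (i a) _ = _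
      congr 1
      apply Subtype.ext
      have ht := t.2.1
      simp only [tent, ContinuousMap.coe_mk]
      replace h : (t : ℝ) ≤ 1 / 2 := h
      have : 1 - |1 - 2 * (t : ℝ)| = 2 * t := by rw [abs_of_nonneg (by linarith)]; ring
      rw [this, Set.projIcc_of_mem _ ⟨by linarith, by linarith⟩]
      rfl
    · change M (i (r (i a))) (σ _) = _
      rw [hr]
      congr 1
      apply Subtype.ext
      have ht := t.2.2
      replace h : 1 / 2 < (t : ℝ) := not_le.1 h
      simp only [tent, ContinuousMap.coe_mk, unitInterval.coe_symm_eq]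
      have : 1 - |1 - 2 * (t : ℝ)| = 1 - (2 * t - 1) := by
        rw [abs_of_nonpos (by linarith)]; ring
      rw [this, Set.projIcc_of_mem _ ⟨by linarith, by linarith⟩]
      rfl
  -- The contraction of the forth-and-back path over `a`: it stops ever earlier, and its ends stay
  -- at `i a` because `tent` vanishes at `0` and `1`.
  let L : C(A, C(I, C(I, X))) := ContinuousMap.curry (ContinuousMap.curry
    ⟨fun p => M (i p.1.1) (σ p.1.2 * tent p.2), by
      have h1 : Continuous fun p : (A × I) × I => M (i p.1.1) := by fun_prop
      exact h1.eval (by fun_prop)⟩)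
  have hL : ∀ a s t, L a s t = M (i a) (σ s * tent t) := fun _ _ _ => rfl
  obtain ⟨N, hN0, hNi⟩ := hi C(I, X) G L (fun a => by
    ext t; rw [hL, hGi, unitInterval.symm_zero, one_mul])
  -- Off `A` the extension `N` may move the ends of the paths. The corrected path follows the track
  -- of the start, then `N x 1`, then the track of the end in reverse. Over `A` all three pieces are
  -- constant, so the result is a deformation relative to `A`.
  let U : C(X, C(I, X)) := ContinuousMap.curry ⟨fun p => N p.1 p.2 0, by fun_prop⟩
  let V : C(X, C(I, X)) := ContinuousMap.curry ⟨fun p => N p.1 p.2 1, by fun_prop⟩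
  let N1 : C(X, C(I, X)) := ⟨fun x => N x 1, by fun_prop⟩
  let σ' : C(I, I) := ⟨σ, unitInterval.continuous_symm⟩
  have hU0 : ∀ x, (reparam σ').comp U x 0 = N1 x 0 := fun x => by
    change N x (σ 0) 0 = N x 1 0; simp
  have hV0 : ∀ x, (reparam σ').comp V x 0 = N1 x 1 := fun x => by
    change N x (σ 0) 1 = N x 1 1; simp
  let Q := concat _ _ _ hU0 hV0
  refine ⟨r, ⟨fun x => Q (x, 1), by fun_prop⟩, hr, fun x => ?_, fun x => ?_, fun a t => ?_⟩
  · refine (concat_start hU0 hV0 x 1).trans ?_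
    change N x (σ 1) 0 = x
    rw [unitInterval.symm_one, hN0, hG0]
  · refine (concat_end hU0 hV0 x 1).trans ?_
    change N x (σ 1) 1 = i (r x)
    rw [unitInterval.symm_one, hN0, hG1]
  · refine (concat_of_const hU0 hV0 (i a) ?_ ?_ 1 t).trans ?_
    · intro s
      change N (i a) (σ s) 0 = N (i a) (σ 0) 0
      rw [hNi, hL, hL, tent_zero, mul_zero, mul_zero]
    · intro s
      change N (i a) (σ s) 1 = N (i a) (σ 0) 1
      rw [hNi, hL, hL, tent_one, mul_zero, mul_zero]
    · change N (i a) 1 _ = i a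
      rw [hNi, hL, unitInterval.symm_one, zero_mul, hM0]

/-- The inclusion of a strong deformation retract with the homotopy extension property has the
extension property for homotopies with prescribed ends. -/
theorem ExtendsHomotopies.of_isSDR {i : C(A, X)} (hi : HasHEP i) (hs : IsSDR i) :
    ExtendsHomotopies i := by
  obtain ⟨r, k, hr, hk0, hk1, hki⟩ := hs
  intro T _ f g h hf hg
  let σ' : C(I, I) := ⟨σ, unitInterval.continuous_symm⟩
  have hU0 : ∀ x, (reparam σ').comp (mapPaths f k) x 0 = (h.comp r) x 0 := fun x => by
    change f (k x (σ 0)) = h (r x) 0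
    rw [unitInterval.symm_zero, hk1, hf]
  have hV0 : ∀ x, (reparam σ').comp (mapPaths g k) x 0 = (h.comp r) x 1 := fun x => by
    change g (k x (σ 0)) = h (r x) 1
    rw [unitInterval.symm_zero, hk1, hg]
  -- From `f x` along `f ∘ k` to `f (i (r x))`, then along `h (r x)`, then back along `g ∘ k` to `g
  -- x`. The ends are right everywhere; over `A` the outer pieces are constant, so only the
  -- parametrization `3t - 1`, clamped to `[0, 1]`, differs from `h`.
  let P : C(X, C(I, T)) := ⟨fun x => concat _ _ _ hU0 hV0 (x, 1), by fun_prop⟩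
  have hP0 : ∀ x, P x 0 = f x := fun x => (concat_start hU0 hV0 x 1).trans (by
    change f (k x (σ 1)) = f x
    rw [unitInterval.symm_one, hk0])
  have hP1 : ∀ x, P x 1 = g x := fun x => (concat_end hU0 hV0 x 1).trans (by
    change g (k x (σ 1)) = g x
    rw [unitInterval.symm_one, hk0])
  let e : C(I, I) := ⟨fun t => Set.projIcc 0 1 zero_le_one (3 * (t : ℝ) - 1),
    continuous_projIcc.comp (by fun_prop)⟩
  have hPi : ∀ a t, P (i a) t = h a (e t) := fun a t => by
    refine (concat_of_const hU0 hV0 (i a) ?_ ?_ 1 t).trans ?_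
    · intro s
      change f (k (i a) (σ s)) = f (k (i a) (σ 0))
      rw [hki, hki]
    · intro s
      change g (k (i a) (σ s)) = g (k (i a) (σ 0))
      rw [hki, hki]
    · change h (r (i a)) _ = _
      rw [hr]
      congr 2
      norm_num
  -- `ψ (s, t)` moves `e t` towards `t` by at most `s`; it reaches `t` as soon as `s ≥ |t - e t|`.
  let ψ : I × I → I := fun p => Set.projIcc 0 1 zero_le_one
    (e p.2 + max (-(p.1 : ℝ)) (min ((p.2 : ℝ) - e p.2) p.1))
  have hψ : Continuous ψ := continuous_projIcc.comp (by fun_prop)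
  let L : C(A, C(I, C(I, T))) := ContinuousMap.curry (ContinuousMap.curry
    ⟨fun p => h p.1.1 (ψ (p.1.2, p.2)), by
      have h1 : Continuous fun p : (A × I) × I => h p.1.1 := by fun_prop
      exact h1.eval (by fun_prop)⟩)
  obtain ⟨N, hN0, hNi⟩ := hi C(I, T) P L (fun a => by
    ext t
    change h a (ψ (0, t)) = P (i a) t
    rw [hPi]
    congr 1
    have h0 : max (-((0 : I) : ℝ)) (min ((t : ℝ) - e t) (0 : I)) = 0 := by simp
    simp only [ψ, h0, add_zero, Set.projIcc_val])
  -- The extension `N` of the reparametrizing homotopy is evaluated along the curve `s = τ t`. As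
  -- `τ` vanishes at `t = 0` and `t = 1`, the ends remain those of `P` on all of `X`; over `A`, `ψ
  -- (τ t, t) = t` gives `h` exactly.
  let τ : C(I, I) := ⟨fun t => Set.projIcc 0 1 zero_le_one |(t : ℝ) - e t|,
    continuous_projIcc.comp (by fun_prop)⟩
  have hτ : ∀ t, (τ t : ℝ) = |(t : ℝ) - e t| := fun t => by
    have : |(t : ℝ) - e t| ∈ Set.Icc (0 : ℝ) 1 := ⟨abs_nonneg _, by
      rw [abs_le]
      constructor <;> linarith [t.2.1, t.2.2, (e t).2.1, (e t).2.2]⟩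
    simp only [τ, ContinuousMap.coe_mk, Set.projIcc_of_mem _ this]
  have he0 : e 0 = 0 := by
    apply Subtype.ext
    simp [e, Set.projIcc_of_le_left]
  have he1 : e 1 = 1 := by
    simp only [e, ContinuousMap.coe_mk]
    rw [Set.projIcc_of_right_le _ (by norm_num)]
    rfl
  have hτ0 : τ 0 = 0 := Subtype.ext (by rw [hτ, he0]; simp)
  have hτ1 : τ 1 = 0 := Subtype.ext (by rw [hτ, he1]; simp)
  refine ⟨ContinuousMap.curry ⟨fun p => N p.1 (τ p.2) p.2, by fun_prop⟩, fun x => ?_, fun x => ?_,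
    fun a => ?_⟩
  · change N x (τ 0) 0 = f x
    rw [hτ0, hN0, hP0]
  · change N x (τ 1) 1 = g x
    rw [hτ1, hN0, hP1]
  · ext t
    change N (i a) (τ t) t = h a t
    rw [hNi]
    change h a (ψ (τ t, t)) = h a t
    congr 1
    simp only [ψ]
    have : (e t : ℝ) + max (-(τ t : ℝ)) (min ((t : ℝ) - e t) (τ t)) = t := by
      rw [hτ, min_eq_left (le_abs_self _), max_eq_right (neg_abs_le _)]
      ring
    rw [this, Set.projIcc_val]

end Cofibrations

end HomotopyExtension

/-! ### Gluing maps along the faces of topological simplices -/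

namespace SimplexGluing

open Simplicial

theorem map_succAbove_self {n : ℕ} (j : Fin (n + 2)) (z : stdSimplex ℝ (Fin (n + 1))) :
    stdSimplex.map j.succAbove z j = 0 := by
  rw [stdSimplex.map_coe, FunOnFinite.linearMap_apply_apply]
  apply Finset.sum_eq_zero
  intro x hx
  exact absurd (Finset.mem_filter.1 hx).2 (Fin.succAbove_ne j x)

theorem map_succAbove_apply {n : ℕ} (j : Fin (n + 2)) (z : stdSimplex ℝ (Fin (n + 1)))
    (k : Fin (n + 1)) : stdSimplex.map j.succAbove z (j.succAbove k) = z k := by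
  rw [stdSimplex.map_coe, FunOnFinite.linearMap_apply_apply]
  have : (Finset.univ.filter fun x => j.succAbove x = j.succAbove k) = {k} := by
    ext x; simp
  rw [this, Finset.sum_singleton]

theorem map_succAbove_injective {n : ℕ} (j : Fin (n + 2)) :
    Function.Injective (stdSimplex.map (S := ℝ) j.succAbove) := by
  intro z z' h
  apply stdSimplex.ext
  funext k
  rw [← map_succAbove_apply j z k, h, map_succAbove_apply]

theorem exists_map_succAbove_eq {n : ℕ} (j : Fin (n + 2)) (y : stdSimplex ℝ (Fin (n + 2)))
    (hy : y j = 0) : ∃ z, stdSimplex.map j.succAbove z = y := by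
  refine ⟨⟨fun k => y (j.succAbove k), fun k => y.2.1 _, ?_⟩, ?_⟩
  · have := stdSimplex.sum_eq_one y
    rw [Fin.sum_univ_succAbove _ j, hy, zero_add] at this
    exact this
  · apply stdSimplex.ext
    funext k
    rcases Fin.eq_self_or_eq_succAbove j k with rfl | ⟨l, rfl⟩
    · rw [map_succAbove_self, hy]
    · rw [map_succAbove_apply]; rfl

/-- Continuous maps descend along surjections from compact spaces to Hausdorff spaces. -/
theorem exists_descent {K : Type u₁} {L : Type u₂} {E : Type u₃} [TopologicalSpace K]
    [TopologicalSpace L] [TopologicalSpace E] [CompactSpace K] [T2Space L] (q : C(K, L))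
    (hq : Function.Surjective q) (f : C(K, E)) (h : ∀ a b, q a = q b → f a = f b) :
    ∃ F : C(L, E), ∀ a, F (q a) = f a := by
  have hq' : Topology.IsQuotientMap q := q.continuous.isClosedMap.isQuotientMap q.continuous hq
  exact ⟨hq'.lift f (fun a b => h a b), fun a =>
    congrArg (fun k : C(K, E) => k a) (hq'.lift_comp f (fun a b => h a b))⟩

instance (n : ℕ) : CompactSpace (stdSimplex ℝ (Fin n)) :=
  isCompact_iff_compactSpace.1 (isCompact_stdSimplex ℝ (Fin n))

/-- The union of the faces opposite to the vertices in `J`. -/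
def faceUnion {n : ℕ} (J : Fin (n + 2) → Prop) : Set (stdSimplex ℝ (Fin (n + 2))) :=
  {x | ∃ j, J j ∧ x j = 0}

theorem isClosed_faceUnion {n : ℕ} (J : Fin (n + 2) → Prop) : IsClosed (faceUnion J) := by
  have : faceUnion J = ⋃ j : {j // J j}, {x | x j.1 = 0} := by
    ext x; simp [faceUnion]
  rw [this]
  apply isClosed_iUnion_of_finite
  intro j
  exact isClosed_eq ((continuous_apply j.1).comp continuous_subtype_val) continuous_const

instance {n : ℕ} (J : Fin (n + 2) → Prop) : CompactSpace (faceUnion J) :=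
  isCompact_iff_compactSpace.1 (isClosed_faceUnion J).isCompact

/-- A finite disjoint union of simplices is compact and maps onto the Hausdorff space `faceUnion J`,
which therefore carries the quotient topology. Compatibility is needed only for `j < k`, since each
face inclusion is injective. -/
theorem exists_glue {n : ℕ} (J : Fin (n + 2) → Prop) {E : Type u} [TopologicalSpace E]
    (f : ∀ j, J j → C(stdSimplex ℝ (Fin (n + 1)), E))
    (hf : ∀ j k (hj : J j) (hk : J k) y z, j < k →
      stdSimplex.map j.succAbove y = stdSimplex.map k.succAbove z → f j hj y = f k hk z) :
    ∃ F : C(faceUnion J, E), ∀ (x : faceUnion J) j (hj : J j) y,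
      stdSimplex.map j.succAbove y = x.1 → F x = f j hj y := by
  let q₀ : (Σ _ : {j // J j}, stdSimplex ℝ (Fin (n + 1))) → stdSimplex ℝ (Fin (n + 2)) :=
    fun p => stdSimplex.map p.1.1.succAbove p.2
  have hq₀ : Continuous q₀ := continuous_sigma fun j =>
    stdSimplex.continuous_map (S := ℝ) j.1.succAbove
  let q : C(Σ _ : {j // J j}, stdSimplex ℝ (Fin (n + 1)), faceUnion J) :=
    ⟨fun p => ⟨q₀ p, p.1.1, p.1.2, map_succAbove_self _ _⟩, hq₀.subtype_mk _⟩
  obtain ⟨F, hF⟩ := exists_descent q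
    (by
      rintro ⟨x, j, hj, hx⟩
      obtain ⟨z, rfl⟩ := exists_map_succAbove_eq j x hx
      exact ⟨⟨⟨j, hj⟩, z⟩, rfl⟩)
    ⟨fun p => f p.1.1 p.1.2 p.2, continuous_sigma fun j => (f j.1 j.2).continuous⟩
    (by
      rintro ⟨⟨j, hj⟩, y⟩ ⟨⟨k, hk⟩, z⟩ h
      replace h : stdSimplex.map j.succAbove y = stdSimplex.map k.succAbove z :=
        congrArg Subtype.val h
      change f j hj y = f k hk z
      rcases lt_trichotomy j k with hjk | rfl | hjk
      · exact hf _ _ _ _ _ _ hjk h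
      · rw [map_succAbove_injective j h]
      · exact (hf _ _ _ _ _ _ hjk h.symm).symm)
  refine ⟨F, ?_⟩
  rintro ⟨x, hx⟩ j hj y rfl
  exact hF ⟨⟨j, hj⟩, y⟩

/-- A lifting property against a subcomplex of a simplex which is a union of faces can be checked
on topological simplices. -/
theorem hasLiftingProperty_of_faceUnion {n : ℕ} (A : (Δ[n + 1] : SSet.{u}).Subcomplex)
    (J : Fin (n + 2) → Prop) (ι : ∀ j, J j → ((Δ[n] : SSet.{u}) ⟶ A))
    (hι : ∀ j hj, ι j hj ≫ A.ι = SSet.stdSimplex.δ j)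
    (ext : ∀ {X : SSet.{u}} {f g : (A : SSet.{u}) ⟶ X}, (∀ j hj, ι j hj ≫ f = ι j hj ≫ g) → f = g)
    {E B : TopCat.{u}} (p : E ⟶ B)
    (geo : ∀ (F : C(faceUnion J, E)) (b : C(stdSimplex ℝ (Fin (n + 2)), B)),
      (∀ x, p (F x) = b x.1) → ∃ l : C(stdSimplex ℝ (Fin (n + 2)), E),
        (∀ x : faceUnion J, l x.1 = F x) ∧ ∀ x, p (l x) = b x) :
    HasLiftingProperty A.ι (TopCat.toSSet.map p) := by
  refine ⟨fun {f b} sq => ?_⟩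
  let f' : ∀ j, J j → C(stdSimplex ℝ (Fin (n + 1)), E) := fun j hj =>
    E.toSSetObjEquiv (op ⦋n⦌) (SSet.yonedaEquiv (ι j hj ≫ f))
  let b' : C(stdSimplex ℝ (Fin (n + 2)), B) := B.toSSetObjEquiv (op ⦋n + 1⦌) (SSet.yonedaEquiv b)
  have δapp : ∀ {m : ℕ} {Z : TopCat.{u}} (j : Fin (m + 2)) (g : (Δ[m + 1] : SSet.{u}) ⟶ TopCat.toSSet.obj Z)
      (y : stdSimplex ℝ (Fin (m + 1))),
      Z.toSSetObjEquiv (op ⦋m⦌) (SSet.yonedaEquiv (SSet.stdSimplex.δ j ≫ g)) y =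
        Z.toSSetObjEquiv (op ⦋m + 1⦌) (SSet.yonedaEquiv g) (stdSimplex.map j.succAbove y) := by
    intro m Z j g y
    have : SSet.yonedaEquiv (SSet.stdSimplex.δ j ≫ g) =
        (TopCat.toSSet.obj Z).δ j (SSet.yonedaEquiv g) :=
      (SSet.yonedaEquiv_comp _ _).trans (SSet.yonedaEquiv_naturality ..).symm
    rw [this]
    exact TopCat.toSSetObjEquiv_δ_apply _ _ _
  have compat : ∀ j k (hj : J j) (hk : J k) y z, j < k →
      stdSimplex.map j.succAbove y = stdSimplex.map k.succAbove z → f' j hj y = f' k hk z := by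
    intro j k hj hk y z hjk h
    -- A common point of two faces lies in the face of codimension two where they meet. With `j =
    -- castSucc j'` and `k = succ k'`, the identity `δ_comp_δ` says that both maps restrict to the
    -- same map there.
    obtain ⟨j', rfl⟩ := j.eq_castSucc_of_ne_last (Fin.ne_last_of_lt hjk)
    obtain ⟨k', rfl⟩ := k.eq_succ_of_ne_zero (Fin.ne_zero_of_lt hjk)
    have hjk' : j' ≤ k' := Fin.castSucc_lt_succ_iff.1 hjk
    have hy : y k' = 0 := by
      rw [← map_succAbove_apply j'.castSucc y k', Fin.succAbove_castSucc_of_le _ _ hjk', h,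
        map_succAbove_self]
    obtain _ | n := n
    -- The two faces of a 1-simplex are distinct vertices, with no common point.
    · have := stdSimplex.sum_eq_one y
      obtain rfl : k' = 0 := by ext; omega
      rw [Fin.sum_univ_one, hy] at this
      exact absurd this zero_ne_one
    obtain ⟨w, rfl⟩ := exists_map_succAbove_eq k' y hy
    have hcomm : stdSimplex.map (S := ℝ) j'.castSucc.succAbove (stdSimplex.map k'.succAbove w) =
        stdSimplex.map k'.succ.succAbove (stdSimplex.map j'.succAbove w) := by
      rw [stdSimplex.map_comp_apply, stdSimplex.map_comp_apply]
      congr 1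
      funext l
      exact (congrArg (fun φ => SimplexCategory.Hom.toOrderHom φ l)
        (SimplexCategory.δ_comp_δ hjk')).symm
    obtain rfl : stdSimplex.map j'.succAbove w = z :=
      map_succAbove_injective _ (hcomm.symm.trans h)
    have hι' : SSet.stdSimplex.δ k' ≫ ι j'.castSucc hj = SSet.stdSimplex.δ j' ≫ ι k'.succ hk := by
      rw [← cancel_mono A.ι, Category.assoc, Category.assoc, hι, hι,
        SSet.stdSimplex.δ_comp_δ hjk']
    change E.toSSetObjEquiv (op ⦋n + 1⦌) _ _ = E.toSSetObjEquiv (op ⦋n + 1⦌) _ _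
    rw [← δapp, ← δapp, ← Category.assoc, hι', Category.assoc]
  obtain ⟨F, hF⟩ := exists_glue J f' compat
  have hFb : ∀ x, p (F x) = b' x.1 := by
    rintro ⟨x, j, hj, hx⟩
    obtain ⟨y, rfl⟩ := exists_map_succAbove_eq j x hx
    rw [hF _ j hj y rfl]
    change B.toSSetObjEquiv (op ⦋n⦌) ((TopCat.toSSet.map p).app _ (SSet.yonedaEquiv (ι j hj ≫ f))) y
      = _
    rw [← SSet.yonedaEquiv_comp, Category.assoc, sq.w, ← Category.assoc, hι, δapp]
  obtain ⟨l, hl, hl'⟩ := geo F b' hFb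
  let l' : (Δ[n + 1] : SSet.{u}) ⟶ TopCat.toSSet.obj E :=
    SSet.yonedaEquiv.symm ((E.toSSetObjEquiv (op ⦋n + 1⦌)).symm l)
  have hl'' : E.toSSetObjEquiv (op ⦋n + 1⦌) (SSet.yonedaEquiv l') = l := by
    simp [l']
  refine ⟨⟨⟨l', ext fun j hj => ?_, ?_⟩⟩⟩
  · rw [← Category.assoc, hι]
    apply SSet.yonedaEquiv.injective
    apply (E.toSSetObjEquiv (op ⦋n⦌)).injective
    ext y
    rw [δapp, hl'']
    exact (hl ⟨_, j, hj, map_succAbove_self j y⟩).trans (hF _ j hj y rfl)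
  · apply SSet.yonedaEquiv.injective
    apply (B.toSSetObjEquiv (op ⦋n + 1⦌)).injective
    ext y
    rw [SSet.yonedaEquiv_comp]
    change p (E.toSSetObjEquiv (op ⦋n + 1⦌) (SSet.yonedaEquiv l') y) = _
    rw [hl'', hl']

/-- The homotopy lifting property. -/
def HasHLP {E B : Type u} [TopologicalSpace E] [TopologicalSpace B] (p : C(E, B)) : Prop :=
  ∀ (Y : Type) [TopologicalSpace Y] (f : C(Y, E)) (h : C(Y × I, B)), (∀ y, h (y, 0) = p (f y)) →
    ∃ l : C(Y × I, E), (∀ y, l (y, 0) = f y) ∧ ∀ z, p (l z) = h z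

/-! ### Lifting against horns -/

section Horn

variable {n : ℕ} (k : Fin (n + 2))

theorem erase_nonempty : (Finset.univ.erase k).Nonempty :=
  ⟨k.succAbove 0, by simp⟩

/-- The smallest coordinate of index different from `k`. -/
noncomputable def depth (x : stdSimplex ℝ (Fin (n + 2))) : ℝ :=
  (Finset.univ.erase k).inf' (erase_nonempty k) fun j => x j

theorem continuous_depth : Continuous (depth k) :=
  Continuous.finset_inf'_apply (erase_nonempty k)
    fun j _ => (continuous_apply j).comp continuous_subtype_val

theorem depth_le {j : Fin (n + 2)} (hj : j ≠ k) (x : stdSimplex ℝ (Fin (n + 2))) :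
    depth k x ≤ x j :=
  Finset.inf'_le (fun j => x j) (by simp [hj])

theorem exists_eq_depth (x : stdSimplex ℝ (Fin (n + 2))) : ∃ j, j ≠ k ∧ x j = depth k x := by
  obtain ⟨j, hj, h⟩ := Finset.exists_mem_eq_inf' (erase_nonempty k) (fun j => x j)
  exact ⟨j, by simpa using hj, h.symm⟩

theorem depth_nonneg (x : stdSimplex ℝ (Fin (n + 2))) : 0 ≤ depth k x := by
  obtain ⟨j, -, h⟩ := exists_eq_depth k x
  exact h ▸ x.2.1 j

theorem depth_le_one (x : stdSimplex ℝ (Fin (n + 2))) : depth k x ≤ 1 := by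
  obtain ⟨j, -, h⟩ := exists_eq_depth k x
  exact h ▸ stdSimplex.le_one x j

/-- The point obtained by moving `x` towards the vertex `k`, parallel to the line from the
barycenter of the face opposite to it, by the amount `c`. -/
noncomputable def shift (x : stdSimplex ℝ (Fin (n + 2))) (c : ℝ) (h₀ : 0 ≤ c)
    (h₁ : c ≤ depth k x) : stdSimplex ℝ (Fin (n + 2)) :=
  ⟨fun j => if j = k then x j + (n + 1) * c else x j - c, by
    constructor
    · intro j
      change 0 ≤ if j = k then x j + (n + 1) * c else x j - c
      split_ifs with h
      · have := x.2.1 j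
        positivity
      · linarith [depth_le k h x]
    · have := stdSimplex.sum_eq_one x
      rw [Fin.sum_univ_succAbove _ k] at this ⊢
      simp only [if_true, Fin.succAbove_ne, if_false, Finset.sum_sub_distrib, Finset.sum_const,
        Finset.card_univ, Fintype.card_fin, nsmul_eq_mul, Nat.cast_add, Nat.cast_one]
      linarith⟩

theorem shift_eq_self (x : stdSimplex ℝ (Fin (n + 2))) (c : ℝ) (h₀ : 0 ≤ c) (h₁ : c ≤ depth k x)
    (hc : c = 0) : shift k x c h₀ h₁ = x := by
  subst hc
  apply stdSimplex.ext
  funext j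
  change (if j = k then x j + (n + 1) * 0 else x j - 0) = x j
  split_ifs <;> simp

/-- Maps defined on a horn lift along maps with the homotopy lifting property. -/
theorem exists_lift_of_horn {E B : Type u} [TopologicalSpace E] [TopologicalSpace B] (p : C(E, B))
    (hp : HasHLP p) (F : C(faceUnion (fun j => j ≠ k), E)) (b : C(stdSimplex ℝ (Fin (n + 2)), B))
    (hF : ∀ x, p (F x) = b x.1) : ∃ l : C(stdSimplex ℝ (Fin (n + 2)), E),
      (∀ x : faceUnion (fun j => j ≠ k), l x.1 = F x) ∧ ∀ x, p (l x) = b x := by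
  have hc : ∀ {Y : Type} [TopologicalSpace Y] (g : Y → stdSimplex ℝ (Fin (n + 2))) (c : Y → ℝ)
      (h₀ : ∀ y, 0 ≤ c y) (h₁ : ∀ y, c y ≤ depth k (g y)), Continuous g → Continuous c →
      Continuous fun y => shift k (g y) (c y) (h₀ y) (h₁ y) := by
    intro Y _ g c h₀ h₁ hg hc
    apply Continuous.subtype_mk
    apply continuous_pi
    intro j
    have : Continuous fun y => (g y) j :=
      (continuous_apply j).comp (continuous_subtype_val.comp hg)
    split_ifs <;> fun_prop
  have hmem : ∀ x, shift k x (depth k x) (depth_nonneg k x) le_rfl ∈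
      faceUnion (fun j => j ≠ k) := fun x => by
    obtain ⟨j, hj, h⟩ := exists_eq_depth k x
    refine ⟨j, hj, ?_⟩
    change (if j = k then x j + (n + 1) * depth k x else x j - depth k x) = 0
    rw [if_neg hj, h, sub_self]
  -- Moving `x` by the full amount `depth k x` annihilates a coordinate of index different from `k`,
  -- so `ρ` retracts the simplex onto the horn. The map `D` below deforms `ρ` to the identity,
  -- reaching `x` at time `depth k x`.
  let ρ : C(stdSimplex ℝ (Fin (n + 2)), faceUnion (fun j => j ≠ k)) :=
    ⟨fun x => ⟨shift k x (depth k x) (depth_nonneg k x) le_rfl, hmem x⟩,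
      (hc _ _ _ _ continuous_id (continuous_depth k)).subtype_mk hmem⟩
  let D : C(stdSimplex ℝ (Fin (n + 2)) × I, stdSimplex ℝ (Fin (n + 2))) :=
    ⟨fun z => shift k z.1 (max (depth k z.1 - z.2) 0) (le_max_right _ _)
        (max_le (by linarith [z.2.2.1]) (depth_nonneg k z.1)),
      hc _ _ _ _ continuous_fst
        ((((continuous_depth k).comp continuous_fst).sub (by fun_prop)).max continuous_const)⟩
  obtain ⟨l, hl, hl'⟩ := hp _ (F.comp ρ) (b.comp D) (fun x => by
    refine Eq.trans ?_ (hF (ρ x)).symm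
    have : D (x, 0) = (ρ x).1 := by
      apply stdSimplex.ext
      funext j
      change (if j = k then x j + (n + 1) * max (depth k x - ((0 : I) : ℝ)) 0 else
        x j - max (depth k x - ((0 : I) : ℝ)) 0) =
        (if j = k then x j + (n + 1) * depth k x else x j - depth k x)
      simp [depth_nonneg]
    exact congrArg b this)
  -- Evaluating at the time `depth k x` instead of `1` makes the lift relative: the projection is
  -- already `b x`, while on the horn the time is `0`, where the lift is `F` itself.
  let s : C(stdSimplex ℝ (Fin (n + 2)), stdSimplex ℝ (Fin (n + 2)) × I) :=
    ⟨fun x => (x, ⟨depth k x, depth_nonneg k x, depth_le_one k x⟩),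
      continuous_id.prodMk ((continuous_depth k).subtype_mk _)⟩
  refine ⟨l.comp s, ?_, fun x => ?_⟩
  · rintro ⟨x, j, hj, hx⟩
    have h0 : depth k x = 0 := le_antisymm (hx ▸ depth_le k hj x) (depth_nonneg k x)
    have hs : s x = (x, 0) := Prod.ext rfl (Subtype.ext h0)
    have hρ : ρ x = ⟨x, j, hj, hx⟩ := by
      exact Subtype.ext (shift_eq_self k x _ (depth_nonneg k x) le_rfl h0)
    rw [ContinuousMap.comp_apply, hs, hl, ContinuousMap.comp_apply, hρ]
  · rw [ContinuousMap.comp_apply, hl', ContinuousMap.comp_apply]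
    have h0 : max (depth k x - depth k x) 0 = 0 := by simp
    exact congrArg b (shift_eq_self k x _ h0.ge (h0.le.trans (depth_nonneg k x)) h0)

theorem hasLiftingProperty_horn {E B : TopCat.{u}} (p : E ⟶ B) (hp : HasHLP p.hom) :
    HasLiftingProperty (SSet.horn.{u} (n + 1) k).ι (TopCat.toSSet.map p) :=
  hasLiftingProperty_of_faceUnion _ (fun j => j ≠ k) (fun j hj => SSet.horn.ι k j hj)
    (fun j hj => SSet.horn.ι_ι k j hj) (fun h => SSet.horn.hom_ext' h) p
    (fun F b h => exists_lift_of_horn k p.hom hp F b h)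

end Horn

/-! ### Extending homotopies from the boundary of a simplex -/

section Boundary

variable {n : ℕ}

/-- The smallest barycentric coordinate. -/
noncomputable def low (x : stdSimplex ℝ (Fin (n + 2))) : ℝ :=
  Finset.univ.inf' Finset.univ_nonempty fun j => x j

theorem continuous_low : Continuous (low (n := n)) :=
  Continuous.finset_inf'_apply Finset.univ_nonempty
    fun j _ => (continuous_apply j).comp continuous_subtype_val

theorem low_le (j : Fin (n + 2)) (x : stdSimplex ℝ (Fin (n + 2))) : low x ≤ x j :=
  Finset.inf'_le (fun j => x j) (by simp)

theorem exists_eq_low (x : stdSimplex ℝ (Fin (n + 2))) : ∃ j, x j = low x := by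
  obtain ⟨j, hj, h⟩ := Finset.exists_mem_eq_inf' Finset.univ_nonempty (fun j => x j)
  exact ⟨j, h.symm⟩

theorem low_nonneg (x : stdSimplex ℝ (Fin (n + 2))) : 0 ≤ low x := by
  obtain ⟨j, h⟩ := exists_eq_low x
  exact h ▸ x.2.1 j

/-- The part of the cylinder over a simplex which consists of the bottom and the sides. -/
def openBox (n : ℕ) : Set (stdSimplex ℝ (Fin (n + 2)) × I) :=
  {z | z.1 ∈ faceUnion (fun _ => True) ∨ z.2 = 0}

/-- The inverse scaling factor of the radial projection of the cylinder over a simplex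
onto its bottom and sides. -/
noncomputable def scale (z : stdSimplex ℝ (Fin (n + 2)) × I) : ℝ :=
  max (1 - (z.2 : ℝ) / 2) (1 - (n + 2) * low z.1)

theorem half_le_scale (z : stdSimplex ℝ (Fin (n + 2)) × I) : 1 / 2 ≤ scale z :=
  le_max_of_le_left (by linarith [z.2.2.2])

theorem scale_le_one (z : stdSimplex ℝ (Fin (n + 2)) × I) : scale z ≤ 1 := by
  have := mul_nonneg (show (0 : ℝ) ≤ n + 2 by positivity) (low_nonneg z.1)
  exact max_le (by linarith [z.2.2.1]) (by linarith)

theorem continuous_scale : Continuous (scale (n := n)) := by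
  have := (continuous_low (n := n)).comp (continuous_fst (Y := I))
  exact Continuous.max (by fun_prop) (continuous_const.sub (continuous_const.mul this))

/-- The radial projection of the cylinder over a simplex onto its bottom and sides. -/
noncomputable def radial : C(stdSimplex ℝ (Fin (n + 2)) × I, openBox n) where
  -- The centre of projection is the point at height `2` over the barycenter. On the ray from it
  -- through `z`, the bottom is met at inverse scale `1 - t/2` and the sides at `1 - (n + 2) * low`;
  -- the larger of the two belongs to the first hit.
  toFun z := ⟨⟨⟨fun j => 1 / (n + 2) + (z.1 j - 1 / (n + 2)) / scale z, by
      have hs := half_le_scale z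
      have hN : (0 : ℝ) < n + 2 := by positivity
      constructor
      · intro j
        have h1 : 1 - (n + 2) * low z.1 ≤ scale z := le_max_right _ _
        have h2 := low_le j z.1
        have h3 : (1 / (n + 2) + (z.1 j - 1 / (n + 2)) / scale z : ℝ) =
          ((scale z - (1 - (n + 2) * low z.1)) + (n + 2) * (z.1 j - low z.1)) /
            ((n + 2) * scale z) := by
          field_simp; ring
        change (0 : ℝ) ≤ 1 / (n + 2) + (z.1 j - 1 / (n + 2)) / scale z
        rw [h3]
        exact div_nonneg (add_nonneg (by linarith) (mul_nonneg hN.le (by linarith)))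
          (mul_nonneg hN.le (by linarith))
      · have := stdSimplex.sum_eq_one z.1
        simp only [Finset.sum_add_distrib, ← Finset.sum_div, Finset.sum_sub_distrib, this,
          Finset.sum_const, Finset.card_univ, Fintype.card_fin, nsmul_eq_mul]
        push_cast
        field_simp
        ring⟩,
    ⟨2 - (2 - z.2) / scale z, by
      have hs := half_le_scale z
      have h1 : 1 - (z.2 : ℝ) / 2 ≤ scale z := le_max_left _ _
      rw [sub_nonneg, div_le_iff₀ (by linarith)]
      linarith, by
      have hs := half_le_scale z
      have h1 := scale_le_one z
      rw [sub_le_comm, le_div_iff₀ (by linarith)]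
      linarith [z.2.2.2]⟩⟩, by
      have hs := half_le_scale z
      rcases max_choice (1 - (z.2 : ℝ) / 2) (1 - (n + 2) * low z.1) with h | h
      · right
        apply Subtype.ext
        change 2 - (2 - (z.2 : ℝ)) / scale z = 0
        replace h : scale z = _ := h
        have : 2 - (z.2 : ℝ) = 2 * scale z := by rw [h]; ring
        rw [this]
        field_simp
        ring
      · left
        obtain ⟨j, hj⟩ := exists_eq_low z.1
        refine ⟨j, trivial, ?_⟩
        change (1 / (n + 2) + (z.1 j - 1 / (n + 2)) / scale z : ℝ) = 0
        replace h : scale z = _ := h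
        have : (z.1 j - 1 / (n + 2) : ℝ) = - (1 / (n + 2) * scale z) := by
          rw [h, hj]; field_simp; ring
        rw [this]
        field_simp
        ring⟩
  continuous_toFun := by
    have hs : ∀ z, scale (n := n) z ≠ 0 := fun z => by linarith [half_le_scale z]
    have hc := continuous_scale (n := n)
    refine Continuous.subtype_mk (Continuous.prodMk ?_ ?_) _
    · refine Continuous.subtype_mk (continuous_pi fun j => ?_) _
      have : Continuous fun z : stdSimplex ℝ (Fin (n + 2)) × I => z.1 j :=
        (continuous_apply j).comp (continuous_subtype_val.comp continuous_fst)
      exact continuous_const.add ((this.sub continuous_const).div hc hs)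
    · exact Continuous.subtype_mk (continuous_const.sub
        ((by fun_prop : Continuous fun z : stdSimplex ℝ (Fin (n + 2)) × I => 2 - (z.2 : ℝ)).div
          hc hs)) _

theorem radial_of_mem (z : stdSimplex ℝ (Fin (n + 2)) × I) (hz : z ∈ openBox n) :
    radial z = ⟨z, hz⟩ := by
  have hs : scale z = 1 := by
    apply le_antisymm (scale_le_one z)
    rcases hz with ⟨j, -, hj⟩ | hz
    · have : low z.1 = 0 := le_antisymm (hj ▸ low_le j z.1) (low_nonneg z.1)
      exact le_max_of_le_right (by simp [this])
    · exact le_max_of_le_left (by simp [hz])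
  apply Subtype.ext
  apply Prod.ext
  · apply stdSimplex.ext
    funext j
    change (1 / (n + 2) + (z.1 j - 1 / (n + 2)) / scale z : ℝ) = z.1 j
    rw [hs]; ring
  · apply Subtype.ext
    change 2 - (2 - (z.2 : ℝ)) / scale z = z.2
    rw [hs]; ring

/-- A homotopy given on the boundary of a simplex, whose start extends, extends. -/
theorem exists_extension_of_boundary {T : Type u} [TopologicalSpace T]
    (F : C(faceUnion (n := n) (fun _ => True), C(I, T))) (b : C(stdSimplex ℝ (Fin (n + 2)), T))
    (hF : ∀ x, F x 0 = b x.1) : ∃ l : C(stdSimplex ℝ (Fin (n + 2)), C(I, T)),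
      (∀ x : faceUnion (n := n) (fun _ => True), l x.1 = F x) ∧ ∀ x, l x 0 = b x := by
  -- The bottom and the sides form a quotient of a compact disjoint union, so `F` and `b` glue to a
  -- map on the open box; the radial retraction then extends it to the cylinder.
  let q : C((faceUnion (n := n) (fun _ => True) × I) ⊕ stdSimplex ℝ (Fin (n + 2)), openBox n) :=
    ⟨Sum.elim (fun z => ⟨(z.1.1, z.2), Or.inl z.1.2⟩) (fun x => ⟨(x, 0), Or.inr rfl⟩), by
      fun_prop⟩
  obtain ⟨G, hG⟩ := exists_descent q
    (by
      rintro ⟨⟨x, t⟩, h⟩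
      by_cases hx : x ∈ faceUnion (fun _ => True)
      · exact ⟨Sum.inl (⟨x, hx⟩, t), rfl⟩
      · obtain rfl : t = 0 := h.resolve_left hx
        exact ⟨Sum.inr x, rfl⟩)
    ⟨Sum.elim (fun z => F z.1 z.2) b, by fun_prop⟩
    (by
      have key : ∀ z x, q (Sum.inl z) = q (Sum.inr x) → F z.1 z.2 = b x := by
        rintro ⟨z, t⟩ x h
        obtain ⟨h1, h2⟩ := Prod.ext_iff.1 (congrArg Subtype.val h)
        obtain rfl : t = 0 := h2
        obtain rfl : z.1 = x := h1
        exact hF z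
      rintro (z | x) (z' | x') h
      · have h1 := Prod.ext_iff.1 (congrArg Subtype.val h)
        have : z = z' := Prod.ext (Subtype.ext h1.1) h1.2
        rw [this]
      · exact key _ _ h
      · exact (key _ _ h.symm).symm
      · have h1 := Prod.ext_iff.1 (congrArg Subtype.val h)
        have : x = x' := h1.1
        rw [this])
  refine ⟨(G.comp radial).curry, fun x => ?_, fun x => ?_⟩
  · ext t
    change G (radial (x.1, t)) = F x t
    rw [radial_of_mem _ (Or.inl x.2)]
    exact hG (Sum.inl (x, t))
  · change G (radial (x, 0)) = b x
    rw [radial_of_mem _ (Or.inr rfl)]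
    exact hG (Sum.inr x)

/-- The space of paths in a space. -/
abbrev pathSpace (T : TopCat.{u}) : TopCat.{u} := TopCat.of C(I, T)

/-- The evaluation of paths at their start. -/
def evalZero (T : TopCat.{u}) : pathSpace T ⟶ T :=
  TopCat.ofHom ⟨fun γ => γ 0, by fun_prop⟩

/-- The evaluation of paths at their end. -/
def evalOne (T : TopCat.{u}) : pathSpace T ⟶ T :=
  TopCat.ofHom ⟨fun γ => γ 1, by fun_prop⟩

/-- The evaluation of paths at both ends. -/
def evalEnds (T : TopCat.{u}) : pathSpace T ⟶ TopCat.of (T × T) :=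
  TopCat.ofHom ⟨fun γ => (γ 0, γ 1), by fun_prop⟩

/-- The constant paths. -/
def constPath (T : TopCat.{u}) : T ⟶ pathSpace T :=
  TopCat.ofHom (HomotopyExtension.constPaths (ContinuousMap.id T))

theorem constPath_evalZero (T : TopCat.{u}) : constPath T ≫ evalZero T = 𝟙 T := rfl

/-- The cylinder over a simplex retracts onto its bottom and sides. Since boundary inclusions
generate the monomorphisms, this is the source of the homotopy extension property for realizations
of all monomorphisms. -/
theorem rlp_boundary_evalZero (T : TopCat.{u}) :
    SSet.modelCategoryQuillen.I.rlp (TopCat.toSSet.map (evalZero T)) := by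
  rintro _ _ _ ⟨n⟩
  obtain _ | n := n
  -- The boundary of `Δ[0]` is empty, so constant paths solve the problem.
  · refine ⟨fun {f b} sq => ⟨⟨⟨b ≫ TopCat.toSSet.map (constPath T), ?_, ?_⟩⟩⟩⟩
    · exact SSet.boundary.hom_ext₀
    · rw [Category.assoc, ← Functor.map_comp, constPath_evalZero]; simp
  · exact hasLiftingProperty_of_faceUnion _ (fun _ => True) (fun j _ => SSet.boundary.ι j)
      (fun j _ => SSet.boundary.ι_ι j) (fun h => SSet.boundary.hom_ext fun j => h j trivial) _
      (fun F b h => exists_extension_of_boundary F b h)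

end Boundary

/-- A motion of the two ends of a path lifts by attaching to the path the tracks of its ends, which
is what `concat` does. -/
theorem hasHLP_evalEnds (T : TopCat.{u}) : HasHLP (evalEnds T).hom := by
  intro Y _ f h hf
  let U : C(Y, C(I, T)) := ContinuousMap.curry (ContinuousMap.fst.comp h)
  let V : C(Y, C(I, T)) := ContinuousMap.curry (ContinuousMap.snd.comp h)
  have h₀ : ∀ y, U y 0 = f y 0 := fun y => congrArg Prod.fst (hf y)
  have h₁ : ∀ y, V y 0 = f y 1 := fun y => congrArg Prod.snd (hf y)
  exact ⟨HomotopyExtension.concat U f V h₀ h₁, HomotopyExtension.concat_zero h₀ h₁, fun z =>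
    Prod.ext (HomotopyExtension.concat_start h₀ h₁ z.1 z.2)
      (HomotopyExtension.concat_end h₀ h₁ z.1 z.2)⟩

/-- The map to a point. -/
def toPoint (T : TopCat.{u}) : T ⟶ TopCat.of PUnit.{u + 1} :=
  TopCat.ofHom ⟨fun _ => PUnit.unit, continuous_const⟩

theorem hasHLP_toPoint (T : TopCat.{u}) : HasHLP (toPoint T).hom :=
  fun _ _ f _ _ => ⟨f.comp ContinuousMap.fst, fun _ => rfl, fun _ => rfl⟩

end SimplexGluing

/-! ### Maps with invertible realization as a lifting class -/

namespace RealizationEquivalence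

open Simplicial MonoidalCategory CartesianMonoidalCategory Limits SimplexGluing HomotopyExtension

/-- The homotopy relation on continuous maps. -/
def homotopyRel : HomRel TopCat.{u} := fun _ _ f g => ContinuousMap.Homotopic f.hom g.hom

instance : Congruence homotopyRel.{u} where
  equivalence :=
    { refl := fun f => ContinuousMap.Homotopic.refl f.hom
      symm := fun h => ContinuousMap.Homotopic.symm h
      trans := fun h h' => ContinuousMap.Homotopic.trans h h' }
  comp_left f _ _ h := ContinuousMap.Homotopic.comp h (ContinuousMap.Homotopic.refl f.hom)
  comp_right g h := ContinuousMap.Homotopic.comp (ContinuousMap.Homotopic.refl g.hom) h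

/-- The functor from topological spaces to the naive homotopy category. -/
abbrev toHo : TopCat.{u} ⥤ Quotient homotopyRel.{u} := Quotient.functor homotopyRel

theorem toHo_map_eq_iff {X Y : TopCat.{u}} (f g : X ⟶ Y) :
    toHo.map f = toHo.map g ↔ ContinuousMap.Homotopic f.hom g.hom :=
  Quotient.functor_map_eq_iff homotopyRel f g

/-- This makes `W` the inverse image of the isomorphisms under a functor, so two-out-of-three and
multiplicativity are formal. -/
theorem isHomotopyEquivalence_iff {X Y : TopCat.{u}} (f : X ⟶ Y) :
    IsHomotopyEquivalence f ↔ IsIso (toHo.map f) := by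
  constructor
  · rintro ⟨e, he⟩
    refine ⟨toHo.map (TopCat.ofHom e.invFun), ?_, ?_⟩
    · rw [← Functor.map_comp, ← CategoryTheory.Functor.map_id, toHo_map_eq_iff]
      change (e.invFun.comp f.hom).Homotopic _
      rw [← he]
      exact e.left_inv
    · rw [← Functor.map_comp, ← CategoryTheory.Functor.map_id, toHo_map_eq_iff]
      change ((f.hom).comp e.invFun).Homotopic _
      rw [← he]
      exact e.right_inv
  · rintro ⟨g, h₁, h₂⟩
    obtain ⟨g, rfl⟩ := toHo.map_surjective g
    rw [← Functor.map_comp, ← CategoryTheory.Functor.map_id, toHo_map_eq_iff] at h₁ h₂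
    exact ⟨⟨f.hom, g.hom, h₁, h₂⟩, rfl⟩

/-- The functor from simplicial sets to the naive homotopy category given by the realization. -/
noncomputable abbrev realHo : SSet.{u} ⥤ Quotient homotopyRel.{u} := SSet.toTop ⋙ toHo

/-- The maps of simplicial sets whose realization is a homotopy equivalence. -/
def W : MorphismProperty SSet.{u} := (MorphismProperty.isomorphisms _).inverseImage realHo

instance : W.{u}.HasTwoOutOfThreeProperty := by unfold W; infer_instance

instance : W.{u}.RespectsIso := by unfold W; infer_instance

instance : W.{u}.IsMultiplicative := by unfold W; infer_instance

theorem W_iff {X Y : SSet.{u}} (f : X ⟶ Y) : W f ↔ IsHomotopyEquivalence (SSet.toTop.map f) :=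
  (isHomotopyEquivalence_iff _).symm

/-- The maps of singular simplicial sets which detect maps in `W`. -/
def testFibrations : MorphismProperty SSet.{u} :=
  MorphismProperty.ofHoms (fun T : TopCat.{u} => TopCat.toSSet.map (toPoint T)) ⊔
    MorphismProperty.ofHoms (fun T : TopCat.{u} => TopCat.toSSet.map (evalEnds T))

/-- Transposed along the adjunction between realization and singular complex, a lift against
`toPoint` is an extension of a map, and a lift against `evalEnds` is an extension of a homotopy with
both ends prescribed. This lemma and the next three are that dictionary. -/
theorem llp_toPoint {X Y : SSet.{u}} {i : X ⟶ Y} (T : TopCat.{u})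
    (h : ExtendsMaps (SSet.toTop.map i).hom) :
    HasLiftingProperty i (TopCat.toSSet.map (toPoint T)) := by
  rw [← sSetTopAdj.hasLiftingProperty_iff]
  refine ⟨fun {f b} sq => ?_⟩
  obtain ⟨k, hk⟩ := h T f.hom
  exact ⟨⟨⟨TopCat.ofHom k, by ext a; exact hk a, rfl⟩⟩⟩

theorem llp_evalEnds {X Y : SSet.{u}} {i : X ⟶ Y} (T : TopCat.{u})
    (h : ExtendsHomotopies (SSet.toTop.map i).hom) :
    HasLiftingProperty i (TopCat.toSSet.map (evalEnds T)) := by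
  rw [← sSetTopAdj.hasLiftingProperty_iff]
  refine ⟨fun {f b} sq => ?_⟩
  have hs := fun a => ConcreteCategory.congr_hom sq.w a
  obtain ⟨k, h0, h1, hk⟩ := h T (ContinuousMap.fst.comp b.hom) (ContinuousMap.snd.comp b.hom) f.hom
    (fun a => congrArg Prod.fst (hs a)) (fun a => congrArg Prod.snd (hs a))
  refine ⟨⟨⟨TopCat.ofHom k, TopCat.hom_ext (ContinuousMap.ext hk), ?_⟩⟩⟩
  exact TopCat.hom_ext (ContinuousMap.ext fun a => Prod.ext (h0 a) (h1 a))

theorem extendsMaps_of_llp {X Y : SSet.{u}} {i : X ⟶ Y} (h : testFibrations.llp i) :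
    ExtendsMaps (SSet.toTop.map i).hom := by
  intro T _ g
  have := h _ (Or.inl ⟨TopCat.of T⟩)
  rw [← sSetTopAdj.hasLiftingProperty_iff] at this
  have sq : CommSq (TopCat.ofHom g) (SSet.toTop.map i) (toPoint (TopCat.of T)) (toPoint _) := ⟨rfl⟩
  exact ⟨sq.lift.hom, fun a => ConcreteCategory.congr_hom sq.fac_left a⟩

theorem extendsHomotopies_of_llp {X Y : SSet.{u}} {i : X ⟶ Y} (h : testFibrations.llp i) :
    ExtendsHomotopies (SSet.toTop.map i).hom := by
  intro T _ f g k h₀ h₁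
  have := h _ (Or.inr ⟨TopCat.of T⟩)
  rw [← sSetTopAdj.hasLiftingProperty_iff] at this
  have sq : CommSq (TopCat.ofHom k) (SSet.toTop.map i) (evalEnds (TopCat.of T))
      (TopCat.ofHom (f.prodMk g)) := ⟨TopCat.hom_ext (ContinuousMap.ext fun a => Prod.ext (h₀ a) (h₁ a))⟩
  exact ⟨sq.lift.hom, fun x => congrArg Prod.fst (ConcreteCategory.congr_hom sq.fac_right x),
    fun x => congrArg Prod.snd (ConcreteCategory.congr_hom sq.fac_right x),
    fun a => ConcreteCategory.congr_hom sq.fac_left a⟩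

/-- Homotopy extension is lifting against `evalZero`. After transposition it suffices to treat
boundary inclusions, which have the same right lifting property as all monomorphisms. -/
theorem hasHEP_of_mono {X Y : SSet.{u}} (i : X ⟶ Y) [Mono i] :
    HasHEP (SSet.toTop.map i).hom := by
  intro T _ g h hg
  have hr := rlp_boundary_evalZero (TopCat.of T)
  rw [← SSet.rlp_monomorphisms] at hr
  have := hr i (MorphismProperty.monomorphisms.infer_property i)
  rw [← sSetTopAdj.hasLiftingProperty_iff] at this
  have sq : CommSq (TopCat.ofHom h) (SSet.toTop.map i) (evalZero (TopCat.of T))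
      (TopCat.ofHom g) := ⟨by ext a; exact hg a⟩
  exact ⟨sq.lift.hom, fun x => ConcreteCategory.congr_hom sq.fac_right x,
    fun a => ConcreteCategory.congr_hom sq.fac_left a⟩

theorem W_of_llp {X Y : SSet.{u}} {i : X ⟶ Y} (h : testFibrations.llp i) : W i := by
  rw [W_iff]
  exact (IsSDR.of_extends (extendsMaps_of_llp h) (extendsHomotopies_of_llp h)).exists_homotopyEquiv

/-- This is where `i` must be a monomorphism: only with homotopy extension does a homotopy
equivalence become a strong deformation retract. -/
theorem llp_of_W {X Y : SSet.{u}} {i : X ⟶ Y} [Mono i] (h : W i) : testFibrations.llp i := by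
  rw [W_iff] at h
  obtain ⟨e, he⟩ := h
  have hi := hasHEP_of_mono i
  have hs := IsSDR.of_hasHEP hi e he
  rintro _ _ _ (⟨⟨T⟩⟩ | ⟨⟨T⟩⟩)
  · exact llp_toPoint T (ExtendsMaps.of_isSDR hs)
  · exact llp_evalEnds T (ExtendsHomotopies.of_isSDR hi hs)

/-- The monomorphisms of simplicial sets whose realization is a homotopy equivalence. -/
def triv : MorphismProperty SSet.{u} := MorphismProperty.monomorphisms _ ⊓ W

/-- The right-hand side is visibly stable under cobase change and sequential composition, the
left-hand side has two-out-of-three; later arguments alternate between the two descriptions. -/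
theorem triv_eq : triv.{u} = MorphismProperty.monomorphisms _ ⊓ testFibrations.llp := by
  ext X Y i
  constructor
  · rintro ⟨h₁, h₂⟩
    have : Mono i := h₁
    exact ⟨h₁, llp_of_W h₂⟩
  · rintro ⟨h₁, h₂⟩
    exact ⟨h₁, W_of_llp h₂⟩

instance : triv.{u}.IsStableUnderCobaseChange := by rw [triv_eq]; infer_instance

instance : triv.{u}.IsMultiplicative := by unfold triv; infer_instance

open SSet.Subcomplex in
/-- The inclusion of the first term of an exhaustive chain of subcomplexes belongs to `triv` if
the successive inclusions do. -/
theorem triv_of_chain {Z : SSet.{u}} (B : ℕ → Z.Subcomplex) (hB : Monotone B)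
    (h : ∀ n, triv (homOfLE (hB (Nat.le_succ n)))) (hsup : ⨆ n, B n = ⊤) : triv (B 0).ι := by
  rw [triv_eq] at h ⊢
  refine ⟨MorphismProperty.monomorphisms.infer_property _, ?_⟩
  have T : testFibrations.llp.TransfiniteCompositionOfShape ℕ (B 0).ι :=
    { F := hB.functor ⋙ toSSetFunctor
      isoBot := Iso.refl _
      incl := { app := fun n => (B n).ι }
      isColimit := IsColimit.ofIsoColimit (isColimitOfPreserves toSSetFunctor
        ((CompleteLattice.colimitCocone hB.functor).isColimit))
          (Cocone.ext (SSet.Subcomplex.eqToIso hsup ≪≫ topIso _))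
      map_mem := fun n _ => (h n).2 }
  exact testFibrations.llp.transfiniteCompositionsOfShape_le ℕ _ T.mem

/-- The test maps are Kan fibrations, because their topological counterparts have the homotopy
lifting property. Anodyne extensions therefore lift against them. -/
theorem testFibrations_le : testFibrations.{u} ≤ SSet.modelCategoryQuillen.J.rlp := by
  rintro _ _ _ hp _ _ _ hi
  simp only [SSet.modelCategoryQuillen.J, MorphismProperty.iSup_iff] at hi
  obtain ⟨n, ⟨k⟩⟩ := hi
  rcases hp with ⟨⟨T⟩⟩ | ⟨⟨T⟩⟩
  · exact hasLiftingProperty_horn k _ (hasHLP_toPoint T)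
  · exact hasLiftingProperty_horn k _ (hasHLP_evalEnds T)

theorem W_of_anodyne {X Y : SSet.{u}} {i : X ⟶ Y} (h : SSet.anodyneExtensions i) : W i :=
  W_of_llp (MorphismProperty.antitone_llp testFibrations_le _ h)

theorem W_of_isIso {X Y : SSet.{u}} (f : X ⟶ Y) [IsIso f] : W f :=
  MorphismProperty.of_isIso W f

theorem anodyne_δ_one : SSet.anodyneExtensions (SSet.stdSimplex.δ (1 : Fin 2) : (Δ[0] : SSet.{u}) ⟶ Δ[1]) := by
  have h : SSet.Subcomplex.range (SSet.stdSimplex.{u}.δ (1 : Fin 2)) = SSet.horn 1 0 := by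
    rw [SSet.stdSimplex.range_δ, SSet.horn_eq_iSup]
    apply le_antisymm
    · exact le_iSup (fun j : ({0}ᶜ : Set (Fin 2)) => SSet.stdSimplex.face.{u} {j.1}ᶜ) ⟨1, by simp⟩
    · refine iSup_le ?_
      rintro ⟨j, hj⟩
      obtain rfl : j = 1 := by fin_cases j <;> simp_all
      rfl
  rw [← SSet.Subcomplex.toRange_ι (SSet.stdSimplex.{u}.δ (1 : Fin 2))]
  refine MorphismProperty.comp_mem _ _ _ (SSet.anodyneExtensions.of_isIso _) ?_
  rw [h]
  exact SSet.anodyneExtensions.horn_ι 0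

/-- One end inclusion of the cylinder is anodyne, and the projection composed with it is an
isomorphism. -/
theorem W_fst_interval (X : SSet.{u}) : W (fst X Δ[1]) := by
  have h₁ : W (X ◁ SSet.stdSimplex.{u}.δ (1 : Fin 2)) := W_of_anodyne (anodyne_δ_one.whiskerLeft X)
  have h₂ : X ◁ SSet.stdSimplex.{u}.δ (1 : Fin 2) ≫ fst X Δ[1] = fst X Δ[0] := by simp
  have : IsIso (fst X Δ[0]) := by
    refine ⟨lift (𝟙 X) (SSet.stdSimplex.isTerminalObj₀.from X), ?_, by simp⟩
    ext : 1
    · simp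
    · exact SSet.stdSimplex.ext₀
  refine W.of_precomp _ _ h₁ ?_
  rw [h₂]
  exact W_of_isIso _

/-- Simplicially homotopic maps have homotopic realizations. -/
theorem realHo_map_eq {X Y : SSet.{u}} (H : X ⊗ Δ[1] ⟶ Y) :
    realHo.map (SSet.ι₀ ≫ H) = realHo.map (SSet.ι₁ ≫ H) := by
  have : IsIso (realHo.map (fst X Δ[1])) := W_fst_interval X
  -- Both end inclusions are sections of the projection, which is invertible in the homotopy
  -- category.
  have h : realHo.map (SSet.ι₀ (X := X)) = realHo.map SSet.ι₁ := by
    rw [← cancel_mono (realHo.map (fst X Δ[1])), ← Functor.map_comp, ← Functor.map_comp,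
      SSet.ι₀_fst, SSet.ι₁_fst]
  rw [Functor.map_comp, Functor.map_comp, h]

/-- A map of simplicial sets with a homotopy inverse belongs to `W`. -/
theorem W_of_homotopyInverse {X Y : SSet.{u}} (f : X ⟶ Y) (g : Y ⟶ X)
    (h₁ : realHo.map (f ≫ g) = 𝟙 _) (h₂ : realHo.map (g ≫ f) = 𝟙 _) : W f :=
  ⟨realHo.map g, by rw [← Functor.map_comp, h₁], by rw [← Functor.map_comp, h₂]⟩

/-- A homotopy is a map into the path space, so homotopies chosen on the summands assemble by the
universal property of the coproduct. -/
theorem homotopic_of_cofan {ι : Type w₁} {X : ι → TopCat.{u}} {c : Cofan X} (hc : IsColimit c)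
    {T : TopCat.{u}} (f g : c.pt ⟶ T) (h : ∀ i, toHo.map (c.inj i ≫ f) = toHo.map (c.inj i ≫ g)) :
    toHo.map f = toHo.map g := by
  simp only [toHo_map_eq_iff] at h ⊢
  let H := fun i => (h i).some
  let K : c.pt ⟶ pathSpace T := Cofan.IsColimit.desc hc fun i => TopCat.ofHom (pathFamily (H i))
  have hK : ∀ i, c.inj i ≫ K = TopCat.ofHom (pathFamily (H i)) := Cofan.IsColimit.fac hc _
  have h₀ : K ≫ evalZero T = f := Cofan.IsColimit.hom_ext hc _ _ fun i => by
    rw [← Category.assoc, hK]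
    exact TopCat.hom_ext (ContinuousMap.ext fun x => (H i).map_zero_left x)
  have h₁ : K ≫ evalOne T = g := Cofan.IsColimit.hom_ext hc _ _ fun i => by
    rw [← Category.assoc, hK]
    exact TopCat.hom_ext (ContinuousMap.ext fun x => (H i).map_one_left x)
  exact ⟨homotopyOfPathFamily K.hom (fun x => ConcreteCategory.congr_hom h₀ x)
    (fun x => ConcreteCategory.congr_hom h₁ x)⟩

/-- The class `W` is stable under coproducts. -/
theorem W_of_cofan {ι : Type w₁} {X Y : ι → SSet.{u}} {A B : SSet.{u}}
    {a : ∀ i, X i ⟶ A} {b : ∀ i, Y i ⟶ B} (hc : IsColimit (Cofan.mk A a))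
    (hd : IsColimit (Cofan.mk B b)) (f : A ⟶ B) (g : ∀ i, X i ⟶ Y i)
    (h : ∀ i, a i ≫ f = g i ≫ b i) (hg : ∀ i, W (g i)) : W f := by
  have hc' := isColimitCofanMkObjOfIsColimit SSet.toTop _ _ hc
  have hd' := isColimitCofanMkObjOfIsColimit SSet.toTop _ _ hd
  -- Realization preserves coproducts, so homotopy inverses chosen on the summands assemble to a
  -- candidate inverse `m`.
  choose k hk₁ hk₂ using fun i => (hg i).out
  choose l hl using fun i => toHo.map_surjective (k i)
  let m : SSet.toTop.obj B ⟶ SSet.toTop.obj A :=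
    Cofan.IsColimit.desc hd' fun i => l i ≫ SSet.toTop.map (a i)
  have hm : ∀ i, SSet.toTop.map (b i) ≫ m = l i ≫ SSet.toTop.map (a i) :=
    Cofan.IsColimit.fac hd' _
  have hk₁' : ∀ i, toHo.map (SSet.toTop.map (g i)) ≫ toHo.map (l i) = 𝟙 _ := fun i => by
    rw [hl]; exact hk₁ i
  have hk₂' : ∀ i, toHo.map (l i) ≫ toHo.map (SSet.toTop.map (g i)) = 𝟙 _ := fun i => by
    rw [hl]; exact hk₂ i
  refine ⟨toHo.map m, ?_, ?_⟩
  · change toHo.map (SSet.toTop.map f) ≫ toHo.map m = 𝟙 (toHo.obj _)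
    rw [← Functor.map_comp, ← CategoryTheory.Functor.map_id]
    refine homotopic_of_cofan hc' _ _ fun i => ?_
    change toHo.map (SSet.toTop.map (a i) ≫ _) = toHo.map (SSet.toTop.map (a i) ≫ _)
    rw [← Category.assoc, ← Functor.map_comp SSet.toTop, h, Functor.map_comp SSet.toTop,
      Category.assoc, hm,
      ← Category.assoc, Functor.map_comp, Functor.map_comp, hk₁', Category.id_comp,
      Category.comp_id]
  · change toHo.map m ≫ toHo.map (SSet.toTop.map f) = 𝟙 (toHo.obj _)
    rw [← Functor.map_comp, ← CategoryTheory.Functor.map_id]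
    refine homotopic_of_cofan hd' _ _ fun i => ?_
    change toHo.map (SSet.toTop.map (b i) ≫ _) = toHo.map (SSet.toTop.map (b i) ≫ _)
    rw [← Category.assoc, hm, Category.assoc, ← Functor.map_comp SSet.toTop, h, Functor.map_comp,
      Functor.map_comp, Functor.map_comp, ← Category.assoc, hk₂', Category.id_comp,
      Category.comp_id]

end RealizationEquivalence

/-! ### Contractible factors and pushout-products -/

namespace RealizationEquivalence

open Simplicial MonoidalCategory CartesianMonoidalCategory Limits

/-- Products with simplicially contractible simplicial sets do not change the homotopy type. -/
theorem W_fst_of_contraction {K : SSet.{u}} (pt : K _⦋0⦌) (H : K ⊗ Δ[1] ⟶ K)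
    (h₀ : SSet.ι₀ ≫ H = 𝟙 K) (h₁ : SSet.ι₁ ≫ H = SSet.const pt) (X : SSet.{u}) : W (fst X K) := by
  let H' : (X ⊗ K) ⊗ Δ[1] ⟶ X ⊗ K := (α_ X K Δ[1]).hom ≫ X ◁ H
  have h₀' : SSet.ι₀ ≫ H' = 𝟙 _ := by
    have : SSet.ι₀ ≫ (α_ X K Δ[1]).hom = X ◁ SSet.ι₀ := rfl
    rw [← Category.assoc, this, ← MonoidalCategory.whiskerLeft_comp, h₀]; simp
  have h₁' : SSet.ι₁ ≫ H' = fst X K ≫ lift (𝟙 X) (SSet.const pt) := by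
    have : SSet.ι₁ ≫ (α_ X K Δ[1]).hom = X ◁ SSet.ι₁ := rfl
    rw [← Category.assoc, this, ← MonoidalCategory.whiskerLeft_comp, h₁]
    rfl
  refine W_of_homotopyInverse _ (lift (𝟙 X) (SSet.const pt)) ?_ ?_
  · rw [← h₁', ← realHo_map_eq, h₀', CategoryTheory.Functor.map_id]
  · rw [lift_fst, CategoryTheory.Functor.map_id]

/-- The contraction of a simplex to its last vertex. -/
noncomputable def simplexContraction (n : ℕ) : (Δ[n] : SSet.{u}) ⊗ Δ[1] ⟶ Δ[n] where
  app m := ↾fun x => SSet.stdSimplex.objMk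
    { toFun := fun j => if SSet.stdSimplex.asOrderHom x.2 j = 0 then
        SSet.stdSimplex.asOrderHom x.1 j else Fin.last n
      monotone' := fun j k hjk => by
        dsimp only
        have h₁ := (SSet.stdSimplex.asOrderHom x.1).monotone hjk
        have h₂ := (SSet.stdSimplex.asOrderHom x.2).monotone hjk
        split_ifs with h h'
        · exact h₁
        · exact Fin.le_last _
        · rename_i h'
          exact absurd (le_antisymm (h' ▸ h₂) (Fin.zero_le _)) h
        · exact le_rfl }
  naturality _ _ _ := rfl

theorem W_fst_stdSimplex (X : SSet.{u}) (n : ℕ) : W (fst X Δ[n]) :=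
  W_fst_of_contraction (SSet.stdSimplex.obj₀Equiv.symm (Fin.last n)) (simplexContraction n)
    (NatTrans.ext (funext fun _ => ConcreteCategory.hom_ext _ _ fun _ =>
      SSet.stdSimplex.objEquiv.injective (by ext; rfl))) rfl X

instance mono_whiskerRight {X Y : SSet.{u}} (f : X ⟶ Y) [Mono f] (Z : SSet.{u}) : Mono (f ▷ Z) where
  right_cancellation g h w := by
    ext : 1
    · rw [← cancel_mono f]
      simpa using congrArg (fun k => k ≫ fst Y Z) w
    · simpa using congrArg (fun k => k ≫ snd Y Z) w

theorem W_whiskerRight_stdSimplex {X Y : SSet.{u}} {f : X ⟶ Y} (hf : W f) (n : ℕ) :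
    W (f ▷ (Δ[n] : SSet.{u})) := by
  refine W.of_postcomp _ _ (W_fst_stdSimplex Y n) ?_
  rw [whiskerRight_fst]
  exact W.comp_mem _ _ (W_fst_stdSimplex X n) hf

open HomotopicalAlgebra MonoidalClosed SSet.Subcomplex in
/-- The pushout-product of a map in `triv` with a monomorphism belongs to `triv`. -/
theorem triv_unionProd {X K : SSet.{u}} (S : X.Subcomplex) (T : K.Subcomplex) (hS : triv S.ι) :
    triv (S.unionProd T).ι := by
  -- By adjunction this says that the pushout-product of `S.ι` with the inclusion of `∂Δ[n]` lifts
  -- against `p`; the proof is by strong induction on `n`.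
  have key : ∀ (n : ℕ) {E B : SSet.{u}} (p : E ⟶ B), testFibrations p →
      HasLiftingProperty (∂Δ[n] : Δ[n].Subcomplex).ι
        (Functor.PullbackObjObj.ofHasPullback MonoidalClosed.internalHom S.ι p).π := by
    intro n
    induction n using Nat.strong_induction_on with
    | _ n ih =>
      let I' : MorphismProperty SSet.{u} :=
        .ofHoms (fun d : {d : ℕ // d < n} => (∂Δ[d.1] : Δ[d.1].Subcomplex).ι)
      -- `∂Δ[n]` is built from cells of dimension less than `n`, to which the induction hypothesis
      -- applies; the pushout-product of `S.ι` with `∅ → ∂Δ[n]` is `S.ι × ∂Δ[n]`.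
      have hT : ∀ {E B : SSet.{u}} (p : E ⟶ B), testFibrations p →
          HasLiftingProperty (S.ι ▷ (∂Δ[n] : SSet.{u})) p := by
        intro E B p hp
        let sq := Functor.PushoutObjObj.ofIsInitialRight (curriedTensor SSet.{u}) S.ι
          (⊥ : (∂Δ[n] : SSet.{u}).Subcomplex).ι isInitialBot
        change HasLiftingProperty sq.ι p
        let sq' := Functor.PullbackObjObj.ofHasPullback MonoidalClosed.internalHom S.ι p
        rw [internalHomAdjunction₂.hasLiftingProperty_iff sq sq']
        have h₁ : I'.rlp sq'.π := by
          rintro _ _ _ ⟨d⟩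
          exact ih d.1 d.2 p hp
        refine MorphismProperty.transfiniteCompositionsOfShape_pushouts_coproducts_le_llp_rlp.{u}
          I' ℕ _ ⟨(SSet.relativeCellComplex (∂Δ[n] : SSet.{u})).transfiniteCompositionOfShape'
            (fun s => ?_)⟩ _ h₁
        have hs : s.j < n := SSet.dim_lt_of_nonDegenerate (X := (∂Δ[n] : SSet.{u}))
          ⟨s.k.simplex, s.k.nonDegenerate⟩ n
        exact ⟨(⟨s.j, hs⟩ : {d : ℕ // d < n})⟩
      have h₁ : triv (S.ι ▷ (∂Δ[n] : SSet.{u})) := by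
        rw [triv_eq]
        exact ⟨inferInstanceAs (Mono _), fun _ _ p hp => hT p hp⟩
      -- `S × Δ[n] → S × Δ[n] ∪ X × ∂Δ[n]` is a pushout of `S.ι × ∂Δ[n]`. Its composite with the
      -- inclusion in `X × Δ[n]` is `S.ι × Δ[n]`, which lies in `W` because `Δ[n]` is contractible;
      -- two-out-of-three concludes.
      have h₂ : triv (unionProd.ι₂ S (∂Δ[n] : Δ[n].Subcomplex)) :=
        MorphismProperty.of_isPushout (unionProd.isPushout S ∂Δ[n]).flip h₁
      have h₃ : triv (S.unionProd (∂Δ[n] : Δ[n].Subcomplex)).ι :=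
        ⟨inferInstanceAs (Mono _), W.of_precomp _ _ h₂.2 (by
          rw [unionProd.ι₂_ι]
          exact W_whiskerRight_stdSimplex hS.2 n)⟩
      rw [triv_eq] at h₃
      intro E B p hp
      rw [← internalHomAdjunction₂.hasLiftingProperty_iff (unionProd.pushoutObjObj.{u} _ _)]
      exact h₃.2 _ hp
  rw [triv_eq]
  refine ⟨inferInstanceAs (Mono _), fun E B p hp => ?_⟩
  have h := internalHomAdjunction₂.hasLiftingProperty_iff (unionProd.pushoutObjObj.{u} S T)
    (Functor.PullbackObjObj.ofHasPullback MonoidalClosed.internalHom S.ι p)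
  rw [unionProd.pushoutObjObj_ι] at h
  refine h.2 ?_
  -- Boundary inclusions detect the right lifting property against every monomorphism, in particular
  -- against `T.ι`.
  suffices (MorphismProperty.monomorphisms SSet.{u}).rlp
      (Functor.PullbackObjObj.ofHasPullback MonoidalClosed.internalHom S.ι p).π from
    this _ (inferInstanceAs (Mono _))
  rw [SSet.rlp_monomorphisms]
  rintro _ _ _ ⟨n⟩
  exact key n p hp

end RealizationEquivalence

/-! ### The realization lemma for levelwise monomorphisms -/

namespace RealizationEquivalence

open Simplicial MonoidalCategory CartesianMonoidalCategory Limits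

open SSet.Subcomplex in
/-- A subcomplex `B'` obtained from `B` by attaching `X` along a subcomplex `A`. -/
theorem triv_homOfLE {X Z : SSet.{u}} (f : X ⟶ Z) (A : X.Subcomplex) (B B' : Z.Subcomplex)
    (hle : B ≤ B') (h₁ : ∀ m (x : X.obj m), f.app m x ∈ B.obj m ↔ x ∈ A.obj m)
    (h₂ : ∀ m (z : Z.obj m), z ∈ B'.obj m ↔ z ∈ B.obj m ∨ ∃ x, f.app m x = z)
    (h₃ : ∀ m (x x' : X.obj m), x ∉ A.obj m → x' ∉ A.obj m → f.app m x = f.app m x' → x = x')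
    (hA : triv A.ι) : triv (homOfLE hle) := by
  let t : (A : SSet.{u}) ⟶ (B : SSet.{u}) := SSet.Subcomplex.lift (A.ι ≫ f) (by
    rintro m _ ⟨x, rfl⟩
    exact (h₁ m x.1).2 x.2)
  let b : X ⟶ (B' : SSet.{u}) := SSet.Subcomplex.lift f (by
    rintro m _ ⟨x, rfl⟩
    exact (h₂ m _).2 (Or.inr ⟨x, rfl⟩))
  -- In each degree this is a square of sets, a pushout because it is a pullback (`h₁`), jointly
  -- surjective (`h₂`) and injective off `A` (`h₃`).
  have sq : IsPushout t A.ι (homOfLE hle) b :=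
    { w := rfl
      isColimit' := ⟨evaluationJointlyReflectsColimits _ fun m =>
        (isColimitMapCoconePushoutCoconeEquiv _ _).2 (IsPushout.isColimit (by
          refine Types.isPushout_of_isPullback_of_mono' ?_ ?_ ?_
          · rw [Types.isPullback_iff]
            refine ⟨rfl, fun x y h => Subtype.ext h.2, ?_⟩
            rintro ⟨z, hz⟩ x h
            have hz' : z = f.app m x := congrArg Subtype.val h
            subst hz'
            exact ⟨⟨x, (h₁ m x).1 hz⟩, rfl, rfl⟩
          · refine Set.eq_univ_of_forall ?_
            rintro ⟨z, hz⟩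
            rcases (h₂ m z).1 hz with hz' | ⟨x, rfl⟩
            · exact Or.inl ⟨⟨z, hz'⟩, rfl⟩
            · exact Or.inr ⟨x, rfl⟩
          · intro x x' hx hx' h
            exact h₃ m x x' (fun h' => hx ⟨⟨x, h'⟩, rfl⟩) (fun h' => hx' ⟨⟨x', h'⟩, rfl⟩)
              (congrArg Subtype.val h)))⟩ }
  exact MorphismProperty.of_isPushout sq hA

/-- A bisimplicial subset of a bisimplicial set. -/
structure Subbisimplicial (Y : SimplicialObject SSet.{u}) where
  /-- The rows. -/
  obj (p : SimplexCategoryᵒᵖ) : (Y.obj p).Subcomplex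
  map {p q : SimplexCategoryᵒᵖ} (φ : p ⟶ q) {m : SimplexCategoryᵒᵖ} {y : (Y.obj p).obj m} :
    y ∈ (obj p).obj m → (Y.map φ).app m y ∈ (obj q).obj m

/-- A column of a bisimplicial set. -/
abbrev column (Y : SimplicialObject SSet.{u}) (m : SimplexCategoryᵒᵖ) : SSet.{u} :=
  Y ⋙ (evaluation _ _).obj m

namespace Subbisimplicial

variable {Y : SimplicialObject SSet.{u}} (A : Subbisimplicial Y)

/-- The union of a row of `A` with the images of the degeneracies of index less than `k`. -/
def latch (k p : ℕ) : (Y.obj (op ⦋p⦌)).Subcomplex :=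
  match p with
  | 0 => A.obj _
  | p + 1 => A.obj _ ⊔ ⨆ i : {i : Fin (p + 1) // i.1 < k}, SSet.Subcomplex.range (Y.σ i.1)

theorem mem_latch_succ {k p : ℕ} {m : SimplexCategoryᵒᵖ} (y : (Y.obj (op ⦋p + 1⦌)).obj m) :
    y ∈ (A.latch k (p + 1)).obj m ↔ y ∈ (A.obj _).obj m ∨
      ∃ i : Fin (p + 1), i.1 < k ∧ ∃ w, (column Y m).σ i w = y := by
  simp only [latch, Subfunctor.max_obj, Subfunctor.iSup_obj, Set.mem_union, Set.mem_iUnion,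
    Subtype.exists, exists_prop]
  rfl

theorem le_latch (k p : ℕ) : A.obj (op ⦋p⦌) ≤ A.latch k p := by
  cases p
  · exact le_rfl
  · exact le_sup_left

theorem latch_mono {k l : ℕ} (h : k ≤ l) (p : ℕ) : A.latch k p ≤ A.latch l p := by
  cases p
  · exact le_rfl
  · intro m y hy
    rw [mem_latch_succ] at hy ⊢
    exact hy.imp_right fun ⟨i, hi, hw⟩ => ⟨i, hi.trans_le h, hw⟩

/-- If `σₖ w = σᵢ v` with `i < k`, then applying `d_{k+1}` gives `w = σᵢ (dₖ v)`; conversely `σₖ σᵢ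
= σᵢ σ_{k-1}`. Hence adding the image of `σₖ` attaches a copy of row `p` along `latch k p`. -/
theorem σ_mem_latch_iff {k p : ℕ} (hk : k < p + 1) {m : SimplexCategoryᵒᵖ}
    (w : (Y.obj (op ⦋p⦌)).obj m) :
    (column Y m).σ ⟨k, hk⟩ w ∈ (A.latch k (p + 1)).obj m ↔ w ∈ (A.latch k p).obj m := by
  have hself : (column Y m).δ (Fin.castSucc ⟨k, hk⟩) ((column Y m).σ ⟨k, hk⟩ w) = w :=
    ConcreteCategory.congr_hom ((column Y m).δ_comp_σ_self (i := ⟨k, hk⟩)) w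
  have hsucc : (column Y m).δ (Fin.succ ⟨k, hk⟩) ((column Y m).σ ⟨k, hk⟩ w) = w :=
    ConcreteCategory.congr_hom ((column Y m).δ_comp_σ_succ (i := ⟨k, hk⟩)) w
  rw [mem_latch_succ]
  constructor
  · rintro (h | ⟨i, hi, v, hv⟩)
    · apply A.le_latch
      rw [← hself]
      exact A.map _ h
    · obtain _ | p := p
      · omega
      · rw [mem_latch_succ]
        refine Or.inr ⟨⟨i.1, by omega⟩, hi, (column Y m).δ ⟨k, hk⟩ v, ?_⟩
        rw [← hsucc, ← hv]
        exact (ConcreteCategory.congr_hom ((column Y m).δ_comp_σ_of_gt (i := ⟨k, hk⟩)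
          (j := ⟨i.1, by omega⟩) hi) v).symm
  · intro h
    obtain _ | p := p
    · exact Or.inl (A.map _ h)
    · rw [mem_latch_succ] at h
      rcases h with h | ⟨i, hi, v, rfl⟩
      · exact Or.inl (A.map _ h)
      · obtain _ | k := k
        · omega
        · refine Or.inr ⟨i.castSucc, hi, (column Y m).σ ⟨k, by omega⟩ v, ?_⟩
          exact ConcreteCategory.congr_hom ((column Y m).σ_comp_σ (i := i) (j := ⟨k, by omega⟩)
            (Nat.lt_succ_iff.1 hi)) v

/-- Induction on `k`, for all rows at once: adding the image of `σₖ` in row `p + 1` is a pushout of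
the inclusion of `latch k p` in row `p`, which is trivial by induction and two-out-of-three. -/
theorem triv_le_latch (hA : ∀ p, triv (A.obj p).ι) (k : ℕ) :
    ∀ p, triv (SSet.Subcomplex.homOfLE (A.le_latch k p)) := by
  induction k with
  | zero =>
    intro p
    have : A.latch 0 p = A.obj _ := by
      cases p
      · rfl
      · apply le_antisymm _ (A.le_latch _ _)
        intro m y hy
        rw [mem_latch_succ] at hy
        rcases hy with hy | ⟨i, hi, -⟩
        · exact hy
        · omega
    have : IsIso (SSet.Subcomplex.homOfLE (A.le_latch 0 p)) :=
      ⟨SSet.Subcomplex.homOfLE this.le, rfl, rfl⟩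
    exact MorphismProperty.of_isIso _ _
  | succ k ih =>
    intro p
    obtain _ | p := p
    · exact MorphismProperty.id_mem triv (A.obj (op ⦋0⦌) : SSet.{u})
    · rw [← SSet.Subcomplex.homOfLE_comp (A.le_latch k (p + 1)) (A.latch_mono (Nat.le_succ k) _)]
      refine MorphismProperty.comp_mem _ _ _ (ih _) ?_
      by_cases hk : k < p + 1
      · refine triv_homOfLE (Y.σ ⟨k, hk⟩) (A.latch k p) _ _ _
          (fun m x => A.σ_mem_latch_iff hk x) (fun m z => ?_) (fun m x x' _ _ h => ?_)
          ⟨inferInstanceAs (Mono _), W.of_precomp _ _ (ih p).2 (hA _).2⟩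
        · rw [mem_latch_succ, mem_latch_succ]
          constructor
          · rintro (h | ⟨i, hi, w, hw⟩)
            · exact Or.inl (Or.inl h)
            · rcases Nat.lt_succ_iff_lt_or_eq.1 hi with hi | hi
              · exact Or.inl (Or.inr ⟨i, hi, w, hw⟩)
              · obtain rfl : i = ⟨k, hk⟩ := Fin.ext hi
                exact Or.inr ⟨w, hw⟩
          · rintro ((h | ⟨i, hi, w, hw⟩) | ⟨w, hw⟩)
            · exact Or.inl h
            · exact Or.inr ⟨i, hi.trans (Nat.lt_succ_self k), w, hw⟩
            · exact Or.inr ⟨⟨k, hk⟩, Nat.lt_succ_self k, w, hw⟩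
        · have hinj : ∀ w, (column Y m).δ (Fin.castSucc ⟨k, hk⟩) ((column Y m).σ ⟨k, hk⟩ w) = w :=
            fun w => ConcreteCategory.congr_hom ((column Y m).δ_comp_σ_self (i := ⟨k, hk⟩)) w
          rw [← hinj x, ← hinj x']
          exact congrArg _ h
      -- There is no degeneracy of index `k ≥ p + 1`, so nothing is added.
      · have : A.latch (k + 1) (p + 1) ≤ A.latch k (p + 1) := by
          intro m y hy
          rw [mem_latch_succ] at hy ⊢
          exact hy.imp_right fun ⟨i, hi, hw⟩ => ⟨i, by omega, hw⟩
        have : IsIso (SSet.Subcomplex.homOfLE (A.latch_mono (Nat.le_succ k) (p + 1))) :=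
          ⟨SSet.Subcomplex.homOfLE this, rfl, rfl⟩
        exact MorphismProperty.of_isIso _ _

theorem triv_latch (hA : ∀ p, triv (A.obj p).ι) (k p : ℕ) : triv (A.latch k p).ι :=
  ⟨inferInstanceAs (Mono _), W.of_precomp _ _ (A.triv_le_latch hA k p).2 (hA _).2⟩

theorem degenerate_le_latch {p : ℕ} {m : SimplexCategoryᵒᵖ} {y : (column Y m) _⦋p⦌}
    (hy : y ∈ (column Y m).degenerate p) : y ∈ (A.latch p p).obj m := by
  obtain _ | p := p
  · simp at hy
  · rw [SSet.degenerate_eq_iUnion_range_σ, Set.mem_iUnion] at hy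
    obtain ⟨i, w, hw⟩ := hy
    rw [mem_latch_succ]
    exact Or.inr ⟨i, i.2, w, hw⟩

/-- The subcomplex of the diagonal which consists of the simplices of `A` and those coming from
the rows of index less than `n`. -/
def stage (n : ℕ) : (diag.obj Y).Subcomplex where
  obj m := {y | y ∈ (A.obj m).obj m ∨ ∃ (k : ℕ) (_ : k < n) (z : (Y.obj (op ⦋k⦌)).obj m)
    (φ : m.unop ⟶ ⦋k⦌), (column Y m).map φ.op z = y}
  map {m m'} ψ := by
    rintro y (hy | ⟨k, hk, z, φ, rfl⟩)
    · exact Or.inl ((A.obj m').map ψ (A.map ψ hy))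
    · refine Or.inr ⟨k, hk, (Y.obj _).map ψ z, ψ.unop ≫ φ, ?_⟩
      change (Y.map (φ.op ≫ ψ)).app m' ((Y.obj _).map ψ z) =
        (Y.obj m').map ψ ((Y.map ψ).app m ((Y.map φ.op).app m z))
      rw [NatTrans.naturality_apply, Y.map_comp]
      rfl

theorem mem_stage {n : ℕ} {m : SimplexCategoryᵒᵖ} (y : (Y.obj m).obj m) :
    y ∈ (A.stage n).obj m ↔ y ∈ (A.obj m).obj m ∨ ∃ (k : ℕ) (_ : k < n)
      (z : (Y.obj (op ⦋k⦌)).obj m) (φ : m.unop ⟶ ⦋k⦌), (column Y m).map φ.op z = y :=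
  Iff.rfl

theorem stage_mono : Monotone A.stage := fun _ _ h _ _ hy =>
  hy.imp_right fun ⟨k, hk, hz⟩ => ⟨k, hk.trans_le h, hz⟩

/-- The map from the product of a row with a simplex to the diagonal. -/
def rowAction (Y : SimplicialObject SSet.{u}) (n : ℕ) : Y.obj (op ⦋n⦌) ⊗ Δ[n] ⟶ diag.obj Y where
  app m := ↾fun x => (column Y m).map (SSet.stdSimplex.objEquiv x.2).op x.1
  naturality m m' ψ := by
    refine ConcreteCategory.hom_ext _ _ fun x => ?_
    change (Y.map ((SSet.stdSimplex.objEquiv x.2).op ≫ ψ)).app m' ((Y.obj (op ⦋n⦌)).map ψ x.1) =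
      (Y.obj m').map ψ ((Y.map ψ).app m ((Y.map (SSet.stdSimplex.objEquiv x.2).op).app m x.1))
    rw [NatTrans.naturality_apply, Y.map_comp]
    rfl

theorem rowAction_apply {n : ℕ} {m : SimplexCategoryᵒᵖ} (y : (Y.obj (op ⦋n⦌)).obj m)
    (θ : (Δ[n] : SSet.{u}).obj m) :
    (rowAction Y n).app m (y, θ) = (column Y m).map (SSet.stdSimplex.objEquiv θ).op y := rfl

theorem epi_of_not_mem_boundary {n : ℕ} {m : SimplexCategoryᵒᵖ} {θ : (Δ[n] : SSet.{u}).obj m}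
    (h : θ ∉ (∂Δ[n] : Δ[n].Subcomplex).obj m) : Epi (SSet.stdSimplex.objEquiv θ) := by
  rw [SimplexCategory.epi_iff_surjective]
  exact not_not.1 h

/-- This identifies the subcomplex along which `Yₙ × Δ[n]` is attached. A `θ` outside the boundary
is a split epimorphism; pulling back along a section shows that `y` lies in `A` or comes from a row
of index less than `n`, hence is degenerate in its column. -/
theorem rowAction_mem_stage_iff {n : ℕ} {m : SimplexCategoryᵒᵖ} (y : (Y.obj (op ⦋n⦌)).obj m)
    (θ : (Δ[n] : SSet.{u}).obj m) : (rowAction Y n).app m (y, θ) ∈ (A.stage n).obj m ↔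
      θ ∈ (∂Δ[n] : Δ[n].Subcomplex).obj m ∨ y ∈ (A.latch n n).obj m := by
  refine (A.mem_stage _).trans ?_
  rw [rowAction_apply]
  constructor
  · intro h
    by_cases hθ : θ ∈ (∂Δ[n] : Δ[n].Subcomplex).obj m
    · exact Or.inl hθ
    · right
      have := epi_of_not_mem_boundary hθ
      have := isSplitEpi_of_epi (SSet.stdSimplex.objEquiv θ)
      have hs : ∀ w : (column Y m).obj (op ⦋n⦌),
          (column Y m).map (section_ (SSet.stdSimplex.objEquiv θ)).op
            ((column Y m).map (SSet.stdSimplex.objEquiv θ).op w) = w := fun w => by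
        rw [← Functor.map_comp_apply, ← op_comp, IsSplitEpi.id]
        simp
      rcases h with h | ⟨k, hk, z, φ, h⟩
      · apply A.le_latch
        rw [← hs y]
        exact A.map _ h
      · apply A.degenerate_le_latch
        refine ⟨k, hk, section_ (SSet.stdSimplex.objEquiv θ) ≫ φ, z, ?_⟩
        rw [op_comp, Functor.map_comp_apply, h, hs]
  · intro h
    obtain _ | n := n
    · rcases h with h | h
      · exact absurd h (by simp)
      · exact Or.inl (A.map _ h)
    · rcases h with h | h
      · obtain ⟨i, θ', hθ'⟩ :=
          SimplexCategory.eq_comp_δ_of_not_surjective (SSet.stdSimplex.objEquiv θ) h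
        exact Or.inr ⟨n, Nat.lt_succ_self n, (column Y m).δ i y, θ', by
          rw [hθ', op_comp, Functor.map_comp_apply]; rfl⟩
      · rw [mem_latch_succ] at h
        rcases h with h | ⟨i, hi, w, rfl⟩
        · exact Or.inl (A.map _ h)
        · exact Or.inr ⟨n, Nat.lt_succ_self n, w,
            SSet.stdSimplex.objEquiv θ ≫ SimplexCategory.σ i, by
              rw [op_comp, Functor.map_comp_apply]; rfl⟩

/-- The next stage is a pushout along the pushout-product of the latching inclusion of row `n` with
`∂Δ[n] ⊂ Δ[n]`. -/
theorem triv_stage (hA : ∀ p, triv (A.obj p).ι) (n : ℕ) :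
    triv (SSet.Subcomplex.homOfLE (A.stage_mono (Nat.le_succ n))) := by
  refine triv_homOfLE (rowAction Y n) ((A.latch n n).unionProd ∂Δ[n]) _ _ _ ?_ ?_ ?_
    (triv_unionProd _ _ (A.triv_latch hA n n))
  · rintro m ⟨y, θ⟩
    exact (A.rowAction_mem_stage_iff y θ).trans
      (SSet.Subcomplex.mem_unionProd_iff (A.latch n n) ∂Δ[n] (y, θ)).symm
  · intro m z
    constructor
    · rintro (h | ⟨k, hk, z, φ, h⟩)
      · exact Or.inl (Or.inl h)
      · rcases Nat.lt_succ_iff_lt_or_eq.1 hk with hk | rfl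
        · exact Or.inl (Or.inr ⟨k, hk, z, φ, h⟩)
        · exact Or.inr ⟨(z, SSet.stdSimplex.objEquiv.symm φ), by
            rw [rowAction_apply, Equiv.apply_symm_apply]; exact h⟩
    · rintro ((h | ⟨k, hk, z, φ, h⟩) | ⟨⟨y, θ⟩, h⟩)
      · exact Or.inl h
      · exact Or.inr ⟨k, hk.trans (Nat.lt_succ_self n), z, φ, h⟩
      · exact Or.inr ⟨n, Nat.lt_succ_self n, y, _, h⟩
  -- Injectivity off the attaching subcomplex is the uniqueness in the Eilenberg–Zilber
  -- decomposition, applied in column `m`: there `y`, `y'` are nondegenerate and `θ`, `θ'` are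
  -- epimorphisms.
  · rintro m ⟨y, θ⟩ ⟨y', θ'⟩ h h' e
    replace h := not_or.1 (mt (SSet.Subcomplex.mem_unionProd_iff _ _ (y, θ)).2 h)
    replace h' := not_or.1 (mt (SSet.Subcomplex.mem_unionProd_iff _ _ (y', θ')).2 h')
    have := epi_of_not_mem_boundary h.1
    have := epi_of_not_mem_boundary h'.1
    have hy : y ∈ (column Y m).nonDegenerate n := fun hd => h.2 (A.degenerate_le_latch hd)
    have hy' : y' ∈ (column Y m).nonDegenerate n := fun hd => h'.2 (A.degenerate_le_latch hd)
    have h₁ : y = y' := congrArg Subtype.val ((column Y m).unique_nonDegenerate_simplex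
      (n := m.unop.len) _ (SSet.stdSimplex.objEquiv θ) ⟨y, hy⟩ rfl
      (SSet.stdSimplex.objEquiv θ') ⟨y', hy'⟩ e)
    have h₂ : SSet.stdSimplex.objEquiv θ = SSet.stdSimplex.objEquiv θ' :=
      (column Y m).unique_nonDegenerate_map
        (n := m.unop.len) _ (SSet.stdSimplex.objEquiv θ) ⟨y, hy⟩ rfl
        (SSet.stdSimplex.objEquiv θ') ⟨y', hy'⟩ e
    rw [h₁, SSet.stdSimplex.objEquiv.injective h₂]

theorem triv_stage_zero (hA : ∀ p, triv (A.obj p).ι) : triv (A.stage 0).ι := by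
  refine triv_of_chain A.stage A.stage_mono (A.triv_stage hA) ?_
  rw [eq_top_iff]
  intro m y _
  rw [Subfunctor.iSup_obj, Set.mem_iUnion]
  -- A simplex of the diagonal in degree `m` comes from row `m` through the identity, so it lies in
  -- stage `m + 1`.
  refine ⟨m.unop.len + 1, Or.inr ⟨m.unop.len, Nat.lt_succ_self _, y, 𝟙 _, ?_⟩⟩
  exact ConcreteCategory.congr_hom ((column Y m).map_id m) y

end Subbisimplicial

/-- The realization lemma for levelwise monomorphisms. -/
theorem W_diag_of_mono {X Y : SimplicialObject SSet.{u}} (f : X ⟶ Y) (hm : ∀ p, Mono (f.app p))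
    (hf : ∀ p, W (f.app p)) : W (diag.map f) := by
  let A : Subbisimplicial Y :=
    { obj := fun p => SSet.Subcomplex.range (f.app p)
      map := by
        rintro p q φ m _ ⟨x, rfl⟩
        exact ⟨(X.map φ).app m x, congrArg (fun k => k.app m x) (f.naturality φ)⟩ }
  have hA : ∀ p, triv (A.obj p).ι := fun p =>
    ⟨inferInstanceAs (Mono _), W.of_precomp (SSet.Subcomplex.toRange (f.app p)) _
      (W_of_isIso _) (by rw [SSet.Subcomplex.toRange_ι]; exact hf p)⟩
  have hs : A.stage 0 = SSet.Subcomplex.range (diag.map f) := by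
    ext m y
    exact ⟨fun h => h.resolve_right fun ⟨k, hk, _⟩ => absurd hk (Nat.not_lt_zero k), Or.inl⟩
  have : Mono (diag.map f) := by
    rw [NatTrans.mono_iff_mono_app]
    intro m
    have := (NatTrans.mono_iff_mono_app (f.app m)).1 (hm m)
    exact this m
  have h := A.triv_stage_zero hA
  rw [hs] at h
  rw [← SSet.Subcomplex.toRange_ι (diag.map f)]
  exact W.comp_mem _ _ (W_of_isIso _) h.2

end RealizationEquivalence

/-! ### The general realization lemma and products -/

namespace RealizationEquivalence

open Simplicial MonoidalCategory CartesianMonoidalCategory Limits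

/-- A functorial contractible simplicial set containing a given one: its `q`-simplices are the
tuples of `q + 1` elements of the pointed set obtained from the set of `q`-simplices by adding a
base point. -/
def hull : SSet.{u} ⥤ SSet.{u} where
  obj K :=
    { obj := fun m => Fin (m.unop.len + 1) → Option (K.obj m)
      map := fun ψ => ↾fun g j => (g (ψ.unop.toOrderHom j)).map (K.map ψ)
      map_id := fun m => ConcreteCategory.hom_ext _ _ fun g => funext fun j => by
        change (g j).map (K.map (𝟙 m)) = g j
        cases h : g j <;> simp
      map_comp := fun φ ψ => ConcreteCategory.hom_ext _ _ fun g => funext fun j => by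
        change (g _).map (K.map (φ ≫ ψ)) = ((g _).map (K.map φ)).map (K.map ψ)
        rw [Option.map_map, K.map_comp]
        rfl }
  map f :=
    { app := fun m => ↾fun g j => (g j).map (f.app m)
      naturality := fun m m' ψ => ConcreteCategory.hom_ext _ _ fun g => funext fun j => by
        change ((g _).map _).map (f.app m') = ((g _).map (f.app m)).map _
        rw [Option.map_map, Option.map_map]
        congr 1
        funext x
        exact NatTrans.naturality_apply f ψ x }
  map_id K := NatTrans.ext (funext fun m => ConcreteCategory.hom_ext _ _ fun g =>
    funext fun j => congrFun Option.map_id (g j))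
  map_comp f f' := NatTrans.ext (funext fun m => ConcreteCategory.hom_ext _ _ fun g =>
    funext fun j => (Option.map_map (f'.app m) (f.app m) (g j)).symm)

/-- The inclusion of a simplicial set in its hull. -/
def toHull : 𝟭 SSet.{u} ⟶ hull where
  app K :=
    { app := fun _ => ↾fun x _ => some x }

/-- The contraction of the hull. -/
noncomputable def hullContraction (K : SSet.{u}) : hull.obj K ⊗ Δ[1] ⟶ hull.obj K where
  app m := ↾fun x j => if SSet.stdSimplex.asOrderHom x.2 j = 0 then x.1 j else none
  naturality m m' ψ := ConcreteCategory.hom_ext _ _ fun x => funext fun j => by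
    change (if SSet.stdSimplex.asOrderHom x.2 (ψ.unop.toOrderHom j) = 0 then
      (x.1 (ψ.unop.toOrderHom j)).map (K.map ψ) else none) =
      (if SSet.stdSimplex.asOrderHom x.2 (ψ.unop.toOrderHom j) = 0 then
      x.1 (ψ.unop.toOrderHom j) else none).map (K.map ψ)
    split_ifs <;> rfl

theorem W_fst_hull (X K : SSet.{u}) : W (fst X (hull.obj K)) :=
  W_fst_of_contraction (fun _ => none) (hullContraction K) rfl rfl X

/-- The levelwise product of `Y` with the hull of `X`. -/
def cylinder (X Y : SimplicialObject SSet.{u}) : SimplicialObject SSet.{u} where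
  obj p := Y.obj p ⊗ hull.obj (X.obj p)
  map φ := Y.map φ ⊗ₘ hull.map (X.map φ)

/-- The inclusion of `X` in the levelwise product of `Y` with the hull of `X`. -/
def toCylinder {X Y : SimplicialObject SSet.{u}} (f : X ⟶ Y) : X ⟶ cylinder X Y where
  app p := lift (f.app p) (toHull.app (X.obj p))
  naturality p q φ := by
    refine CartesianMonoidalCategory.hom_ext _ _ ?_ ?_
    · simp [cylinder]
    · simpa [cylinder] using toHull.naturality (X.map φ)

/-- The projection of the levelwise product of `Y` with the hull of `X`. -/
def cylinderFst (X Y : SimplicialObject SSet.{u}) : cylinder X Y ⟶ Y where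
  app p := fst _ _
  naturality p q φ := by simp [cylinder]

theorem toCylinder_fst {X Y : SimplicialObject SSet.{u}} (f : X ⟶ Y) :
    toCylinder f ≫ cylinderFst X Y = f := by
  ext p : 2
  exact lift_fst _ _

theorem mono_toHull (K : SSet.{u}) : Mono (toHull.app K) := by
  rw [NatTrans.mono_iff_mono_app]
  intro m
  rw [mono_iff_injective]
  intro x y h
  exact Option.some_injective _ (congrFun h 0)

/-- The diagonal of the levelwise product of `Y` with the hull of `X`. -/
def diagCylinderIso (X Y : SimplicialObject SSet.{u}) :
    diag.obj (cylinder X Y) ≅ diag.obj Y ⊗ hull.obj (diag.obj X) :=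
  NatIso.ofComponents (fun m => Iso.refl ((Y.obj m).obj m × (hull.obj (X.obj m)).obj m))
    (fun {m m'} φ => by
      refine ConcreteCategory.hom_ext _ _ ?_
      rintro ⟨y, g⟩
      exact Prod.ext rfl (funext fun j =>
        Option.map_map ((X.obj m').map φ) ((X.map φ).app m) (g (φ.unop.toOrderHom j))))

/-- The realization lemma: a levelwise homotopy equivalence of bisimplicial sets induces a homotopy
equivalence on the diagonals. -/
theorem W_diag {X Y : SimplicialObject SSet.{u}} (f : X ⟶ Y) (hf : ∀ p, W (f.app p)) :
    W (diag.map f) := by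
  -- `f` is a levelwise monomorphism into `Y × hull X` followed by the projection. The hull is
  -- contractible and formed degreewise, so it commutes with the diagonal, and the projection lies
  -- in `W` both in each row and on the diagonal.
  have h : ∀ p, (toCylinder f).app p ≫ fst (Y.obj p) (hull.obj (X.obj p)) = f.app p :=
    fun p => lift_fst _ _
  have h₁ : W (diag.map (toCylinder f)) := by
    refine W_diag_of_mono _ (fun p => ?_) (fun p => ?_)
    · have := mono_toHull (X.obj p)
      have e : (toCylinder f).app p ≫ snd (Y.obj p) (hull.obj (X.obj p)) =
        toHull.app (X.obj p) := lift_snd _ _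
      exact mono_of_mono_fac e
    · refine W.of_postcomp _ (fst (Y.obj p) (hull.obj (X.obj p))) (W_fst_hull _ _) ?_
      rw [h]
      exact hf p
  have h₂ : W (diag.map (cylinderFst X Y)) := by
    have e : diag.map (cylinderFst X Y) = (diagCylinderIso X Y).hom ≫
      fst (diag.obj Y) (hull.obj (diag.obj X)) := rfl
    rw [e]
    exact W.comp_mem _ _ (W_of_isIso _) (W_fst_hull (diag.obj Y) (diag.obj X))
  rw [← toCylinder_fst f, Functor.map_comp]
  exact W.comp_mem _ _ h₁ h₂

/-- Products preserve the class `W`. -/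
theorem W_whiskerRight {X Y : SSet.{u}} {f : X ⟶ Y} (hf : W f) (K : SSet.{u}) : W (f ▷ K) := by
  have hm : ∀ {X Y : SSet.{u}} (i : X ⟶ Y) [Mono i], W i → W (i ▷ K) := by
    intro X Y i _ hi
    have hS : triv (SSet.Subcomplex.range i).ι :=
      ⟨inferInstanceAs (Mono _), W.of_precomp (SSet.Subcomplex.toRange i) _
        (W_of_isIso _) (by rw [SSet.Subcomplex.toRange_ι]; exact hi)⟩
    -- For a monomorphism, the product with `K` is the pushout-product with `∅ ⊂ K`.
    have h := triv_unionProd (SSet.Subcomplex.range i) (⊥ : K.Subcomplex) hS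
    have e : (SSet.Subcomplex.range i).unionProd (⊥ : K.Subcomplex) =
        SSet.Subcomplex.range (i ▷ K) := by
      ext m ⟨y, k⟩
      refine (SSet.Subcomplex.mem_unionProd_iff _ _ (y, k)).trans ?_
      constructor
      · rintro (h | ⟨x, hx⟩)
        · exact absurd h (by simp)
        · exact ⟨(x, k), Prod.ext hx rfl⟩
      · rintro ⟨⟨x, k'⟩, hx⟩
        exact Or.inr ⟨x, congrArg Prod.fst hx⟩
    rw [e] at h
    rw [← SSet.Subcomplex.toRange_ι (i ▷ K)]
    exact W.comp_mem _ _ (W_of_isIso _) h.2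
  -- Up to symmetry and associativity this is the projection of `Z × Y × hull X` away from the hull.
  have hf' : ∀ Z, W (fst Y (hull.obj X) ▷ Z) := fun Z => by
    have e : (β_ _ _).hom ≫ fst Y (hull.obj X) ▷ Z ≫ (β_ _ _).hom = (α_ Z Y (hull.obj X)).inv ≫
      fst (Z ⊗ Y) (hull.obj X) := rfl
    have h := W.comp_mem _ _ (W_of_isIso (α_ Z Y (hull.obj X)).inv) (W_fst_hull (Z ⊗ Y) X)
    rw [← e] at h
    exact (W.cancel_right_of_respectsIso _ _).1 ((W.cancel_left_of_respectsIso _ _).1 h)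
  have e : lift f (toHull.app X) ≫ fst Y (hull.obj X) = f := lift_fst _ _
  have : Mono (lift f (toHull.app X)) := by
    have := mono_toHull X
    exact mono_of_mono_fac (lift_snd f (toHull.app X))
  have h₁ : W (lift f (toHull.app X)) :=
    W.of_postcomp _ (fst Y (hull.obj X)) (W_fst_hull _ _) (by rw [e]; exact hf)
  rw [← e, MonoidalCategory.comp_whiskerRight]
  exact W.comp_mem _ _ (hm _ h₁) (hf' K)

end RealizationEquivalence

/-! ### The double nerve of a product with a category -/

namespace TwoCategory

open MonoidalCategory CartesianMonoidalCategory Limits RealizationEquivalence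

section Products

variable {ι : Type} [Preorder ι] {B L : Type u} [Bicategory.{u, u} B] [Bicategory.{u, u} L]

/-- A pair of chains, viewed as a chain in the product. -/
def chainPair {b : ι → B} {l : ι → L} (f : Chain b) (g : Chain l) :
    Chain (B := B × L) (fun i => (b i, l i)) where
  hom h := (f.hom h, g.hom h)
  hom_refl i := Prod.ext (f.hom_refl i) (g.hom_refl i)
  hom_trans h h' := Prod.ext (f.hom_trans h h') (g.hom_trans h h')

/-- A pair of morphisms of chains, viewed as a morphism of chains in the product. -/
def chainHomPair {b : ι → B} {l : ι → L} {f f' : Chain b} {g g' : Chain l} (α : f ⟶ f')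
    (β : g ⟶ g') : chainPair f g ⟶ chainPair f' g' :=
  show ChainHom _ _ from
  { cell h := (ChainHom.cell α h, ChainHom.cell β h)
    cell_refl i := prod_cell_heq (A := B) (L := L) (X := (b i, l i)) (Y := (b i, l i))
      (f := (f.hom le_rfl, g.hom le_rfl)) (g := (f'.hom le_rfl, g'.hom le_rfl))
      (f' := (𝟙 _, 𝟙 _)) (g' := (𝟙 _, 𝟙 _)) _ (𝟙 _, 𝟙 _)
      (Prod.ext (f.hom_refl i) (g.hom_refl i)) (Prod.ext (f'.hom_refl i) (g'.hom_refl i))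
      (ChainHom.cell_refl α i) (ChainHom.cell_refl β i)
    cell_trans {i _ k} h h' := prod_cell_heq (A := B) (L := L) (X := (b i, l i)) (Y := (b k, l k))
      (f := (f.hom (h.trans h'), g.hom (h.trans h')))
      (g := (f'.hom (h.trans h'), g'.hom (h.trans h')))
      (f' := (f.hom h ≫ f.hom h', g.hom h ≫ g.hom h'))
      (g' := (f'.hom h ≫ f'.hom h', g'.hom h ≫ g'.hom h'))
      _ (hcomp _ _, hcomp _ _)
      (Prod.ext (f.hom_trans h h') (g.hom_trans h h'))
      (Prod.ext (f'.hom_trans h h') (g'.hom_trans h h'))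
      (ChainHom.cell_trans α h h') (ChainHom.cell_trans β h h') }

/-- The action on morphisms of `chainProd`. -/
def chainProdMap : ∀ {X Y : Σ b : ι → B, Chain b} {X' Y' : Σ l : ι → L, Chain l} (_ : X ⟶ Y)
    (_ : X' ⟶ Y'), ((⟨fun i => (X.1 i, X'.1 i), chainPair X.2 X'.2⟩ : Σ c : ι → B × L, Chain c) ⟶
      ⟨fun i => (Y.1 i, Y'.1 i), chainPair Y.2 Y'.2⟩)
  | _, _, _, _, Sigma.SigmaHom.mk α, Sigma.SigmaHom.mk β => Sigma.SigmaHom.mk (chainHomPair α β)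

/-- Pairs of chains are chains in the product. -/
def chainProd : ((Σ b : ι → B, Chain b) × (Σ l : ι → L, Chain l)) ⥤
    (Σ c : ι → B × L, Chain c) where
  obj X := ⟨fun i => (X.1.1 i, X.2.1 i), chainPair X.1.2 X.2.2⟩
  map f := chainProdMap f.1 f.2
  map_id _ := rfl
  map_comp := by
    rintro ⟨_, _⟩ ⟨_, _⟩ ⟨_, _⟩ ⟨⟨α⟩, ⟨β⟩⟩ ⟨⟨α'⟩, ⟨β'⟩⟩
    rfl

end Products

variable {A A' : TwoCat.{u}} (K : Type u) [Category.{u} K]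

/-- The projection `A × K → A`. -/
def prodFst (A : TwoCat.{u}) : prodCat A K ⟶ A :=
  Bicategory.Prod.fst A (LocallyDiscrete K)

/-- The projection `A × K → K`. -/
def prodSnd (A : TwoCat.{u}) : prodCat A K ⟶ TwoCat.mk (LocallyDiscrete K) :=
  Bicategory.Prod.snd A (LocallyDiscrete K)

/-- The comparison of the double nerve of a product with the product of the double nerves. -/
def nerveProd (A : TwoCat.{u}) : diagDoubleNerve.obj (prodCat A K) ⟶
    diagDoubleNerve.obj A ⊗ diagDoubleNerve.obj (TwoCat.mk (LocallyDiscrete K)) :=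
  lift (diagDoubleNerve.map (prodFst K A)) (diagDoubleNerve.map (prodSnd K A))

/-- Simplices of degree `m` are functors from `[m]` to the `m`-th category of the nerve. For a
product, pairing of chains `Ψ` is a strict inverse to the two projections, and functors into a
product of categories are pairs of functors. -/
theorem nerveProd_bijective (A : TwoCat.{u}) (m : SimplexCategoryᵒᵖ) :
    Function.Bijective ((nerveProd K A).app m) := by
  let Φ₁ := ((nerFunctor.map (prodFst K A)).app m).toFunctor
  let Φ₂ := ((nerFunctor.map (prodSnd K A)).app m).toFunctor
  let Ψ : _ ⥤ ((nerFunctor.obj (prodCat A K)).obj m) :=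
    chainProd (ι := Fin (m.unop.len + 1)) (B := A) (L := LocallyDiscrete K)
  have h : Functor.prod' Φ₁ Φ₂ ⋙ Ψ = 𝟭 _ := by
    apply sigma_functor_ext
    intro c
    rfl
  have h₁ : Ψ ⋙ Φ₁ = CategoryTheory.Prod.fst _ _ := by
    refine Functor.hext (fun _ => rfl) ?_
    rintro ⟨_, _⟩ ⟨_, _⟩ ⟨⟨α⟩, ⟨β⟩⟩
    rfl
  have h₂ : Ψ ⋙ Φ₂ = CategoryTheory.Prod.snd _ _ := by
    refine Functor.hext (fun _ => rfl) ?_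
    rintro ⟨_, _⟩ ⟨_, _⟩ ⟨⟨α⟩, ⟨β⟩⟩
    rfl
  refine Function.bijective_iff_has_inverse.2
    ⟨fun x => Functor.prod' (show Fin (m.unop.len + 1) ⥤ _ from x.1) x.2 ⋙ Ψ, fun x => ?_,
      fun x => ?_⟩
  · exact congrArg (fun k => (show Fin (m.unop.len + 1) ⥤ _ from x) ⋙ k) h
  · refine Prod.ext ?_ ?_
    · exact congrArg (fun k => Functor.prod' (show Fin (m.unop.len + 1) ⥤ _ from x.1) x.2 ⋙ k) h₁
    · exact congrArg (fun k => Functor.prod' (show Fin (m.unop.len + 1) ⥤ _ from x.1) x.2 ⋙ k) h₂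

instance (A : TwoCat.{u}) : IsIso (nerveProd K A) :=
  (NatTrans.isIso_iff_isIso_app _).2 fun m => (isIso_iff_bijective _).2 (nerveProd_bijective K A m)

/-- The product of a weak equivalence with a category is a weak equivalence. -/
theorem W_prodMap (F : A ⟶ A') (hF : W (diagDoubleNerve.map F)) :
    W (diagDoubleNerve.map
      (show prodCat A K ⟶ prodCat A' K from prodMap (TwoCat.fn F) K)) := by
  have h : diagDoubleNerve.map (show prodCat A K ⟶ prodCat A' K from prodMap (TwoCat.fn F) K) ≫
      nerveProd K A' = nerveProd K A ≫ diagDoubleNerve.map F ▷ _ := by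
    refine CartesianMonoidalCategory.hom_ext _ _ ?_ ?_
    · simp only [nerveProd, Category.assoc, lift_fst, whiskerRight_fst, lift_fst_assoc]
      rw [← Functor.map_comp, ← Functor.map_comp]
      rfl
    · simp only [nerveProd, Category.assoc, lift_snd, whiskerRight_snd]
      rw [← Functor.map_comp]
      rfl
  refine (W.cancel_right_of_respectsIso _ (nerveProd K A')).1 ?_
  rw [h]
  exact (W.cancel_left_of_respectsIso _ _).2 (W_whiskerRight hF _)

end TwoCategory

/-! ### The double nerve of a disjoint union -/

namespace TwoCategory

open Limits RealizationEquivalence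

section Lifting

variable {J : Type v₁} [Category.{w₁} J] {X : Type v₂} [Category.{w₂} X] {Y : Type v₃}
  [Category.{w₃} Y]

/-- A functor whose values on objects lie in the image of a fully faithful functor factors through
it. -/
theorem exists_comp_eq (Φ : X ⥤ Y) [Φ.Full] [Φ.Faithful] (F : J ⥤ Y)
    (h : ∀ j, ∃ x, Φ.obj x = F.obj j) : ∃ G : J ⥤ X, G ⋙ Φ = F := by
  choose x hx using h
  refine ⟨{ obj := x
            map := fun {i j} f => Φ.preimage (eqToHom (hx i) ≫ F.map f ≫ eqToHom (hx j).symm)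
            map_id := fun j => Φ.map_injective (by simp)
            map_comp := fun f g => Φ.map_injective (by simp) }, ?_⟩
  exact CategoryTheory.Functor.ext hx fun i j f => Φ.map_preimage _

/-- Postcomposition with a faithful functor that is injective on objects is injective. -/
theorem comp_injective (Φ : X ⥤ Y) [Φ.Faithful] (hΦ : Function.Injective Φ.obj) {G G' : J ⥤ X}
    (h : G ⋙ Φ = G' ⋙ Φ) : G = G' := by
  have h₀ : ∀ j, G.obj j = G'.obj j := fun j => hΦ (Functor.congr_obj h j)
  refine CategoryTheory.Functor.ext h₀ fun i j f => Φ.map_injective ?_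
  have := Functor.congr_hom h f
  simpa [eqToHom_map] using this

/-- A functor from a linear order with a least element to a disjoint union of categories lands in a
summand. -/
theorem exists_comp_incl_eq {Q : Type u} {B : Q → Type u} [∀ i, Category.{u} (B i)] {n : ℕ}
    (F : Fin (n + 1) ⥤ Σ i, B i) : ∃ (i : Q) (G : Fin (n + 1) ⥤ B i), G ⋙ Sigma.incl i = F := by
  refine ⟨(F.obj 0).1, exists_comp_eq _ F fun j => ?_⟩
  have key : ∀ {X Y : Σ i, B i} (_ : X ⟶ Y), ∃ x : B X.1, (Sigma.incl X.1).obj x = Y := by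
    rintro _ _ ⟨f⟩
    exact ⟨_, rfl⟩
  exact key (F.map (homOfLE (Fin.zero_le j)))

end Lifting

namespace Coprod

variable {Q : Type u} {A : Q → TwoCat.{u}}

/-- The inclusion of a summand into a disjoint union. -/
def inclFunctor (A : Q → TwoCat.{u}) (i : Q) : StrictPseudofunctor (A i) (Coprod A) :=
  StrictPseudofunctor.mk''
    { obj x := ⟨i, x⟩
      map f := Hom.mk f
      map₂ η := Hom₂.mk η
      map₂_id _ := rfl
      map₂_comp _ _ := rfl
      map_id _ := rfl
      map_comp _ _ := rfl
      map₂_whisker_left f _ _ η :=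
        have h' : Hom₂.mk (f ◁ η) = whiskerL (Hom.mk f) (Hom₂.mk η) := rfl
        eq_conj_of_heq (A := (⟨i, _⟩ : Coprod A) ⟶ ⟨i, _⟩) rfl rfl (heq_of_eq h')
      map₂_whisker_right η h :=
        have h' : Hom₂.mk (η ▷ h) = whiskerR (Hom₂.mk η) (Hom.mk h) := rfl
        eq_conj_of_heq (A := (⟨i, _⟩ : Coprod A) ⟶ ⟨i, _⟩) rfl rfl (heq_of_eq h') }

/-- The inclusion of a summand into a disjoint union, as a 1-cell of the 2-category of
2-categories. -/
def incl (A : Q → TwoCat.{u}) (i : Q) : A i ⟶ TwoCat.mk (Coprod A) :=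
  inclFunctor A i

theorem incl_comp_map {A' : Q → TwoCat.{u}} (F : ∀ i, A i ⟶ A' i) (i : Q) :
    incl A i ≫ (show TwoCat.mk (Coprod A) ⟶ TwoCat.mk (Coprod A') from
      map (fun i => i) (fun i => TwoCat.fn (F i))) = F i ≫ incl A' i :=
  twoFunctor_ext (fun _ => rfl) (fun _ => HEq.rfl) (fun _ => HEq.rfl)

/-- The 1-cell of a summand underlying a 1-cell of the disjoint union. -/
def unHom {i : Q} {x y : A i} : ((⟨i, x⟩ : Coprod A) ⟶ ⟨i, y⟩) → (x ⟶ y)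
  | Hom.mk f => f

/-- The 2-cell of a summand underlying a 2-cell of the disjoint union. -/
def unHom₂ {i : Q} {x y : A i} {f g : (⟨i, x⟩ : Coprod A) ⟶ ⟨i, y⟩} :
    (f ⟶ g) → (unHom f ⟶ unHom g)
  | Hom₂.mk η => η

theorem mk_unHom {i : Q} {x y : A i} (f : (⟨i, x⟩ : Coprod A) ⟶ ⟨i, y⟩) : Hom.mk (unHom f) = f := by
  obtain ⟨f⟩ := f; rfl

theorem unHom_comp {i : Q} {x y z : A i} (f : (⟨i, x⟩ : Coprod A) ⟶ ⟨i, y⟩)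
    (g : (⟨i, y⟩ : Coprod A) ⟶ ⟨i, z⟩) : unHom (f ≫ g) = unHom f ≫ unHom g := by
  obtain ⟨f⟩ := f; obtain ⟨g⟩ := g; rfl

theorem mk_unHom₂_heq {i : Q} {x y : A i} {f g : (⟨i, x⟩ : Coprod A) ⟶ ⟨i, y⟩} (η : f ⟶ g) :
    Hom₂.mk (unHom₂ η) ≍ η := by
  obtain ⟨η⟩ := η; rfl

theorem unHom₂_heq {i : Q} {x y : A i} {f g f' g' : (⟨i, x⟩ : Coprod A) ⟶ ⟨i, y⟩} {η : f ⟶ g}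
    {η' : f' ⟶ g'} (hf : f = f') (hg : g = g') (h : η ≍ η') : unHom₂ η ≍ unHom₂ η' := by
  subst hf hg; cases h; rfl

theorem unHom₂_id_heq {i : Q} {x y : A i} (f : (⟨i, x⟩ : Coprod A) ⟶ ⟨i, y⟩) :
    unHom₂ (𝟙 f) = 𝟙 (unHom f) := by
  obtain ⟨f⟩ := f; rfl

theorem unHom₂_comp {i : Q} {x y : A i} {f g h : (⟨i, x⟩ : Coprod A) ⟶ ⟨i, y⟩} (η : f ⟶ g)
    (θ : g ⟶ h) : unHom₂ (η ≫ θ) = unHom₂ η ≫ unHom₂ θ := by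
  obtain ⟨η⟩ := η; obtain ⟨θ⟩ := θ; rfl

theorem unHom₂_hcomp_heq {i : Q} {x y z : A i} {f f' : (⟨i, x⟩ : Coprod A) ⟶ ⟨i, y⟩}
    {g g' : (⟨i, y⟩ : Coprod A) ⟶ ⟨i, z⟩} (η : f ⟶ f') (θ : g ⟶ g') :
    unHom₂ (hcomp η θ) ≍ hcomp (unHom₂ η) (unHom₂ θ) := by
  obtain ⟨η⟩ := η; obtain ⟨θ⟩ := θ; rfl

/-- Chains in a disjoint union through objects of a summand are chains of the summand. -/
def unimage {ι : Type} [Preorder ι] {i : Q} (a : ι → A i) :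
    Chain (fun j => (⟨i, a j⟩ : Coprod A)) ⥤ Chain a where
  obj f :=
    { hom h := unHom (f.hom h)
      hom_refl j := congrArg unHom (f.hom_refl j)
      hom_trans h h' := (congrArg unHom (f.hom_trans h h')).trans (unHom_comp _ _) }
  map {f g} α := show ChainHom _ _ from
    { cell h := unHom₂ (ChainHom.cell α h)
      cell_refl j := unHom₂_heq (f.hom_refl j) (g.hom_refl j) (ChainHom.cell_refl α j)
      cell_trans h h' := (unHom₂_heq (f.hom_trans h h') (g.hom_trans h h')
        (ChainHom.cell_trans α h h')).trans (unHom₂_hcomp_heq _ _) }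
  map_id f := ChainHom.ext (by funext i j h; exact unHom₂_id_heq _)
  map_comp α β := ChainHom.ext (by funext i j h; exact unHom₂_comp _ _)

theorem chainHom_heq {ι : Type} [Preorder ι] {B : Type u} [Bicategory.{u, u} B] {c : ι → B}
    {f g f' g' : Chain c} {α : f ⟶ g} {β : f' ⟶ g'} (hf : f = f') (hg : g = g')
    (h : ∀ {i j : ι} (h : i ≤ j), ChainHom.cell α h ≍ ChainHom.cell β h) : α ≍ β := by
  subst hf hg
  exact heq_of_eq (ChainHom.ext (by funext i j k; exact eq_of_heq (h k)))

theorem unimage_comp_image {ι : Type} [Preorder ι] {i : Q} (a : ι → A i) :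
    unimage a ⋙ Chain.image (inclFunctor A i) a = 𝟭 (Chain fun j => (⟨i, a j⟩ : Coprod A)) := by
  have h : ∀ f : Chain (fun j => (⟨i, a j⟩ : Coprod A)),
      (unimage a ⋙ Chain.image (inclFunctor A i) a).obj f = f :=
    fun f => Chain.ext (by funext i j h; exact mk_unHom _)
  exact Functor.hext h fun f g α => chainHom_heq (h f) (h g) fun _ => mk_unHom₂_heq _

/-- The objects of a chain in a disjoint union lie in one summand. -/
theorem exists_of_chain {n : ℕ} {c : Fin (n + 1) → Coprod A} (f : Chain c) :
    ∃ (i : Q) (a : Fin (n + 1) → A i), c = fun j => ⟨i, a j⟩ := by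
  have key : ∀ {X Y : Coprod A} (_ : X ⟶ Y), ∃ x : A X.idx, Y = ⟨X.idx, x⟩ := by
    rintro _ _ ⟨f⟩
    exact ⟨_, rfl⟩
  choose a ha using fun j => key (f.hom (Fin.zero_le j))
  exact ⟨(c 0).idx, a, funext ha⟩

theorem mk_injective {i : Q} {x y : A i} (h : (⟨i, x⟩ : Coprod A) = ⟨i, y⟩) : x = y := by
  cases h; rfl

theorem sigma_incl_injective {J : Type u} {B : J → Type u} [∀ j, Category.{u} (B j)] (j : J) :
    Function.Injective (Sigma.incl j : B j ⥤ Σ j, B j).obj :=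
  fun _ _ h => eq_of_heq (Sigma.mk.inj h).2

/-- The effect of the inclusion of a summand on the nerves. -/
def inclNerve (A : Q → TwoCat.{u}) (i : Q) (n : ℕ) : (Σ a : Fin (n + 1) → A i, Chain a) ⥤
    (Σ c : Fin (n + 1) → Coprod A, Chain c) :=
  sigmaFunctor.{u} (A' := fun c : Fin (n + 1) → Coprod A => Chain c)
    (fun (a : Fin (n + 1) → A i) j => (⟨i, a j⟩ : Coprod A))
    (fun a => Chain.image (inclFunctor A i) a)

/-- Connectedness is used in both directions of the double nerve: a functor on `[n]` stays over one
tuple of objects, and a chain joins the first object of the tuple to all the others, so the tuple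
lies in one summand. -/
theorem exists_comp_inclNerve_eq {n : ℕ} (F : Fin (n + 1) ⥤ Σ c : Fin (n + 1) → Coprod A, Chain c) :
    ∃ (i : Q) (G : Fin (n + 1) ⥤ Σ a : Fin (n + 1) → A i, Chain a), G ⋙ inclNerve A i n = F := by
  obtain ⟨c, G, rfl⟩ := exists_comp_incl_eq F
  obtain ⟨i, a, rfl⟩ := exists_of_chain (G.obj 0)
  refine ⟨i, G ⋙ unimage a ⋙ Sigma.incl a, ?_⟩
  exact congrArg (fun k => G ⋙ k ⋙ Sigma.incl (C := fun c : Fin (n + 1) → Coprod A => Chain c) _)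
    (unimage_comp_image a)

/-- The summand and the tuple of objects are read off from the first value of the functor; after
that, `unimage` undoes the inclusion. -/
theorem eq_of_comp_inclNerve_eq {n : ℕ} {i i' : Q}
    (H : Fin (n + 1) ⥤ Σ a : Fin (n + 1) → A i, Chain a)
    (H' : Fin (n + 1) ⥤ Σ a : Fin (n + 1) → A i', Chain a)
    (h : H ⋙ inclNerve A i n = H' ⋙ inclNerve A i' n) : i = i' ∧ H ≍ H' := by
  obtain ⟨a, G, rfl⟩ := exists_comp_incl_eq H
  obtain ⟨a', G', rfl⟩ := exists_comp_incl_eq H'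
  have h₀ := congrArg Sigma.fst (Functor.congr_obj h 0)
  obtain rfl : i = i' := congrArg (fun c : Fin (n + 1) → Coprod A => (c 0).idx) h₀
  obtain rfl : a = a' := funext fun j => mk_injective (congrFun h₀ j)
  refine ⟨rfl, heq_of_eq (congrArg (fun k => k ⋙ Sigma.incl a) ?_)⟩
  have h₁ : G ⋙ Chain.image (inclFunctor A i) a = G' ⋙ Chain.image (inclFunctor A i) a :=
    comp_injective (Sigma.incl (C := fun c : Fin (n + 1) → Coprod A => Chain c)
      (fun j => ⟨i, a j⟩)) (sigma_incl_injective _) h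
  exact congrArg (fun k => k ⋙ unimage a) h₁

/-- The double nerve of a disjoint union is the coproduct of the double nerves. -/
noncomputable def isColimitNerve (A : Q → TwoCat.{u}) :
    IsColimit (Cofan.mk (diagDoubleNerve.obj (TwoCat.mk (Coprod A)))
      fun i => diagDoubleNerve.map (incl A i)) := by
  refine evaluationJointlyReflectsColimits _ fun m => ?_
  refine (isColimitMapCoconeCofanMkEquiv ((evaluation _ _).obj m) _ _).2 ?_
  refine Classical.choice ((Cofan.nonempty_isColimit_iff_bijective_fromSigma _).2 ⟨?_, ?_⟩)
  · rintro ⟨i, H⟩ ⟨i', H'⟩ h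
    obtain ⟨rfl, h'⟩ := eq_of_comp_inclNerve_eq (n := m.unop.len) H H' h
    cases h'
    rfl
  · intro F
    obtain ⟨i, G, h⟩ := exists_comp_inclNerve_eq (n := m.unop.len) F
    exact ⟨⟨i, G⟩, h⟩

/-- A disjoint union of weak equivalences is a weak equivalence. -/
theorem W_map {A' : Q → TwoCat.{u}} (F : ∀ i, A i ⟶ A' i)
    (hF : ∀ i, W (diagDoubleNerve.map (F i))) :
    W (diagDoubleNerve.map (show TwoCat.mk (Coprod A) ⟶ TwoCat.mk (Coprod A') from
      map (fun i => i) (fun i => TwoCat.fn (F i)))) :=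
  W_of_cofan (isColimitNerve A) (isColimitNerve A') _ (fun i => diagDoubleNerve.map (F i))
    (fun i => by rw [← Functor.map_comp, incl_comp_map, Functor.map_comp]) hF

end Coprod

/-- A map of simplicial 2-categories that is a weak equivalence in each degree induces a homotopy
equivalence on classifying spaces. -/
theorem isHomotopyEquivalence_classifyingSpaceSimplicial {S T : SimplicialObject TwoCat.{u}}
    (F : S ⟶ T) (hF : ∀ p, W (diagDoubleNerve.map (F.app p))) :
    IsHomotopyEquivalence (classifyingSpaceSimplicial.map F) :=
  (W_iff _).1 (W_diag (((SimplicialObject.whiskering _ _).obj diagDoubleNerve).map F) hF)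

end TwoCategory

/-! ### Homotopy invariance -/

theorem mainTheorem2 {C : Type u} [Bicategory.{u, u} C] [Bicategory.Strict C] :
    (∀ (D E : StrictPseudofunctor C TwoCat.{u}) (Γ : TwoNatTrans D E),
      (∀ c : C, IsWeakEquivalence (Γ.app c)) →
        IsHomotopyEquivalence (classifyingSpaceSimplicial.map (hocolimMap Γ))) ∧
    (∀ (D E : StrictPseudofunctor Cᵒᵖ TwoCat.{u}) (Γ : TwoNatTrans D E),
      (∀ c : C, IsWeakEquivalence (Γ.app (op c))) →
        IsHomotopyEquivalence (classifyingSpaceSimplicial.map (hocolimOpMap Γ))) := by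
  refine ⟨fun D E Γ hΓ => ?_, fun D E Γ hΓ => ?_⟩
  · refine isHomotopyEquivalence_classifyingSpaceSimplicial _ fun p => ?_
    -- In degree `p` the map keeps the index tuple `c` and is `Γ × 1` on each summand, so it is a
    -- disjoint union of products of weak equivalences with categories. The contravariant case
    -- differs only in using the last object of the tuple.
    exact Coprod.W_map
      (fun c : Fin (p.unop.len + 1) → C =>
        (show prodCat _ (Chain c) ⟶ prodCat _ (Chain c) from
          prodMap (TwoCat.fn (Γ.app (c 0))) (Chain c)))
      fun c => W_prodMap (Chain c) _ ((RealizationEquivalence.W_iff _).2 (hΓ (c 0)))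
  · refine isHomotopyEquivalence_classifyingSpaceSimplicial _ fun p => ?_
    exact Coprod.W_map
      (fun c : Fin (p.unop.len + 1) → C =>
        (show prodCat _ (Chain c) ⟶ prodCat _ (Chain c) from
          prodMap (TwoCat.fn (Γ.app (op (c (Fin.last _))))) (Chain c)))
      fun c => W_prodMap (Chain c) _ ((RealizationEquivalence.W_iff _).2 (hΓ (c (Fin.last _))))
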